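/- **Setting.** Let $G=\mathbb R^3\times\mathbb R^3$ with coordinates $(x^i,x^*_i)$ and group law $(x,x^*)(y,y^*)=(x^i+y^i,\;x^*_i+y^*_i+\tfrac12\varepsilon_{ijk}x^jy^k)$, where $\varepsilon$ is totally antisymmetric with $\varepsilon_{123}=1$. Let $\Gamma$ be the lattice generated by the three standard basis vectors of the $x$-directions, and $Y=\Gamma\backslash G$. Functions on $Y$ are regarded as functions on the fundamental domain $[0,1)^6$, so $L^2(Y)=L^2([0,1)^6)$ with $\langle\psi|f\rangle=\int\overline{\psi}f$. Let $\mathfrak L$ be the Lie algebra spanned by a central element (acting as $1$) and $W^i,P_i,x^i_n,x^*_{i,n}$ ($1\le i\le3$, $n\in\mathbb Z$), with the only nonzero brackets $$[P_i,P_j]=-\varepsilon_{ijk}W^k,\quad [P_i,x^j_0]=[W^j,x^*_{i,0}]=\delta_i^j,\quad [P_i,x^*_{j,n}]=-\tfrac12\varepsilon_{ijk}x^k_n,\quad [x^*_{i,n},x^j_m]=\tfrac1m\delta_i^j\delta_{m,-n}\ (m\ne0),$$ $$[x^*_{i,m},x^*_{j,n}]=\tfrac{m+n}{2mn}\varepsilon_{ijk}x^k_{m+n}+\tfrac1{m^2}\varepsilon_{ijk}W^k\delta_{m,-n}\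 (m,n\ne0),\quad [x^*_{i,m},x^*_{j,0}]=\tfrac1{2m}\varepsilon_{ijk}x^k_m\ (m\neq0).$$ It acts on smooth functions of $(x,x^*)$ (ground states) by multiplication by $x^i,x^*_i$ for $x^i_0,x^*_{i,0}$, by $W^i=\partial_{x^*_i}$ and $P_i=\partial_{x^i}+\tfrac12\varepsilon_{ijk}x^j\partial_{x^*_k}$, and by $0$ for the modes with $n>0$. Let $\mathcal H$ be the induced $\mathfrak L$-module. For $\psi\in L^2(Y)$ the covector $\langle\psi|$ on $\mathcal H$ kills the image of every mode with $n<0$ and is $f\mapsto\langle\psi|f\rangle$ on ground states. For $\alpha=(w^i)\in\mathbb C^3$ put $e^\alpha=\exp(\sum_i w^ix^*_i)$, a ground state, and $$e^\alpha(z)=e^{\alpha_0}z^{\alpha_l}\exp(\alpha(z)_-)\exp(\alpha(z)_+),\quad \alpha_0=w^ix^*_{i,0},\quad \alpha_l=w^i(P_i-\tfrac12\varepsilon_{ijk}x^j_0W^k),$$ $$\alpha(z)_\pm=w^i\sum_{n\gtrless0}\Bigl(x^*_{i,n}+\tfrac12\log(z)\,\varepsilon_{ijk}W^jx^k_n\Bigr)z^{-n}.$$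 Correlators are formal series in integer powers of the insertion points and nonnegative powers of their logarithms. Put $\varepsilon(\alpha,\beta,\gamma)=\varepsilon_{ijk}w^i_\alpha w^j_\beta w^k_\gamma$ and $L(x)=\mathrm{Li}_2(x)+\tfrac12\log(x)\log(1-x)$. Let $i_{z,w,t}$ denote the formal expansion in the domain $|z|\gg|w|\gg|t|$, i.e. in $\mathbb C[\log z,\log w,\log t][[w/z,t/w]]$. **Proposition.** (1) For all $\alpha,\beta,\gamma,\delta\in\mathbb C^3$ (in particular in $\mathbb Z^3$ or $2\pi\sqrt{-1}\,\mathbb Z^3$) and every $\psi\in L^2(Y)$, $$\langle\psi|e^\alpha(z)e^\beta(w)e^\gamma(t)|e^\delta\rangle=\langle\psi|e^{\alpha+\beta+\gamma+\delta}\rangle\; i_{z,w,t}\exp\Bigl(\varepsilon(\beta,\gamma,\delta)L\bigl(\tfrac tw\bigr)+\varepsilon(\alpha,\beta,\delta)L\bigl(\tfrac wz\bigr)+\varepsilon(\alpha,\gamma,\delta)L\bigl(\tfrac tz\bigr)+\varepsilon(\alpha,\beta,\gamma)L\bigl(\tfrac{w-t}{z-t}\bigr)\Bigr).$$ (2) Let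 $n_1,\dots,n_4\in\mathbb Z^3$, $w_i=2\pi\sqrt{-1}\,n_i$, and write $\alpha,\beta,\gamma,\delta$ for $w_1,\dots,w_4$. If $e^\psi=e^\alpha e^\beta e^\gamma e^\delta$, then $\langle e^\psi|e^\alpha(z)e^\beta(w)e^\gamma(t)|e^\delta\rangle$ equals the expansion of the exponential in (1), and it factors as $$\langle e^{-\alpha}e^\psi|e^\beta(w)e^\gamma(t)|e^\delta\rangle\,\langle e^{-\gamma}e^\psi|e^\alpha(z)e^\beta(w)|e^\delta\rangle\,\langle e^{-\beta}e^\psi|e^\alpha(z)e^\gamma(t)|e^\delta\rangle\,\langle e^{-\delta}e^\psi|e^\alpha(z-t)e^\beta(w-t)|e^\gamma\rangle,$$ each factor (expanded by $i_{z,w,t}$) being a series in the ratio of its two insertion points over the polynomials in their logarithms. With $(z_1,z_2,z_3,z_4)=(z,w,t,0)$ and $j<k<l$ the indices different from $i$, the factor that omits $w_i$ equals $i_{z,w,t}\exp\bigl(\mathrm{vol}(\Delta_{E,i})\,\mathrm{vol}(\Delta_{H,i})\bigr)$. Here $\mathrm{vol}(\Delta_{E,i})=\varepsilon(w_j,w_k,w_l)$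 is the (suitably normalized) oriented volume of the tetrahedron with vertices $0,w_j,w_k,w_l$, and $\mathrm{vol}(\Delta_{H,i})=L\bigl(\tfrac{z_k-z_l}{z_j-z_l}\bigr)$ is the complexified volume of the ideal hyperbolic tetrahedron with vertices $\infty,z_j,z_k,z_l$. -/

import Mathlib

open scoped ContDiff TensorProduct
open MeasureTheory

namespace HDFT

noncomputable section

/-! ## Ground states

`Pt` is the underlying space of the six-dimensional free two-step nilpotent group `G`, with
coordinates `(x, x^*)` and group law
`(x, x^*) (y, y^*) = (x + y, x^* + y^* + (1/2) ε (x, y))`.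
The lattice `Γ` is generated by the three basis vectors `e_i` of the `x`-directions. It contains
`0 × ℤ³` (commutators of the `e_i`) and surjects onto `ℤ³` in the `x`-directions, so the
half-open unit cube `cube` is a fundamental domain for `Γ \ G`, and Haar measure is Lebesgue
measure: the space `L²` of the double twisted torus `Y = Γ \ G` is `L²(cube)`. -/

/-- Points `(x, x^*)` of the group `G`. -/
abbrev Pt := (Fin 3 → ℝ) × (Fin 3 → ℝ)

/-- The fundamental domain `[0,1)^6` of the double twisted torus. -/
def cube : Set Pt := {p | ∀ i, p.1 i ∈ Set.Ico (0 : ℝ) 1 ∧ p.2 i ∈ Set.Ico (0 : ℝ) 1}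

/-- The totally antisymmetric tensor, `eps 0 1 2 = 1`. -/
def eps (i j k : Fin 3) : ℂ :=
  ((((j : ℕ) : ℂ) - ((i : ℕ) : ℂ)) * (((k : ℕ) : ℂ) - ((i : ℕ) : ℂ)) *
    (((k : ℕ) : ℂ) - ((j : ℕ) : ℂ))) / 2

/-- Smooth complex functions of the coordinates `(x, x^*)`; the ground states are such functions
regarded on the fundamental domain `cube`. -/
def Ground : Subalgebra ℂ (Pt → ℂ) where
  carrier := {f | ContDiff ℝ ∞ f}
  mul_mem' := fun {f g} (hf : ContDiff ℝ ∞ f) (hg : ContDiff ℝ ∞ g) => hf.mul hg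
  add_mem' := fun {f g} (hf : ContDiff ℝ ∞ f) (hg : ContDiff ℝ ∞ g) => hf.add hg
  algebraMap_mem' c := (contDiff_const : ContDiff ℝ ∞ (fun _ : Pt => c))

theorem ground_contDiff (f : Ground) : ContDiff ℝ ∞ (f : Pt → ℂ) := f.2

theorem ground_differentiableAt (f : Ground) (p : Pt) : DifferentiableAt ℝ (f : Pt → ℂ) p :=
  (ground_contDiff f).differentiable (by simp) p

/-- The directional derivative of a ground state along `v`. -/
def dirDeriv (v : Pt) : Module.End ℂ Ground where
  toFun f := ⟨fun p => fderiv ℝ (f : Pt → ℂ) p v, by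
    have h : ContDiff ℝ ∞ (fderiv ℝ (f : Pt → ℂ)) := (ground_contDiff f).fderiv_right (by simp)
    exact h.clm_apply contDiff_const⟩
  map_add' f g := Subtype.ext <| funext fun p => by
    change fderiv ℝ ((f : Pt → ℂ) + (g : Pt → ℂ)) p v = _
    rw [fderiv_add (ground_differentiableAt f p) (ground_differentiableAt g p)]
    rfl
  map_smul' c f := Subtype.ext <| funext fun p => by
    change fderiv ℝ (c • (f : Pt → ℂ)) p v = _
    rw [fderiv_const_smul (ground_differentiableAt f p)]
    rfl

/-- `∂ / ∂ x^i` on ground states. -/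
def dX (i : Fin 3) : Module.End ℂ Ground := dirDeriv (Pi.single i 1, 0)

/-- `∂ / ∂ x^*_i` on ground states. -/
def dXs (i : Fin 3) : Module.End ℂ Ground := dirDeriv (0, Pi.single i 1)

/-- The coordinate function `x^i`. -/
def coordX (i : Fin 3) : Ground :=
  ⟨fun p => ((p.1 i : ℝ) : ℂ), by
    change ContDiff ℝ ∞ _
    exact Complex.ofRealCLM.contDiff.comp (by fun_prop)⟩

/-- The coordinate function `x^*_i`. -/
def coordXs (i : Fin 3) : Ground :=
  ⟨fun p => ((p.2 i : ℝ) : ℂ), by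
    change ContDiff ℝ ∞ _
    exact Complex.ofRealCLM.contDiff.comp (by fun_prop)⟩

/-- The exponential ground state `e^w = exp (∑ i, w^i x^*_i)`. -/
def expState (w : Fin 3 → ℂ) : Ground :=
  ⟨fun p => Complex.exp (∑ i, w i * ((p.2 i : ℝ) : ℂ)), by
    change ContDiff ℝ ∞ _
    refine ContDiff.cexp (ContDiff.sum fun i _ => contDiff_const.mul ?_)
    exact Complex.ofRealCLM.contDiff.comp (by fun_prop)⟩

/-- Multiplication by a ground state. -/
def mulG (f : Ground) : Module.End ℂ Ground := LinearMap.mulLeft ℂ f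

/-- The commutator. -/
def comm {R : Type*} [Ring R] (a b : R) : R := a * b - b * a

theorem comm_def {R : Type*} [Ring R] (a b : R) : comm a b = a * b - b * a := rfl

theorem comm_add {R : Type*} [Ring R] (a b c : R) : comm a (b + c) = comm a b + comm a c := by
  simp only [comm, mul_add, add_mul]
  abel

theorem comm_add_left {R : Type*} [Ring R] (a b c : R) : comm (a + b) c = comm a c + comm b c := by
  simp only [comm, mul_add, add_mul]
  abel

theorem comm_smul {R : Type*} [Ring R] [Algebra ℂ R] (t : ℂ) (a b : R) :
    comm a (t • b) = t • comm a b := by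
  simp only [comm, mul_smul_comm, smul_mul_assoc, smul_sub]

theorem comm_smul_left {R : Type*} [Ring R] [Algebra ℂ R] (t : ℂ) (a b : R) :
    comm (t • a) b = t • comm a b := by
  simp only [comm, mul_smul_comm, smul_mul_assoc, smul_sub]

theorem comm_sum {R ι : Type*} [Ring R] (s : Finset ι) (a : R) (f : ι → R) :
    comm a (∑ i ∈ s, f i) = ∑ i ∈ s, comm a (f i) := by
  simp only [comm, Finset.mul_sum, Finset.sum_mul, Finset.sum_sub_distrib]

theorem comm_sum_left {R ι : Type*} [Ring R] (s : Finset ι) (a : R) (f : ι → R) :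
    comm (∑ i ∈ s, f i) a = ∑ i ∈ s, comm (f i) a := by
  simp only [comm, Finset.mul_sum, Finset.sum_mul, Finset.sum_sub_distrib]

theorem comm_swap {R : Type*} [Ring R] [Algebra ℂ R] (a b : R) :
    comm b a = (-1 : ℂ) • comm a b := by
  rw [neg_one_smul, comm, comm, neg_sub]

theorem comm_swap_zero {R : Type*} [Ring R] {a b : R} (h : comm a b = 0) : comm b a = 0 :=
  sub_eq_zero.mpr (sub_eq_zero.mp h).symm

theorem comm_mul_left {R : Type*} [Ring R] (a b c : R) :
    comm (a * b) c = a * comm b c + comm a c * b := by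
  simp only [comm, mul_sub, sub_mul, mul_assoc]
  abel

theorem comm_mul {R : Type*} [Ring R] (a b c : R) :
    comm a (b * c) = comm a b * c + b * comm a c := by
  simp only [comm, mul_sub, sub_mul, mul_assoc]
  abel

/-! ## The algebra of modes and its vacuum modules -/

/-- A vacuum module of the algebra of modes: operators `W^i`, `P_i`, `x^i_n`, `x^*_{i,n}` with the
commutation relations of the modes of the fields `x^i(z)`, `x^*_i(z)` (with `ħ = 1`), containing
the ground states, on which the modes of positive degree vanish and those of degree zero act by
multiplication and differentiation, and equipped with a projection onto the ground states that
annihilates the image of every mode of negative degree. By normal ordering, these properties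
determine every matrix element of a product of modes between a ground state and the projection, so
they are the matrix elements of the module induced from the ground states. -/
structure VacuumModule (V : Type*) [AddCommGroup V] [Module ℂ V] where
  W : Fin 3 → Module.End ℂ V
  P : Fin 3 → Module.End ℂ V
  x : Fin 3 → ℤ → Module.End ℂ V
  xs : Fin 3 → ℤ → Module.End ℂ V
  W_W : ∀ i j, comm (W i) (W j) = 0
  P_W : ∀ i j, comm (P i) (W j) = 0
  P_P : ∀ i j, comm (P i) (P j) = ∑ k, (-eps i j k) • W k
  W_x : ∀ i j n, comm (W i) (x j n) = 0
  W_xs : ∀ i j n, comm (W i) (xs j n) = if i = j ∧ n = 0 then 1 else 0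
  P_x : ∀ i j n, comm (P i) (x j n) = if i = j ∧ n = 0 then 1 else 0
  P_xs : ∀ i j n, comm (P i) (xs j n) = ∑ k, (-(eps i j k) / 2) • x k n
  x_x : ∀ i j m n, comm (x i m) (x j n) = 0
  xs_x : ∀ i j n m, comm (xs i n) (x j m) =
    if i = j ∧ m = -n ∧ m ≠ 0 then ((1 : ℂ) / (m : ℂ)) • 1 else 0
  xs_xs : ∀ i j m n, m ≠ 0 → n ≠ 0 → comm (xs i m) (xs j n) =
    ∑ k, (((m : ℂ) + (n : ℂ)) / (2 * (m : ℂ) * (n : ℂ)) * eps i j k) • x k (m + n) +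
      if m = -n then ∑ k, (eps i j k / (m : ℂ) ^ 2) • W k else 0
  xs_xs_zero : ∀ i j m, m ≠ 0 → comm (xs i m) (xs j 0) =
    ∑ k, (eps i j k / (2 * (m : ℂ))) • x k m
  xs_zero_xs_zero : ∀ i j, comm (xs i 0) (xs j 0) = 0
  vac : Ground →ₗ[ℂ] V
  W_vac : ∀ i f, W i (vac f) = vac (dXs i f)
  P_vac : ∀ i f, P i (vac f) =
    vac (dX i f + ∑ j, ∑ k, (eps i j k / 2) • (coordX j * dXs k f))
  x_zero_vac : ∀ i f, x i 0 (vac f) = vac (coordX i * f)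
  xs_zero_vac : ∀ i f, xs i 0 (vac f) = vac (coordXs i * f)
  x_pos_vac : ∀ i n f, 0 < n → x i n (vac f) = 0
  xs_pos_vac : ∀ i n f, 0 < n → xs i n (vac f) = 0
  proj : V →ₗ[ℂ] Ground
  proj_vac : ∀ f, proj (vac f) = f
  proj_x_neg : ∀ i n v, n < 0 → proj (x i n v) = 0
  proj_xs_neg : ∀ i n v, n < 0 → proj (xs i n v) = 0

/-! ## The Fock space

The module induced from the ground states is realized as the tensor product of the ground states
with polynomials in one creation variable for each `x^i_{-n}` and one for each `x^*_{i,-n}`,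
`n > 0`. The lemmas of this section serve to prove that the operators satisfy the commutation
relations, which is part of the definition of `fockModule`. -/

/-- Index of a creation variable: `(false, i, n)` belongs to `x^i_{-n}`, and `(true, i, n)` to
(the leading part of) `x^*_{i,-n}`; only `n > 0` is used. -/
abbrev OscIdx := Bool × Fin 3 × ℕ+

/-- Polynomials in the creation variables. -/
abbrev Osc := MvPolynomial OscIdx ℂ

/-- The canonical oscillator attached to the species `b`: multiplication by the creation variable
for `n < 0`, zero for `n = 0`, and `-(1/n)` times the derivative in the conjugate creation variable
for `n > 0`. -/
def osc (b : Bool) (i : Fin 3) (n : ℤ) : Module.End ℂ Osc :=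
  if h : 0 < n then
    (-(1 : ℂ) / (n : ℂ)) •
      (MvPolynomial.pderiv ((!b, i, n.toNat.toPNat (by omega)) : OscIdx)).toLinearMap
  else if h : n < 0 then
    LinearMap.mulLeft ℂ (MvPolynomial.X ((b, i, (-n).toNat.toPNat (by omega)) : OscIdx))
  else 0

/-- The nonzero modes of `x^i`. -/
def oX (i : Fin 3) (n : ℤ) : Module.End ℂ Osc := osc false i n

/-- The commuting oscillators conjugate to the nonzero modes of `x^i`. -/
def oY (i : Fin 3) (n : ℤ) : Module.End ℂ Osc := osc true i n

theorem osc_comm (b b' : Bool) (i j : Fin 3) (m n : ℤ) :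
    comm (osc b i m) (osc b' j n) =
      if b ≠ b' ∧ i = j ∧ n = -m ∧ n ≠ 0 then ((1 : ℂ) / (n : ℂ)) • 1 else 0 := by
  have key : ∀ (s t : OscIdx), (MvPolynomial.pderiv s).toLinearMap *
      LinearMap.mulLeft ℂ (MvPolynomial.X t : Osc) =
      LinearMap.mulLeft ℂ (MvPolynomial.X t : Osc) * (MvPolynomial.pderiv s).toLinearMap +
        (if s = t then (1 : Module.End ℂ Osc) else 0) := by
    intro s t
    refine LinearMap.ext fun v => ?_
    by_cases h : s = t
    · subst h
      simp [Derivation.leibniz, add_comm]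
    · simp [Derivation.leibniz, h, MvPolynomial.pderiv_X, Ne.symm h]
  have kd : ∀ (s t : OscIdx), ((MvPolynomial.pderiv s).toLinearMap : Module.End ℂ Osc) *
      ((MvPolynomial.pderiv t).toLinearMap : Module.End ℂ Osc) =
      ((MvPolynomial.pderiv t).toLinearMap : Module.End ℂ Osc) *
      ((MvPolynomial.pderiv s).toLinearMap : Module.End ℂ Osc) := by
    intro s t
    have h0 : ⁅(MvPolynomial.pderiv s : Derivation ℂ Osc Osc), (MvPolynomial.pderiv t : Derivation ℂ Osc Osc)⁆ = 0 := by
      refine MvPolynomial.derivation_ext fun r => ?_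
      rw [Derivation.commutator_apply]
      simp only [MvPolynomial.pderiv_X, Pi.single_apply]
      split_ifs <;> simp
    refine LinearMap.ext fun v => ?_
    have h1 := congrArg (fun D : Derivation ℂ Osc Osc => D v) h0
    simp only [Derivation.commutator_apply, Derivation.coe_zero, Pi.zero_apply] at h1
    exact sub_eq_zero.mp h1
  have km : ∀ (s t : OscIdx), LinearMap.mulLeft ℂ (MvPolynomial.X s : Osc) *
      LinearMap.mulLeft ℂ (MvPolynomial.X t : Osc) =
      LinearMap.mulLeft ℂ (MvPolynomial.X t : Osc) *
      LinearMap.mulLeft ℂ (MvPolynomial.X s : Osc) := by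
    intro s t
    refine LinearMap.ext fun v => ?_
    simp [mul_left_comm]
  rw [comm_def]
  have ie : ∀ (c d : Bool) (i j : Fin 3) (a b : ℕ) (ha : 0 < a) (hb : 0 < b),
      (((c, i, a.toPNat ha) : OscIdx) = (d, j, b.toPNat hb)) ↔ c = d ∧ i = j ∧ a = b := by
    intro c d i j a b ha hb
    refine ⟨fun h => ⟨congrArg (fun x : OscIdx => x.1) h, congrArg (fun x : OscIdx => x.2.1) h,
      congrArg (fun x : OscIdx => (x.2.2 : ℕ)) h⟩, ?_⟩
    rintro ⟨rfl, rfl, rfl⟩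
    rfl
  have nn : ∀ c d : Bool, ((!c) = d) ↔ c ≠ d := by decide
  rcases lt_trichotomy m 0 with hm | hm | hm
  · rcases lt_trichotomy n 0 with hn | hn | hn
    · rw [if_neg (by omega)]
      simp only [osc, hm, hn, hm.not_gt, hn.not_gt, dif_pos, dif_neg, not_false_eq_true]
      rw [km, sub_self]
    · subst hn
      simp [osc]
    · simp only [osc, hm, hn, hm.not_gt, dif_pos, dif_neg, not_false_eq_true]
      rw [smul_mul_assoc, mul_smul_comm, key, smul_add, sub_add_cancel_left]
      by_cases h : b ≠ b' ∧ i = j ∧ n = -m ∧ n ≠ 0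
      · rw [if_pos h, if_pos]
        · rw [← neg_smul, neg_div, neg_neg]
        · obtain ⟨h1, h2, h3, -⟩ := h
          subst h2
          subst h3
          rw [ie, nn]
          exact ⟨Ne.symm h1, rfl, rfl⟩
      · rw [if_neg h, if_neg]
        · simp
        · intro h'
          simp only [ie, nn] at h'
          exact h ⟨Ne.symm h'.1, h'.2.1.symm, by have := h'.2.2; omega, by omega⟩
  · subst hm
    have h0 : osc b i 0 = 0 := by simp [osc]
    rw [h0, if_neg (by omega)]
    simp
  · rcases lt_trichotomy n 0 with hn | hn | hn
    · simp only [osc, hm, hn, hn.not_gt, dif_pos, dif_neg, not_false_eq_true]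
      rw [smul_mul_assoc, mul_smul_comm, key, smul_add, add_sub_cancel_left]
      by_cases h : b ≠ b' ∧ i = j ∧ n = -m ∧ n ≠ 0
      · rw [if_pos h, if_pos]
        · obtain ⟨-, -, h3, -⟩ := h
          subst h3
          push_cast
          rw [neg_div, div_neg]
        · obtain ⟨h1, h2, h3, -⟩ := h
          subst h2
          subst h3
          rw [ie, nn]
          exact ⟨h1, rfl, by omega⟩
      · rw [if_neg h, if_neg]
        · simp
        · intro h'
          simp only [ie, nn] at h'
          exact h ⟨h'.1, h'.2.1, by have := h'.2.2; omega, by omega⟩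
    · subst hn
      simp [osc]
    · rw [if_neg (by omega)]
      simp only [osc, hm, hn, dif_pos]
      rw [smul_mul_assoc, mul_smul_comm, smul_mul_assoc, mul_smul_comm, kd, smul_comm, sub_self]

/-- A polynomial is killed by all annihilation operators of large degree. -/
theorem osc_eventually (b : Bool) (v : Osc) : ∃ N : ℤ, ∀ i n, N < n → osc b i n v = 0 := by
  refine ⟨∑ s ∈ v.vars, (s.2.2 : ℤ), fun i n hn => ?_⟩
  have h0 : 0 < n := lt_of_le_of_lt (Finset.sum_nonneg fun s _ => by positivity) hn
  simp only [osc, h0, dif_pos, LinearMap.smul_apply, Derivation.coeFn_coe]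
  rw [MvPolynomial.pderiv_eq_zero_of_notMem_vars, smul_zero]
  intro hs
  have h1 := Finset.single_le_sum (f := fun s : OscIdx => (s.2.2 : ℤ))
    (fun s _ => by positivity) hs
  have h2 : (((!b, i, n.toNat.toPNat (by omega)) : OscIdx).2.2 : ℕ) = n.toNat := rfl
  omega

/-- The `p`-th term of the quadratic part of `x^*_{i,m}`. -/
def quadTerm (i : Fin 3) (m p : ℤ) : Module.End ℂ Osc :=
  (((m : ℂ) - 2 * (p : ℂ)) / (12 * (m : ℂ))) •
    ∑ j, ∑ k, eps i j k • (oX j p * oX k (m - p))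

theorem oX_comm (i j : Fin 3) (m n : ℤ) : oX i m * oX j n = oX j n * oX i m := by
  have h := osc_comm false false i j m n
  rw [if_neg (by simp), comm_def, sub_eq_zero] at h
  exact h

theorem oY_comm (i j : Fin 3) (m n : ℤ) : oY i m * oY j n = oY j n * oY i m := by
  have h := osc_comm true true i j m n
  rw [if_neg (by simp), comm_def, sub_eq_zero] at h
  exact h

theorem quadTerm_finite (i : Fin 3) (m : ℤ) (v : Osc) :
    (Function.support fun p => quadTerm i m p v).Finite := by
  obtain ⟨N, hN⟩ := osc_eventually false v
  refine (Set.finite_Icc (m - N) N).subset fun p hp => ?_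
  by_contra h
  apply hp
  simp only [Set.mem_Icc, not_and_or, not_le] at h
  simp only [quadTerm, LinearMap.smul_apply, LinearMap.sum_apply, Module.End.mul_apply]
  have : ∀ j k, oX j p (oX k (m - p) v) = 0 := by
    intro j k
    rcases h with h | h
    · rw [show oX k (m - p) v = 0 from hN k _ (by omega), map_zero]
    · have h1 := congrArg (fun T => T v) (oX_comm j k p (m - p))
      simp only [Module.End.mul_apply] at h1
      rw [h1, show oX j p v = 0 from hN j _ h, map_zero]
  simp [this]

/-- The quadratic part of `x^*_{i,m}`, namely
`(1/12) ∑_{p+q=m} ((q-p)/m) ε_{ijk} x^j_p x^k_q` over nonzero `p`, `q`; the sum is locally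
finite. -/
def quad (i : Fin 3) (m : ℤ) : Module.End ℂ Osc where
  toFun v := ∑ᶠ p : ℤ, quadTerm i m p v
  map_add' v w := by
    simp only [map_add]
    exact finsum_add_distrib (quadTerm_finite i m v) (quadTerm_finite i m w)
  map_smul' c v := by
    simp only [map_smul, RingHom.id_apply]
    exact (smul_finsum' c (quadTerm_finite i m v)).symm

theorem eps_swap_left (i j k : Fin 3) : eps j i k = -eps i j k := by
  simp only [eps]
  ring

theorem eps_swap_right (i j k : Fin 3) : eps i k j = -eps i j k := by
  simp only [eps]
  ring

theorem commute_quad (A : Module.End ℂ Osc) (j : Fin 3) (n : ℤ)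
    (h : ∀ p, A * quadTerm j n p = quadTerm j n p * A) : A * quad j n = quad j n * A := by
  refine LinearMap.ext fun v => ?_
  change A (∑ᶠ p : ℤ, quadTerm j n p v) = ∑ᶠ p : ℤ, quadTerm j n p (A v)
  rw [map_finsum A (quadTerm_finite j n v)]
  exact finsum_congr fun p => congrArg (fun T : Module.End ℂ Osc => T v) (h p)

theorem commute_quadTerm (A : Module.End ℂ Osc) (h : ∀ i n, A * oX i n = oX i n * A)
    (j : Fin 3) (n p : ℤ) : A * quadTerm j n p = quadTerm j n p * A := by
  have h2 : ∀ k l q r, A * (oX k q * oX l r) = oX k q * oX l r * A := by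
    intro k l q r
    rw [← mul_assoc, h, mul_assoc, h, ← mul_assoc]
  simp only [quadTerm, mul_smul_comm, smul_mul_assoc, Finset.mul_sum, Finset.sum_mul, h2]

theorem quad_oX_comm (i j : Fin 3) (m n : ℤ) : quad i m * oX j n = oX j n * quad i m :=
  (commute_quad _ i m (commute_quadTerm _ (fun k r => oX_comm j k n r) i m)).symm

theorem quad_quad_comm (i j : Fin 3) (m n : ℤ) : quad i m * quad j n = quad j n * quad i m :=
  commute_quad _ j n (commute_quadTerm _ (fun k r => quad_oX_comm i k m r) j n)

theorem comm_oY_oX (i j : Fin 3) (m n : ℤ) :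
    comm (oY i m) (oX j n) = if i = j ∧ n = -m ∧ n ≠ 0 then ((1 : ℂ) / (n : ℂ)) • 1 else 0 := by
  have h := osc_comm true false i j m n
  simp only [ne_eq, Bool.true_eq_false, not_false_eq_true, true_and] at h
  exact h

theorem comm_oY_quad (i j : Fin 3) (m n : ℤ) (hm : m ≠ 0) (hn : n ≠ 0) :
    comm (oY i m) (quad j n) = ∑ k, (((n : ℂ) + 2 * (m : ℂ)) / (6 * (m : ℂ) * (n : ℂ)) * eps i j k) •
      oX k (m + n) := by
  have hmC : (m : ℂ) ≠ 0 := by exact_mod_cast hm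
  have hnC : (n : ℂ) ≠ 0 := by exact_mod_cast hn
  have hA : ∀ p, comm (oY i m) (quadTerm j n p) =
      (if p = -m then (((n : ℂ) + 2 * (m : ℂ)) / (12 * (n : ℂ)) / (-(m : ℂ))) •
        ∑ k, eps j i k • oX k (m + n) else 0) +
      (if p = n + m then (((n : ℂ) + 2 * (m : ℂ)) / (12 * (n : ℂ)) / (-(m : ℂ))) •
        ∑ k, eps j i k • oX k (m + n) else 0) := by
    intro p
    have h1 : ∀ l k, comm (oY i m) (oX l p * oX k (n - p)) =
        (if p = -m then (if i = l then (1 / (-(m : ℂ))) • oX k (m + n) else 0) else 0) +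
        (if p = n + m then (if i = k then (1 / (-(m : ℂ))) • oX l (m + n) else 0) else 0) := by
      intro l k
      have e : comm (oY i m) (oX l p * oX k (n - p)) =
          comm (oY i m) (oX l p) * oX k (n - p) + oX l p * comm (oY i m) (oX k (n - p)) :=
        comm_mul _ _ _
      rw [e, comm_oY_oX, comm_oY_oX]
      congr 1
      · by_cases hp : p = -m
        · subst hp
          by_cases hl : i = l
          · rw [if_pos ⟨hl, rfl, by omega⟩, if_pos rfl, if_pos hl, sub_neg_eq_add, add_comm n m]
            push_cast
            rw [smul_mul_assoc, one_mul]
          · rw [if_neg (fun h => hl h.1), if_pos rfl, if_neg hl, zero_mul]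
        · rw [if_neg (fun h => hp h.2.1), if_neg hp, zero_mul]
      · by_cases hp : p = n + m
        · subst hp
          by_cases hl : i = k
          · rw [if_pos ⟨hl, by omega, by omega⟩, if_pos rfl, if_pos hl, add_comm n m,
              show n - (m + n) = -m by omega]
            push_cast
            rw [mul_smul_comm, mul_one]
          · rw [if_neg (fun h => hl h.1), if_pos rfl, if_neg hl, mul_zero]
        · rw [if_neg (fun h => hp (by omega)), if_neg hp, mul_zero]
    rw [quadTerm, comm_smul, comm_sum]
    simp only [comm_sum, comm_smul, h1, smul_add, Finset.sum_add_distrib]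
    congr 1
    · by_cases hp : p = -m
      · subst hp
        simp only [if_true, smul_ite, smul_zero]
        rw [Finset.sum_comm]
        simp only [Finset.sum_ite_eq, Finset.mem_univ, if_true, Finset.smul_sum, smul_smul]
        refine Finset.sum_congr rfl fun k _ => ?_
        congr 1
        push_cast
        field_simp
        ring
      · simp [hp]
    · by_cases hp : p = n + m
      · subst hp
        simp only [if_true, smul_ite, smul_zero]
        simp only [Finset.sum_ite_eq, Finset.mem_univ, if_true, Finset.smul_sum, smul_smul]
        refine Finset.sum_congr rfl fun k _ => ?_
        congr 1
        rw [eps_swap_right j i k]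
        push_cast
        field_simp
        ring
      · simp [hp]
  refine LinearMap.ext fun v => ?_
  have h3 : comm (oY i m) (quad j n) v = ∑ᶠ p, comm (oY i m) (quadTerm j n p) v := by
    simp only [comm_def, LinearMap.sub_apply, Module.End.mul_apply]
    change oY i m (∑ᶠ p : ℤ, quadTerm j n p v) - ∑ᶠ p : ℤ, quadTerm j n p (oY i m v) = _
    rw [map_finsum (oY i m) (quadTerm_finite j n v), ← finsum_sub_distrib]
    · exact (quadTerm_finite j n v).subset fun p hp h => hp (by simp [h])
    · exact quadTerm_finite j n _
  rw [h3]
  simp only [hA, LinearMap.add_apply]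
  rw [finsum_add_distrib, finsum_eq_single _ (-m) (fun p hp => by simp [hp]),
    finsum_eq_single _ (n + m) (fun p hp => by simp [hp]), if_pos rfl, if_pos rfl,
    ← LinearMap.add_apply, Finset.smul_sum, ← Finset.sum_add_distrib]
  · congr 1
    refine Finset.sum_congr rfl fun k _ => ?_
    rw [smul_smul, ← add_smul, eps_swap_left i j k]
    congr 1
    field_simp
    ring
  · exact (Set.finite_singleton (-m)).subset fun p hp => by
      by_contra h
      exact hp (by simp [show p ≠ -m from h])
  · exact (Set.finite_singleton (n + m)).subset fun p hp => by
      by_contra h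
      exact hp (by simp [show p ≠ n + m from h])

/-- The oscillator part of `x^*_{i,n}`, `n ≠ 0`. -/
def oYq (i : Fin 3) (n : ℤ) : Module.End ℂ Osc := oY i n + quad i n

theorem comm_oYq_oX (i j : Fin 3) (m n : ℤ) :
    comm (oYq i m) (oX j n) = if i = j ∧ n = -m ∧ n ≠ 0 then ((1 : ℂ) / (n : ℂ)) • 1 else 0 := by
  rw [oYq, comm_add_left, comm_oY_oX, comm_def (quad i m), quad_oX_comm, sub_self, add_zero]

theorem comm_oYq_oYq (i j : Fin 3) (m n : ℤ) (hm : m ≠ 0) (hn : n ≠ 0) :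
    comm (oYq i m) (oYq j n) =
      ∑ k, (((m : ℂ) + (n : ℂ)) / (2 * (m : ℂ) * (n : ℂ)) * eps i j k) • oX k (m + n) := by
  have hmC : (m : ℂ) ≠ 0 := by exact_mod_cast hm
  have hnC : (n : ℂ) ≠ 0 := by exact_mod_cast hn
  have h1 : comm (oY i m) (oY j n) = 0 := by rw [comm_def, oY_comm, sub_self]
  have h2 : comm (quad i m) (quad j n) = 0 := by rw [comm_def, quad_quad_comm, sub_self]
  rw [oYq, oYq, comm_add_left, comm_add, comm_add, h1, h2, zero_add, add_zero, comm_oY_quad i j m n hm hn,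
    comm_swap (oY j n) (quad i m), comm_oY_quad j i n m hn hm, Finset.smul_sum,
    ← Finset.sum_add_distrib]
  refine Finset.sum_congr rfl fun k _ => ?_
  rw [smul_smul, add_comm n m, ← add_smul, eps_swap_left i j k]
  congr 1
  field_simp
  ring

theorem dirDeriv_mul (v : Pt) (f g : Ground) :
    dirDeriv v (f * g) = dirDeriv v f * g + f * dirDeriv v g := Subtype.ext <| funext fun p => by
  change fderiv ℝ ((f : Pt → ℂ) * (g : Pt → ℂ)) p v =
    fderiv ℝ (f : Pt → ℂ) p v * (g : Pt → ℂ) p + (f : Pt → ℂ) p * fderiv ℝ (g : Pt → ℂ) p v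
  rw [fderiv_mul (ground_differentiableAt f p) (ground_differentiableAt g p)]
  simp only [add_apply, smul_apply, smul_eq_mul]
  ring

theorem comm_dirDeriv_mulG (v : Pt) (f : Ground) :
    comm (dirDeriv v) (mulG f) = mulG (dirDeriv v f) := by
  refine LinearMap.ext fun g => ?_
  simp only [comm, mulG, LinearMap.sub_apply, Module.End.mul_apply, LinearMap.mulLeft_apply,
    dirDeriv_mul, add_sub_cancel_right]

theorem comm_mulG_mulG (f g : Ground) : comm (mulG f) (mulG g) = 0 := by
  refine LinearMap.ext fun h => ?_
  simp only [comm, mulG, LinearMap.sub_apply, Module.End.mul_apply, LinearMap.mulLeft_apply,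
    LinearMap.zero_apply, mul_left_comm f g h, sub_self]

theorem comm_dirDeriv_dirDeriv (v w : Pt) : comm (dirDeriv v) (dirDeriv w) = 0 := by
  refine LinearMap.ext fun f => Subtype.ext <| funext fun p => ?_
  have hd : DifferentiableAt ℝ (fderiv ℝ (f : Pt → ℂ)) p := by
    have h : ContDiff ℝ ∞ (fderiv ℝ (f : Pt → ℂ)) := (ground_contDiff f).fderiv_right (by simp)
    exact h.differentiable (by simp) p
  have key : ∀ a b : Pt, fderiv ℝ (fun q => fderiv ℝ (f : Pt → ℂ) q b) p a =
      fderiv ℝ (fderiv ℝ (f : Pt → ℂ)) p a b := by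
    intro a b
    rw [fderiv_clm_apply hd (differentiableAt_const b)]
    simp
  have hs : IsSymmSndFDerivAt ℝ (f : Pt → ℂ) p :=
    (ground_contDiff f).contDiffAt.isSymmSndFDerivAt (by
      rw [minSmoothness_of_isRCLikeNormedField]
      exact WithTop.coe_le_coe.2 le_top)
  change fderiv ℝ (fun q => fderiv ℝ (f : Pt → ℂ) q w) p v -
    fderiv ℝ (fun q => fderiv ℝ (f : Pt → ℂ) q v) p w = 0
  rw [key, key, hs v w, sub_self]

theorem dirDeriv_coordX (v : Pt) (i : Fin 3) :
    dirDeriv v (coordX i) = algebraMap ℂ Ground ((v.1 i : ℝ) : ℂ) :=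
  Subtype.ext <| funext fun p => by
    change fderiv ℝ (Complex.ofRealCLM ∘L ((ContinuousLinearMap.proj i : (Fin 3 → ℝ) →L[ℝ] ℝ) ∘L
      ContinuousLinearMap.fst ℝ (Fin 3 → ℝ) (Fin 3 → ℝ))) p v = ((v.1 i : ℝ) : ℂ)
    rw [ContinuousLinearMap.fderiv]
    rfl

theorem dirDeriv_coordXs (v : Pt) (i : Fin 3) :
    dirDeriv v (coordXs i) = algebraMap ℂ Ground ((v.2 i : ℝ) : ℂ) :=
  Subtype.ext <| funext fun p => by
    change fderiv ℝ (Complex.ofRealCLM ∘L ((ContinuousLinearMap.proj i : (Fin 3 → ℝ) →L[ℝ] ℝ) ∘L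
      ContinuousLinearMap.snd ℝ (Fin 3 → ℝ) (Fin 3 → ℝ))) p v = ((v.2 i : ℝ) : ℂ)
    rw [ContinuousLinearMap.fderiv]
    rfl

theorem mulG_algebraMap (c : ℂ) : mulG (algebraMap ℂ Ground c) = c • 1 := by
  refine LinearMap.ext fun f => ?_
  simp [mulG, Algebra.smul_def]

theorem comm_dX_coordX (i j : Fin 3) :
    comm (dX i) (mulG (coordX j)) = if i = j then 1 else 0 := by
  rw [dX, comm_dirDeriv_mulG, dirDeriv_coordX, mulG_algebraMap]
  by_cases h : i = j
  · subst h
    simp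
  · simp [h, Ne.symm h]

theorem comm_dX_coordXs (i j : Fin 3) : comm (dX i) (mulG (coordXs j)) = 0 := by
  rw [dX, comm_dirDeriv_mulG, dirDeriv_coordXs, mulG_algebraMap]
  simp

theorem comm_dXs_coordX (i j : Fin 3) : comm (dXs i) (mulG (coordX j)) = 0 := by
  rw [dXs, comm_dirDeriv_mulG, dirDeriv_coordX, mulG_algebraMap]
  simp

theorem comm_dXs_coordXs (i j : Fin 3) :
    comm (dXs i) (mulG (coordXs j)) = if i = j then 1 else 0 := by
  rw [dXs, comm_dirDeriv_mulG, dirDeriv_coordXs, mulG_algebraMap]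
  by_cases h : i = j
  · subst h
    simp
  · simp [h, Ne.symm h]

/-- The momentum on ground states, `P_i = ∂/∂x^i + (1/2) ε_{ijk} x^j ∂/∂x^*_k`. -/
def gP (i : Fin 3) : Module.End ℂ Ground :=
  dX i + ∑ j, ∑ k, (eps i j k / 2) • (mulG (coordX j) * dXs k)

theorem comm_gP_dXs (i l : Fin 3) : comm (gP i) (dXs l) = 0 := by
  have h : ∀ j k, comm (mulG (coordX j) * dXs k) (dXs l) = 0 := by
    intro j k
    rw [comm_mul_left, comm_swap_zero (comm_dXs_coordX l j), dXs, dXs, comm_dirDeriv_dirDeriv,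
      zero_mul, mul_zero, add_zero]
  simp only [gP, comm_add_left, comm_sum_left, comm_smul_left, h, smul_zero,
    Finset.sum_const_zero, add_zero]
  exact comm_dirDeriv_dirDeriv _ _

theorem comm_gP_coordX (i l : Fin 3) :
    comm (gP i) (mulG (coordX l)) = if i = l then 1 else 0 := by
  have h : ∀ j k, comm (mulG (coordX j) * dXs k) (mulG (coordX l)) = 0 := by
    intro j k
    rw [comm_mul_left, comm_mulG_mulG, comm_dXs_coordX, zero_mul, mul_zero, add_zero]
  simp only [gP, comm_add_left, comm_sum_left, comm_smul_left, h, smul_zero,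
    Finset.sum_const_zero, add_zero]
  exact comm_dX_coordX i l

theorem comm_gP_coordXs (i l : Fin 3) :
    comm (gP i) (mulG (coordXs l)) = ∑ k, (-(eps i l k) / 2) • mulG (coordX k) := by
  have h : ∀ j k, comm (mulG (coordX j) * dXs k) (mulG (coordXs l)) =
      if l = k then mulG (coordX j) else 0 := by
    intro j k
    rw [comm_mul_left, comm_mulG_mulG, comm_dXs_coordXs, zero_mul, add_zero]
    by_cases hk : k = l
    · simp [hk]
    · simp [hk, Ne.symm hk]
  simp only [gP, comm_add_left, comm_sum_left, comm_smul_left, h, comm_dX_coordXs, zero_add,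
    smul_ite, smul_zero, Finset.sum_ite_eq, Finset.mem_univ, if_true]
  refine Finset.sum_congr rfl fun k _ => ?_
  rw [eps_swap_right i l k]

theorem comm_gP_gP (i j : Fin 3) : comm (gP i) (gP j) = ∑ k, (-eps i j k) • dXs k := by
  have h : ∀ l k, comm (gP i) (mulG (coordX l) * dXs k) = if i = l then dXs k else 0 := by
    intro l k
    rw [comm_mul, comm_gP_coordX, comm_gP_dXs, mul_zero, add_zero]
    split_ifs <;> simp
  have h2 : ∀ l k, comm (mulG (coordX l) * dXs k) (dX j) = if j = l then (-1 : ℂ) • dXs k else 0 := by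
    intro l k
    rw [comm_mul_left, show comm (dXs k) (dX j) = 0 from comm_dirDeriv_dirDeriv _ _,
      comm_swap (dX j) (mulG (coordX l)), comm_dX_coordX, mul_zero, zero_add]
    split_ifs
    · rw [smul_mul_assoc, one_mul]
    · rw [smul_zero, zero_mul]
  have h3 : comm (gP i) (dX j) = ∑ k, (-(eps i j k) / 2) • dXs k := by
    simp only [gP, comm_add_left, comm_sum_left, comm_smul_left, h2, smul_ite, smul_zero]
    rw [show comm (dX i) (dX j) = 0 from comm_dirDeriv_dirDeriv _ _, zero_add, Finset.sum_comm]
    simp only [Finset.sum_ite_eq, Finset.mem_univ, if_true, smul_smul]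
    refine Finset.sum_congr rfl fun k _ => ?_
    congr 1
    ring
  have h4 : comm (gP i) (gP j) = comm (gP i) (dX j) + ∑ k, (eps j i k / 2) • dXs k := by
    conv_lhs => rw [gP.eq_1 j]
    simp only [comm_add, comm_sum, comm_smul, h, smul_ite, smul_zero]
    congr 1
    rw [Finset.sum_comm]
    simp only [Finset.sum_ite_eq, Finset.mem_univ, if_true]
  rw [h4, h3, ← Finset.sum_add_distrib]
  refine Finset.sum_congr rfl fun k _ => ?_
  rw [eps_swap_left i j k, ← add_smul]
  congr 1
  ring

/-- The Fock space: polynomials in the creation variables with ground states as coefficients. -/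
abbrev Fock := Osc ⊗[ℂ] Ground

/-- The operator `A ⊗ B` on the Fock space. -/
def tm (A : Module.End ℂ Osc) (B : Module.End ℂ Ground) : Module.End ℂ Fock :=
  TensorProduct.map A B

theorem tm_mul (A A' : Module.End ℂ Osc) (B B' : Module.End ℂ Ground) :
    tm A B * tm A' B' = tm (A * A') (B * B') := (TensorProduct.map_mul A A' B B').symm

theorem tm_one : tm 1 1 = 1 := TensorProduct.map_one

theorem tm_sub_left (A A' : Module.End ℂ Osc) (B : Module.End ℂ Ground) :
    tm (A - A') B = tm A B - tm A' B := by
  refine TensorProduct.ext' fun a b => ?_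
  simp [tm, TensorProduct.sub_tmul]

theorem tm_sub_right (A : Module.End ℂ Osc) (B B' : Module.End ℂ Ground) :
    tm A (B - B') = tm A B - tm A B' := by
  refine TensorProduct.ext' fun a b => ?_
  simp [tm, TensorProduct.tmul_sub]

theorem tm_smul_left (c : ℂ) (A : Module.End ℂ Osc) (B : Module.End ℂ Ground) :
    tm (c • A) B = c • tm A B := TensorProduct.map_smul_left _ _ _

theorem tm_smul_right (c : ℂ) (A : Module.End ℂ Osc) (B : Module.End ℂ Ground) :
    tm A (c • B) = c • tm A B := TensorProduct.map_smul_right _ _ _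

theorem tm_sum_left {ι : Type*} (s : Finset ι) (A : ι → Module.End ℂ Osc)
    (B : Module.End ℂ Ground) : tm (∑ i ∈ s, A i) B = ∑ i ∈ s, tm (A i) B := by
  refine TensorProduct.ext' fun a b => ?_
  simp [tm, LinearMap.sum_apply, TensorProduct.sum_tmul]

theorem tm_sum_right {ι : Type*} (s : Finset ι) (A : Module.End ℂ Osc)
    (B : ι → Module.End ℂ Ground) : tm A (∑ i ∈ s, B i) = ∑ i ∈ s, tm A (B i) := by
  refine TensorProduct.ext' fun a b => ?_
  simp [tm, LinearMap.sum_apply, TensorProduct.tmul_sum]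

theorem tm_zero_left (B : Module.End ℂ Ground) : tm 0 B = 0 := by
  refine TensorProduct.ext' fun a b => ?_
  simp [tm]

theorem tm_zero_right (A : Module.End ℂ Osc) : tm A 0 = 0 := by
  refine TensorProduct.ext' fun a b => ?_
  simp [tm]

theorem comm_tm_left (A A' : Module.End ℂ Osc) (B B' : Module.End ℂ Ground)
    (h : comm B B' = 0) : comm (tm A B) (tm A' B') = tm (comm A A') (B * B') := by
  rw [comm, tm_mul, tm_mul, ← sub_eq_zero.mp h, comm, tm_sub_left]

theorem comm_tm_right (A A' : Module.End ℂ Osc) (B B' : Module.End ℂ Ground)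
    (h : comm A A' = 0) : comm (tm A B) (tm A' B') = tm (A * A') (comm B B') := by
  rw [comm, tm_mul, tm_mul, ← sub_eq_zero.mp h, comm, tm_sub_right]

theorem comm_one_left {R : Type*} [Ring R] (a : R) : comm 1 a = 0 := by simp [comm]

theorem comm_one_right {R : Type*} [Ring R] (a : R) : comm a 1 = 0 := by simp [comm]

/-- The winding operators. -/
def fW (i : Fin 3) : Module.End ℂ Fock := tm 1 (dXs i)

/-- The momentum operators. -/
def fP (i : Fin 3) : Module.End ℂ Fock := tm 1 (gP i)

/-- The modes of `x^i`. -/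
def fX (i : Fin 3) (n : ℤ) : Module.End ℂ Fock :=
  if n = 0 then tm 1 (mulG (coordX i)) else tm (oX i n) 1

/-- The zero-mode part of `x^*_{i,n}`, `n ≠ 0`. -/
def gZ (j : Fin 3) (n : ℤ) : Module.End ℂ Ground :=
  ((1 : ℂ) / 2) • mulG (coordX j) + ((1 : ℂ) / (2 * (n : ℂ))) • dXs j

/-- The modes of `x^*_i`. -/
def fXs (i : Fin 3) (n : ℤ) : Module.End ℂ Fock :=
  if n = 0 then tm 1 (mulG (coordXs i))
  else tm (oYq i n) 1 + ∑ j, ∑ k, eps i j k • tm (oX k n) (gZ j n)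

theorem comm_dXs_gZ (i j : Fin 3) (n : ℤ) : comm (dXs i) (gZ j n) = 0 := by
  rw [gZ, comm_add, comm_smul, comm_smul, comm_dXs_coordX,
    show comm (dXs i) (dXs j) = 0 from comm_dirDeriv_dirDeriv _ _, smul_zero, smul_zero, add_zero]

theorem comm_gP_gZ (i j : Fin 3) (n : ℤ) :
    comm (gP i) (gZ j n) = if i = j then ((1 : ℂ) / 2) • 1 else 0 := by
  rw [gZ, comm_add, comm_smul, comm_smul, comm_gP_coordX, comm_gP_dXs, smul_zero, add_zero,
    smul_ite, smul_zero]

theorem comm_coordX_gZ (i j : Fin 3) (n : ℤ) : comm (mulG (coordX i)) (gZ j n) = 0 := by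
  rw [gZ, comm_add, comm_smul, comm_smul, comm_mulG_mulG, comm_swap_zero (comm_dXs_coordX j i),
    smul_zero, smul_zero, add_zero]

theorem comm_gZ_coordXs (i j : Fin 3) (n : ℤ) :
    comm (gZ i n) (mulG (coordXs j)) = if i = j then ((1 : ℂ) / (2 * (n : ℂ))) • 1 else 0 := by
  rw [gZ, comm_add_left, comm_smul_left, comm_smul_left, comm_mulG_mulG, comm_dXs_coordXs,
    smul_zero, zero_add, smul_ite, smul_zero]

theorem comm_gZ_gZ (i j : Fin 3) (m n : ℤ) : comm (gZ i m) (gZ j n) = 0 := by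
  rw [gZ.eq_1 i m, comm_add_left, comm_smul_left, comm_smul_left, comm_coordX_gZ, comm_dXs_gZ,
    smul_zero, smul_zero, add_zero]

theorem comm_tm_zero (A A' : Module.End ℂ Osc) (B B' : Module.End ℂ Ground)
    (hA : comm A A' = 0) (hB : comm B B' = 0) : comm (tm A B) (tm A' B') = 0 := by
  rw [comm_tm_left _ _ _ _ hB, hA, tm_zero_left]

theorem comm_oX_oX (i j : Fin 3) (m n : ℤ) : comm (oX i m) (oX j n) = 0 := by
  rw [comm, oX_comm, sub_self]

theorem fX_fX (i j : Fin 3) (m n : ℤ) : comm (fX i m) (fX j n) = 0 := by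
  rw [fX, fX]
  split_ifs
  · exact comm_tm_zero _ _ _ _ (comm_one_left _) (comm_mulG_mulG _ _)
  · exact comm_tm_zero _ _ _ _ (comm_one_left _) (comm_one_right _)
  · exact comm_tm_zero _ _ _ _ (comm_one_right _) (comm_one_left _)
  · exact comm_tm_zero _ _ _ _ (comm_oX_oX i j m n) (comm_one_left _)

theorem fW_fXs (i j : Fin 3) (n : ℤ) :
    comm (fW i) (fXs j n) = if i = j ∧ n = 0 then 1 else 0 := by
  rw [fW, fXs]
  by_cases hn : n = 0
  · rw [if_pos hn, comm_tm_right _ _ _ _ (comm_one_left _), comm_dXs_coordXs]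
    by_cases h : i = j
    · rw [if_pos h, if_pos ⟨h, hn⟩, one_mul, tm_one]
    · rw [if_neg h, if_neg (fun h' => h h'.1), tm_zero_right]
  · rw [if_neg hn, if_neg (fun h => hn h.2), comm_add,
      comm_tm_zero _ _ _ _ (comm_one_left _) (comm_one_right _), zero_add]
    simp only [comm_sum, comm_smul,
      comm_tm_zero _ _ _ _ (comm_one_left _) (comm_dXs_gZ i _ n), smul_zero,
      Finset.sum_const_zero]

theorem fP_fX (i j : Fin 3) (n : ℤ) :
    comm (fP i) (fX j n) = if i = j ∧ n = 0 then 1 else 0 := by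
  rw [fP, fX]
  by_cases hn : n = 0
  · rw [if_pos hn, comm_tm_right _ _ _ _ (comm_one_left _), comm_gP_coordX]
    by_cases h : i = j
    · rw [if_pos h, if_pos ⟨h, hn⟩, one_mul, tm_one]
    · rw [if_neg h, if_neg (fun h' => h h'.1), tm_zero_right]
  · rw [if_neg hn, if_neg (fun h => hn h.2)]
    exact comm_tm_zero _ _ _ _ (comm_one_left _) (comm_one_right _)

theorem fP_fXs (i j : Fin 3) (n : ℤ) :
    comm (fP i) (fXs j n) = ∑ k, (-(eps i j k) / 2) • fX k n := by
  rw [fP, fXs]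
  by_cases hn : n = 0
  · simp only [fX, hn, if_true]
    rw [comm_tm_right _ _ _ _ (comm_one_left _), comm_gP_coordXs, tm_sum_right]
    simp only [tm_smul_right, one_mul]
  · simp only [fX, hn, if_false]
    rw [comm_add, comm_tm_zero _ _ _ _ (comm_one_left _) (comm_one_right _), zero_add]
    simp only [comm_sum, comm_smul, comm_tm_right _ _ _ _ (comm_one_left _), comm_gP_gZ, one_mul]
    rw [Finset.sum_comm]
    refine Finset.sum_congr rfl fun k _ => ?_
    rw [Finset.sum_eq_single i (fun l _ hl => by
      rw [if_neg (Ne.symm hl), tm_zero_right, smul_zero]) (by simp), if_pos rfl, tm_smul_right,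
      smul_smul, eps_swap_left i j k]
    congr 1
    ring

theorem fXs_fX (i j : Fin 3) (n m : ℤ) : comm (fXs i n) (fX j m) =
    if i = j ∧ m = -n ∧ m ≠ 0 then ((1 : ℂ) / (m : ℂ)) • 1 else 0 := by
  rw [fXs, fX]
  by_cases hn : n = 0
  · rw [if_pos hn, if_neg (c := i = j ∧ m = -n ∧ m ≠ 0) (by omega)]
    split_ifs
    · exact comm_tm_zero _ _ _ _ (comm_one_left _) (comm_mulG_mulG _ _)
    · exact comm_tm_zero _ _ _ _ (comm_one_left _) (comm_one_right _)
  · rw [if_neg hn, comm_add_left]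
    by_cases hm : m = 0
    · rw [if_pos hm, if_neg (fun h => h.2.2 hm),
        comm_tm_zero _ _ _ _ (comm_one_right _) (comm_one_left _), zero_add]
      simp only [comm_sum_left, comm_smul_left, comm_tm_zero _ _ _ _ (comm_one_right _)
        (comm_swap_zero (comm_coordX_gZ j _ n)), smul_zero, Finset.sum_const_zero]
    · rw [if_neg hm, comm_tm_left _ _ _ _ (comm_one_left _), comm_oYq_oX, one_mul]
      simp only [comm_sum_left, comm_smul_left, comm_tm_zero _ _ _ _ (comm_oX_oX _ j n m)
        (comm_one_right _), smul_zero, Finset.sum_const_zero, add_zero]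
      split_ifs
      · rw [tm_smul_left, tm_one]
      · rw [tm_zero_left]

theorem fXs_fXs_zero (i j : Fin 3) (m : ℤ) (hm : m ≠ 0) :
    comm (fXs i m) (fXs j 0) = ∑ k, (eps i j k / (2 * (m : ℂ))) • fX k m := by
  simp only [fXs, fX, hm, if_false, if_true]
  rw [comm_add_left, comm_tm_zero _ _ _ _ (comm_one_right _) (comm_one_left _), zero_add]
  simp only [comm_sum_left, comm_smul_left, comm_tm_right _ _ _ _ (comm_one_right _),
    comm_gZ_coordXs, mul_one]
  rw [Finset.sum_comm]
  refine Finset.sum_congr rfl fun k _ => ?_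
  rw [Finset.sum_eq_single j (fun l _ hl => by
    rw [if_neg hl, tm_zero_right, smul_zero]) (by simp), if_pos rfl, tm_smul_right, smul_smul]
  congr 1
  ring

theorem fXs_fXs (i j : Fin 3) (m n : ℤ) (hm : m ≠ 0) (hn : n ≠ 0) :
    comm (fXs i m) (fXs j n) =
    ∑ k, (((m : ℂ) + (n : ℂ)) / (2 * (m : ℂ) * (n : ℂ)) * eps i j k) • fX k (m + n) +
      if m = -n then ∑ k, (eps i j k / (m : ℂ) ^ 2) • fW k else 0 := by
  have h1 : comm (tm (oYq i m) 1) (tm (oYq j n) 1) =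
      ∑ k, (((m : ℂ) + (n : ℂ)) / (2 * (m : ℂ) * (n : ℂ)) * eps i j k) • fX k (m + n) := by
    rw [comm_tm_left _ _ _ _ (comm_one_left _), comm_oYq_oYq i j m n hm hn, tm_sum_left]
    refine Finset.sum_congr rfl fun k _ => ?_
    rw [tm_smul_left, fX]
    by_cases h : m + n = 0
    · have : (m : ℂ) + (n : ℂ) = 0 := by exact_mod_cast h
      simp [this]
    · rw [if_neg h, one_mul]
  have h2 : ∀ (i j : Fin 3) (m n : ℤ), n ≠ 0 →
      comm (tm (oYq i m) 1) (∑ l, ∑ k, eps j l k • tm (oX k n) (gZ l n)) =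
      if n = -m then ∑ l, (eps i j l / (n : ℂ)) • tm 1 (gZ l n) else 0 := by
    intro i j m n hn
    simp only [comm_sum, comm_smul, comm_tm_left _ _ _ _ (comm_one_left _), comm_oYq_oX, one_mul]
    by_cases h : n = -m
    · rw [if_pos h]
      refine Finset.sum_congr rfl fun l _ => ?_
      rw [Finset.sum_eq_single i (fun k _ hk => by
        rw [if_neg (fun h' => hk h'.1.symm), tm_zero_left, smul_zero]) (by simp),
        if_pos ⟨rfl, h, hn⟩, tm_smul_left, smul_smul, eps_swap_right j i l, eps_swap_left i j l]
      congr 1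
      ring
    · rw [if_neg h]
      refine Finset.sum_eq_zero fun l _ => Finset.sum_eq_zero fun k _ => ?_
      rw [if_neg (fun h' => h h'.2.1), tm_zero_left, smul_zero]
  have h3 : comm (∑ l, ∑ k, eps i l k • tm (oX k m) (gZ l m))
      (∑ l, ∑ k, eps j l k • tm (oX k n) (gZ l n)) = 0 := by
    simp only [comm_sum, comm_smul, comm_sum_left, comm_smul_left,
      comm_tm_zero _ _ _ _ (comm_oX_oX _ _ m n) (comm_gZ_gZ _ _ m n), smul_zero,
      Finset.sum_const_zero]
  have h4 : fXs i m = tm (oYq i m) 1 + ∑ l, ∑ k, eps i l k • tm (oX k m) (gZ l m) := if_neg hm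
  have h5 : fXs j n = tm (oYq j n) 1 + ∑ l, ∑ k, eps j l k • tm (oX k n) (gZ l n) := if_neg hn
  rw [h4, h5, comm_add_left, comm_add, comm_add, h1, h3, add_zero, h2 i j m n hn, add_assoc,
    comm_swap (tm (oYq j n) 1), h2 j i n m hm]
  congr 1
  by_cases h : m = -n
  · have h' : n = -m := by omega
    have hC : (m : ℂ) ≠ 0 := by exact_mod_cast hm
    rw [if_pos h, if_pos h, if_pos h', Finset.smul_sum, ← Finset.sum_add_distrib]
    refine Finset.sum_congr rfl fun l _ => ?_
    subst h'
    rw [smul_smul, ← tm_smul_right, ← tm_smul_right, gZ, gZ, fW, ← tm_smul_right,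
      eps_swap_left i j l]
    simp only [smul_add, tm, TensorProduct.map_add_right, smul_smul]
    simp only [TensorProduct.map_smul_right]
    push_cast
    have e1 : eps i j l / -(m : ℂ) * (1 / 2) + -1 * (-eps i j l / (m : ℂ)) * (1 / 2) = 0 := by
      field_simp
      ring
    have e2 : eps i j l / -(m : ℂ) * (1 / (2 * -(m : ℂ))) +
        -1 * (-eps i j l / (m : ℂ)) * (1 / (2 * (m : ℂ))) = eps i j l / (m : ℂ) ^ 2 := by
      field_simp
      ring
    rw [add_add_add_comm, ← add_smul, ← add_smul, e1, e2, zero_smul, zero_add]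
  · rw [if_neg h, if_neg h, if_neg (fun h' => h (by omega)), smul_zero, add_zero]

/-- Evaluation of a polynomial at zero: its constant term. -/
def oscConst : Osc →ₗ[ℂ] ℂ := (MvPolynomial.aeval (fun _ : OscIdx => (0 : ℂ))).toLinearMap

/-- The inclusion of the ground states in the Fock space. -/
def fVac : Ground →ₗ[ℂ] Fock := TensorProduct.mk ℂ Osc Ground 1

/-- The projection of the Fock space onto the ground states (the constant term). -/
def fProj : Fock →ₗ[ℂ] Ground :=
  (TensorProduct.lid ℂ Ground).toLinearMap ∘ₗ TensorProduct.map oscConst LinearMap.id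

theorem osc_one (b : Bool) (i : Fin 3) (n : ℤ) (hn : 0 < n) : osc b i n 1 = 0 := by
  simp only [osc, hn, dif_pos, LinearMap.smul_apply, Derivation.coeFn_coe]
  rw [show (1 : Osc) = MvPolynomial.C 1 by simp, MvPolynomial.pderiv_C, smul_zero]

theorem oscConst_osc (b : Bool) (i : Fin 3) (n : ℤ) (hn : n < 0) (v : Osc) :
    oscConst (osc b i n v) = 0 := by
  simp only [osc, hn, hn.not_gt, dif_pos, dif_neg, not_false_eq_true, LinearMap.mulLeft_apply]
  simp [oscConst]

theorem quad_one (i : Fin 3) (m : ℤ) (hm : 0 < m) : quad i m 1 = 0 := by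
  change ∑ᶠ p : ℤ, quadTerm i m p 1 = 0
  have : ∀ j k p, oX j p (oX k (m - p) 1) = 0 := by
    intro j k p
    rcases le_or_gt p 0 with h | h
    · rw [show oX k (m - p) 1 = 0 from osc_one _ k _ (by omega), map_zero]
    · have h1 := congrArg (fun T : Module.End ℂ Osc => T 1) (oX_comm j k p (m - p))
      simp only [Module.End.mul_apply] at h1
      rw [h1, show oX j p 1 = 0 from osc_one _ j _ h, map_zero]
  simp [quadTerm, this]

theorem oscConst_quad (i : Fin 3) (m : ℤ) (hm : m < 0) (v : Osc) :
    oscConst (quad i m v) = 0 := by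
  change oscConst (∑ᶠ p : ℤ, quadTerm i m p v) = 0
  rw [map_finsum oscConst (quadTerm_finite i m v)]
  have : ∀ j k p, oscConst (oX j p (oX k (m - p) v)) = 0 := by
    intro j k p
    rcases lt_or_ge p 0 with h | h
    · exact oscConst_osc _ j p h _
    · have h1 := congrArg (fun T : Module.End ℂ Osc => T v) (oX_comm j k p (m - p))
      simp only [Module.End.mul_apply] at h1
      rw [h1]
      exact oscConst_osc _ k _ (by omega) _
  simp [quadTerm, this]

theorem fProj_tm (A : Module.End ℂ Osc) (B : Module.End ℂ Ground)
    (h : ∀ v, oscConst (A v) = 0) (v : Fock) : fProj (tm A B v) = 0 := by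
  induction v using TensorProduct.induction_on with
  | zero => simp
  | tmul a f => simp [fProj, tm, h]
  | add a b ha hb => rw [map_add, map_add, ha, hb, add_zero]

/-- The Fock space as a vacuum module of the algebra of modes. -/
def fockModule : VacuumModule Fock where
  W := fW
  P := fP
  x := fX
  xs := fXs
  W_W i j := by
    rw [fW, fW, comm_tm_right _ _ _ _ (comm_one_left _),
      show comm (dXs i) (dXs j) = 0 from comm_dirDeriv_dirDeriv _ _, tm_zero_right]
  P_W i j := by
    rw [fW, fP, comm_tm_right _ _ _ _ (comm_one_left _), comm_gP_dXs, tm_zero_right]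
  P_P i j := by
    rw [fP, fP, comm_tm_right _ _ _ _ (comm_one_left _), comm_gP_gP, tm_sum_right]
    simp only [tm_smul_right, one_mul, fW]
  W_x i j n := by
    rw [fW, fX]
    split_ifs
    · rw [comm_tm_right _ _ _ _ (comm_one_left _), comm_dXs_coordX, tm_zero_right]
    · exact comm_tm_zero _ _ _ _ (comm_one_left _) (comm_one_right _)
  W_xs := fW_fXs
  P_x := fP_fX
  P_xs := fP_fXs
  x_x := fX_fX
  xs_x := fXs_fX
  xs_xs := fXs_fXs
  xs_xs_zero := fXs_fXs_zero
  xs_zero_xs_zero i j := by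
    rw [fXs, fXs, if_pos rfl, if_pos rfl, comm_tm_right _ _ _ _ (comm_one_left _),
      comm_mulG_mulG, tm_zero_right]
  vac := fVac
  W_vac i f := rfl
  P_vac i f := by
    change (1 : Osc) ⊗ₜ[ℂ] (gP i f) = _
    simp only [gP, LinearMap.add_apply, LinearMap.sum_apply, LinearMap.smul_apply,
      Module.End.mul_apply, mulG, LinearMap.mulLeft_apply]
    rfl
  x_zero_vac i f := rfl
  xs_zero_vac i f := rfl
  x_pos_vac i n f hn := by
    rw [fX, if_neg hn.ne']
    change (oX i n 1) ⊗ₜ[ℂ] f = 0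
    rw [show oX i n 1 = 0 from osc_one _ i n hn, TensorProduct.zero_tmul]
  xs_pos_vac i n f hn := by
    have h1 : ∀ k, oX k n 1 = 0 := fun k => osc_one _ k n hn
    have h2 : oYq i n 1 = 0 := by
      rw [oYq, LinearMap.add_apply, quad_one i n hn, show oY i n 1 = 0 from osc_one _ i n hn,
        add_zero]
    rw [fXs, if_neg hn.ne']
    simp [fVac, tm, h1, h2]
  proj := fProj
  proj_vac f := by simp [fProj, fVac, oscConst]
  proj_x_neg i n v hn := by
    rw [fX, if_neg hn.ne]
    exact fProj_tm _ _ (fun w => oscConst_osc _ i n hn w) v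
  proj_xs_neg i n v hn := by
    have h1 : ∀ k w, oscConst (oX k n w) = 0 := fun k w => oscConst_osc _ k n hn w
    have h2 : ∀ w, oscConst (oYq i n w) = 0 := by
      intro w
      rw [oYq, LinearMap.add_apply, map_add, oscConst_quad i n hn,
        show oscConst (oY i n w) = 0 from oscConst_osc _ i n hn w, add_zero]
    rw [fXs, if_neg hn.ne]
    simp only [LinearMap.add_apply, LinearMap.sum_apply, LinearMap.smul_apply, map_add, map_sum,
      map_smul, fProj_tm _ _ h2, fProj_tm _ _ (h1 _), smul_zero, Finset.sum_const_zero, add_zero]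

/-! ## Vertex operators and correlators

The fields are `x^i(z) = W^i log z + ∑ n, x^i_n z^{-n}` and
`x^*_i(z) = P_i log z + ∑ n, x^*_{i,n} z^{-n} + (log z / 2) ε_{ijk} W^j x^k(z)`.
For `α = w^i x^*_i` (winding `w`, no momentum) the vertex operator is
`e^α(z) = e^{α_0} z^{α_l} exp (α(z)_-) exp (α(z)_+)`, where `α_0 = w^i x^*_{i,0}`,
`α_l = w^i Q_i` and `α(z)_±` collects the modes with `n > 0`, respectively `n < 0`. It is handled
through its coefficients at `z^a (log z)^k`. -/

/-- `Q_i = P_i - (1/2) ε_{ijk} x^j_0 W^k`, the coefficient of `log z` in the zero-mode part of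
`x^*_i(z)`. -/
def fQ (i : Fin 3) : Module.End ℂ Fock :=
  fP i - ∑ j, ∑ k, (eps i j k / 2) • (fX j 0 * fW k)

/-- Formal power series in `log z` with coefficients in the operators on the Fock space. -/
abbrev LogOp := PowerSeries (Module.End ℂ Fock)

/-- The coefficient of `z^{-n}`, `n ≠ 0`, in `w^i x^*_i(z)`:
`w^i x^*_{i,n} + (log z / 2) ε_{ijk} w^i W^j x^k_n`. -/
def fieldCoeff (w : Fin 3 → ℂ) (n : ℤ) : LogOp :=
  PowerSeries.mk fun k =>
    if k = 0 then ∑ i, w i • fXs i n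
    else if k = 1 then ∑ i, ∑ j, ∑ l, (eps i j l * w i / 2) • (fW j * fX l n)
    else 0

/-- The annihilation part `α(z)_+`, a power series in `z⁻¹`. -/
def annihilation (w : Fin 3 → ℂ) : PowerSeries LogOp :=
  PowerSeries.mk fun n => if n = 0 then 0 else fieldCoeff w (n : ℤ)

/-- The creation part `α(z)_-`, a power series in `z`. -/
def creation (w : Fin 3 → ℂ) : PowerSeries LogOp :=
  PowerSeries.mk fun n => if n = 0 then 0 else fieldCoeff w (-(n : ℤ))

/-- `z^{α_l} = exp (log z · w^i Q_i)`. -/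
def zPow (w : Fin 3 → ℂ) : LogOp :=
  PowerSeries.mk fun k => (1 / (k.factorial : ℂ)) • (∑ i, w i • fQ i) ^ k

/-- The exponential of a power series without constant term, over a possibly noncommutative
algebra. -/
def serExp {R : Type*} [Ring R] [Algebra ℂ R] (f : PowerSeries R) : PowerSeries R :=
  PowerSeries.mk fun n =>
    PowerSeries.coeff n (∑ N ∈ Finset.range (n + 1), (1 / (N.factorial : ℂ)) • f ^ N)

/-- `e^{α_0}`: multiplication by the exponential of the coordinate function `w^i x^*_i`. -/
def expZero (w : Fin 3 → ℂ) : Module.End ℂ Fock := tm 1 (mulG (expState w))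

/-- The coefficient of `z^a (log z)^k` in `e^α(z) v`. It is the sum over `q` of the terms that take
`z^{-q}` from `exp (α(z)_+)` and `z^{a+q}` from `exp (α(z)_-)`; for given `v` only finitely many of
them are nonzero. -/
def vertex (w : Fin 3 → ℂ) (a : ℤ) (k : ℕ) (v : Fock) : Fock :=
  expZero w (∑ᶠ q : ℕ,
    if 0 ≤ a + (q : ℤ) then
      (PowerSeries.coeff k (zPow w * PowerSeries.coeff (a + (q : ℤ)).toNat (serExp (creation w)) *
        PowerSeries.coeff q (serExp (annihilation w)))) v
    else 0)

/-- The `L²` pairing of `ψ` with a ground state. -/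
def groundPair (ψ : Pt → ℂ) (f : Ground) : ℂ :=
  ∫ p in cube, (starRingEnd ℂ) (ψ p) * (f : Pt → ℂ) p

/-- The covector `⟨ψ|` on the Fock space; it annihilates the image of every creation operator. -/
def bra (ψ : Pt → ℂ) (v : Fock) : ℂ := groundPair ψ (fProj v)

/-- The coefficient of `z_1^a z_2^b (log z_1)^k (log z_2)^l` in the four-point function
`⟨ψ| e^{w_0}(z_1) e^{w_1}(z_2) |e^{w_2}⟩`. -/
def corr4 (ψ : Pt → ℂ) (w : Fin 3 → Fin 3 → ℂ) (a b : ℤ) (k l : ℕ) : ℂ :=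
  bra ψ (vertex (w 0) a k (vertex (w 1) b l (fVac (expState (w 2)))))

/-- The coefficient of `z_1^a z_2^b z_3^c (log z_1)^k (log z_2)^l (log z_3)^m` in the five-point
function `⟨ψ| e^{w_0}(z_1) e^{w_1}(z_2) e^{w_2}(z_3) |e^{w_3}⟩`. -/
def corr5 (ψ : Pt → ℂ) (w : Fin 4 → Fin 3 → ℂ) (a b c : ℤ) (k l m : ℕ) : ℂ :=
  bra ψ (vertex (w 0) a k (vertex (w 1) b l (vertex (w 2) c m (fVac (expState (w 3))))))

/-- The winding vector `2 π i n` attached to `n ∈ ℤ³`; the exponentials `e^{2 π i n}` are the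
characters of the torus fibres and have absolute value one. -/
def winding (n : Fin 3 → ℤ) : Fin 3 → ℂ := fun i => 2 * (Real.pi : ℂ) * Complex.I * (n i : ℂ)

/-! ## Formal expansions in the domain `|z| ≫ |w| ≫ |t|`

In this domain the expansions below are power series in `w/z` and `t/w` whose coefficients are
polynomials in `log z`, `log w`, `log t`. -/

/-- Power series in `w/z` (variable `0`) and `t/w` (variable `1`) over
`ℂ[log z, log w, log t]`. -/
abbrev Ser := MvPowerSeries (Fin 2) (MvPolynomial (Fin 3) ℂ)

/-- `w/z`. -/
def wz : Ser := MvPowerSeries.X 0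

/-- `t/w`. -/
def tw : Ser := MvPowerSeries.X 1

/-- `log z`. -/
def logz : Ser := MvPowerSeries.C (MvPolynomial.X 0)

/-- `log w`. -/
def logw : Ser := MvPowerSeries.C (MvPolynomial.X 1)

/-- `log t`. -/
def logt : Ser := MvPowerSeries.C (MvPolynomial.X 2)

/-- The sum `∑ m, f m` of series such that `f m` has no terms of degree less than `m`. -/
def gradedSum (f : ℕ → Ser) : Ser := fun d =>
  MvPowerSeries.coeff d (∑ m ∈ Finset.range (d.degree + 1), f m)

/-- `exp x`, for `x` without constant term. -/
def formalExp (x : Ser) : Ser := gradedSum fun m => (1 / (m.factorial : ℂ)) • x ^ m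

/-- `1 / (1 - x)`, for `x` without constant term. -/
def geom (x : Ser) : Ser := gradedSum fun m => x ^ m

/-- `log (1 - x)`, for `x` without constant term (the term `m = 0` is zero). -/
def logOneSub (x : Ser) : Ser := gradedSum fun m => (-(1 / (m : ℂ))) • x ^ m

/-- The dilogarithm `Li₂ x`, for `x` without constant term (the term `m = 0` is zero). -/
def li2 (x : Ser) : Ser := gradedSum fun m => (1 / (m : ℂ) ^ 2) • x ^ m

/-- The expansion of a pair of functions `a`, `b` of `z`, `w`, `t` with `|a| ≫ |b|`: the expansions
of `log a`, `log b` and `b/a`. -/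
structure FormalPair where
  logA : Ser
  logB : Ser
  ratio : Ser

/-- The expansion of Roger's dilogarithm `L(b/a) = Li₂(b/a) + (1/2) log(b/a) log(1 - b/a)`. -/
def rogersL (A : FormalPair) : Ser :=
  li2 A.ratio + ((1 : ℂ) / 2) • ((A.logB - A.logA) * logOneSub A.ratio)

/-- The pair `(w, t)`. -/
def pairWT : FormalPair := ⟨logw, logt, tw⟩

/-- The pair `(z, t)`. -/
def pairZT : FormalPair := ⟨logz, logt, wz * tw⟩

/-- The pair `(z, w)`. -/
def pairZW : FormalPair := ⟨logz, logw, wz⟩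

/-- The pair `(z - t, w - t)`, with `z - t = z (1 - t/z)` and `w - t = w (1 - t/w)`. -/
def pairShift : FormalPair :=
  ⟨logz + logOneSub (wz * tw), logw + logOneSub tw, wz * (1 - tw) * geom (wz * tw)⟩

/-- With `(z_0, z_1, z_2, z_3) = (z, w, t, 0)`, the pair `(z_j - z_l, z_k - z_l)` where
`j < k < l` are the indices different from `i`. Its ratio is the cross-ratio of the vertices
`∞, z_j, z_k, z_l` of the `i`-th ideal tetrahedron. -/
def tetraPair : Fin 4 → FormalPair := ![pairWT, pairZT, pairZW, pairShift]

/-- The (complexified) volume of the `i`-th ideal tetrahedron: Roger's dilogarithm at its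
cross-ratio. -/
def hVol (i : Fin 4) : Ser := rogersL (tetraPair i)

/-- The oriented volume `ε(u, v, w) = ε_{ijk} u^i v^j w^k` spanned by three vectors. -/
def eVol (u v w : Fin 3 → ℂ) : ℂ := ∑ i, ∑ j, ∑ k, eps i j k * u i * v j * w k

/-- The value of a series `p` in `b/a` over `ℂ[log a, log b]` at a pair. -/
def evalAt (p : PowerSeries (MvPolynomial (Fin 2) ℂ)) (A : FormalPair) : Ser :=
  gradedSum fun m =>
    MvPolynomial.aeval ![A.logA, A.logB] (PowerSeries.coeff m p) * A.ratio ^ m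

/-- The coefficient of `a^r b^s (log a)^k (log b)^l` in a series in `b/a` over
`ℂ[log a, log b]`. -/
def expand2 (p : PowerSeries (MvPolynomial (Fin 2) ℂ)) (r s : ℤ) (k l : ℕ) : ℂ :=
  if r + s = 0 ∧ 0 ≤ s then
    MvPolynomial.coeff (Finsupp.equivFunOnFinite.symm ![k, l]) (PowerSeries.coeff s.toNat p)
  else 0

/-- The coefficient of `z^a w^b t^c (log z)^k (log w)^l (log t)^m` in an element of `Ser`; the
monomial `(w/z)^r (t/w)^s` is `z^{-r} w^{r-s} t^s`. -/
def expand3 (f : Ser) (a b c : ℤ) (k l m : ℕ) : ℂ :=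
  if a + b + c = 0 ∧ a ≤ 0 ∧ 0 ≤ c then
    MvPolynomial.coeff (Finsupp.equivFunOnFinite.symm ![k, l, m])
      (MvPowerSeries.coeff (Finsupp.equivFunOnFinite.symm ![(-a).toNat, c.toNat]) f)
  else 0

/-- The expansion of
`ε(w_1,w_2,w_3) L(t/w) + ε(w_0,w_1,w_3) L(w/z) + ε(w_0,w_2,w_3) L(t/z)
  + ε(w_0,w_1,w_2) L((w-t)/(z-t))`. -/
def exponent5 (w : Fin 4 → Fin 3 → ℂ) : Ser :=
  eVol (w 1) (w 2) (w 3) • rogersL pairWT + eVol (w 0) (w 1) (w 3) • rogersL pairZW +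
    eVol (w 0) (w 2) (w 3) • rogersL pairZT + eVol (w 0) (w 1) (w 2) • rogersL pairShift

end

end HDFT

/-!
The correlators are matrix elements between a covector that kills the images of the creation modes
and a vacuum that the annihilation modes kill, so they are computed by normal ordering. What makes
this possible is that the modes form a nilpotent Lie algebra: iterated commutators of any three
modes are scalars. Every exponential identity then follows from
`exp x exp y = exp y exp x exp [x, y]`, applied to elements `x`, `y` that commute with `[x, y]`. The
formal series rings in use carry complete filtrations (`Filt`), in which `fexp` is the sum of the
exponential series.

*Zero modes.* The factors `e^{α_0}` are moved to the left by conjugation (`shift`). This shifts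
`W` by the winding vectors that it passes and changes the exponent `α(z)_±` accordingly
(`shift_fieldCoeff`). All remaining operators commute with the winding operators and form the
algebra `WindOp`, whose center contains `W`; they are treated as series in the three logarithms
with coefficients in `WindOp` (`LogRing`). There the powers `z^{α_l}` are exponentials too, and
moving them to the left adds multiples of the logarithms to the coefficients of the modes `x^i_n`
(`fld_mul_expLog`).

*Normal ordering.* The three operators that remain have exponents `∑ u_i x^*_{i,n} + ∑ V_i x^i_n`
with central `V`. The commutator of two opposite modes of such exponents is central, that of two
other modes is a combination of the modes `x^i_n`, and its commutator with a third exponent is a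
scalar. Hence the annihilation parts can be moved to the right, first through the state of the
third operator (`VertexData.annB_creC`), then through that of the second and the third
(`VertexData.annA_state`). Between the covector and the vacuum only the exponential of the central
commutators `VertexData.expo` survives.

*The exponent.* The winding operators vanish on the vacuum, so that there `expo` is a polynomial
in the logarithms (`scalarOn_expo`). The commutators of two exponents give the coefficients of
`L (t / w)`, `L (w / z)` and `L (t / z)`, whereas the iterated commutators of all three give a
double series in `w / z` and `t / w` with the factor `ε(α, β, γ)`. The five-term relation for the
dilogarithm (`five_term`) recognizes this double series, with the contributions of `ε(α, β, γ)` to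
the other terms, as `L ((w - t) / (z - t))` (`rogersL_pairShift`). This gives the five-point
function, `corr5_eq`.

*Factorization.* A vertex operator without winding is the identity (`vertex_zero`), so the
four-point functions are special cases of the five-point function (`corr4_eq`), and the winding
characters have norm one (`groundPair_winding`). The exponent of the five-point function is the
sum of four terms, one for each tetrahedron (`exponent5_eq_sum`). The exponential of each is the
value of one power series at the corresponding ratio (`evalAt_serExp`), and exponentials of
commuting series multiply.
-/

namespace HDFT

/-! ### Exponentials in complete filtered algebras -/

/-- A separated and complete decreasing filtration of a `ℂ`-algebra by subspaces with
`F m * F n ⊆ F (m + n)`. Every formal series ring below carries one, and the exponential series of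
an element of `F 1` converges for it. -/
class Filt (R : Type*) [Ring R] [Algebra ℂ R] where
  F : ℕ → Submodule ℂ R
  mem_zero : ∀ x, x ∈ F 0
  anti : Antitone F
  mul_mem : ∀ {m n : ℕ} {x y : R}, x ∈ F m → y ∈ F n → x * y ∈ F (m + n)
  sep : ∀ x, (∀ n, x ∈ F n) → x = 0
  complete : ∀ f : ℕ → R, (∀ m, f m ∈ F m) → ∃ s, ∀ D, s - ∑ m ∈ Finset.range D, f m ∈ F D

/-- The `D`-th partial sum of the exponential series. -/
noncomputable def expPartial {R : Type*} [Ring R] [Algebra ℂ R] (x : R) (D : ℕ) : R :=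
  ∑ m ∈ Finset.range D, (1 / (m.factorial : ℂ)) • x ^ m

theorem expPartial_zero {R : Type*} [Ring R] [Algebra ℂ R] (D : ℕ) (hD : 0 < D) :
    expPartial (0 : R) D = 1 := by
  rw [expPartial, Finset.sum_eq_single 0 (fun m _ hm => by simp [hm])
    (fun h => absurd (Finset.mem_range.mpr hD) h)]
  simp

/-- `e` is the sum of the exponential series of `x`. -/
def IsExp {R : Type*} [Ring R] [Algebra ℂ R] [Filt R] (x e : R) : Prop :=
  ∀ D, e - expPartial x D ∈ Filt.F D

section Filt

variable {R S : Type*} [Ring R] [Algebra ℂ R] [Filt R] [Ring S] [Algebra ℂ S] [Filt S]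

open Filt

theorem Filt.mono {m n : ℕ} (h : n ≤ m) {x : R} (hx : x ∈ F m) : x ∈ (F n : Submodule ℂ R) :=
  anti h hx

theorem Filt.mul_right {n : ℕ} {x : R} (hx : x ∈ F n) (y : R) :
    x * y ∈ (F n : Submodule ℂ R) := by
  simpa using Filt.mul_mem hx (Filt.mem_zero y)

theorem Filt.mul_left {n : ℕ} {x : R} (y : R) (hx : x ∈ F n) :
    y * x ∈ (F n : Submodule ℂ R) := by
  simpa using Filt.mul_mem (Filt.mem_zero y) hx

theorem Filt.pow_mem {x : R} (hx : x ∈ F 1) (n : ℕ) : x ^ n ∈ (F n : Submodule ℂ R) := by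
  induction n with
  | zero => exact Filt.mem_zero _
  | succ n ih => rw [pow_succ]; exact Filt.mul_mem ih hx

theorem Filt.ext_of {x y : R} (h : ∀ n, x - y ∈ (F n : Submodule ℂ R)) : x = y :=
  sub_eq_zero.mp (Filt.sep _ h)

theorem Filt.comm_mem {m n : ℕ} {x y : R} (hx : x ∈ F m) (hy : y ∈ F n) :
    comm x y ∈ (F (m + n) : Submodule ℂ R) := by
  rw [comm]
  exact Submodule.sub_mem _ (Filt.mul_mem hx hy) (by rw [add_comm]; exact Filt.mul_mem hy hx)

theorem IsExp.unique {x e e' : R} (h : IsExp x e) (h' : IsExp x e') : e = e' :=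
  Filt.ext_of fun D => by
    have := Submodule.sub_mem _ (h D) (h' D)
    simpa using this

theorem exists_isExp {x : R} (hx : x ∈ (F 1 : Submodule ℂ R)) : ∃ e, IsExp x e :=
  Filt.complete (fun m => (1 / (m.factorial : ℂ)) • x ^ m)
    fun m => Submodule.smul_mem _ _ (Filt.pow_mem hx m)

open Classical in
/-- The exponential; it is the sum of the exponential series on `F 1`, and a junk value where the
series does not converge. -/
noncomputable def fexp (x : R) : R := if h : ∃ e, IsExp x e then h.choose else 0

theorem isExp_fexp {x : R} (hx : x ∈ (F 1 : Submodule ℂ R)) : IsExp x (fexp x) := by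
  rw [fexp, dif_pos (exists_isExp hx)]
  exact (exists_isExp hx).choose_spec

theorem IsExp.eq_fexp {x e : R} (h : IsExp x e) : e = fexp x := by
  have h' : ∃ e, IsExp x e := ⟨e, h⟩
  rw [fexp, dif_pos h']
  exact h.unique h'.choose_spec

theorem fexp_zero : fexp (0 : R) = 1 := by
  refine (IsExp.eq_fexp fun D => ?_).symm
  rcases Nat.eq_zero_or_pos D with rfl | hD
  · exact Filt.mem_zero _
  · rw [expPartial_zero D hD, sub_self]; exact Submodule.zero_mem _

theorem fexp_hom (φ : R →ₐ[ℂ] S)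
    (hφ : ∀ n x, x ∈ (F n : Submodule ℂ R) → φ x ∈ (F n : Submodule ℂ S))
    {x : R} (hx : x ∈ (F 1 : Submodule ℂ R)) : φ (fexp x) = fexp (φ x) := by
  refine IsExp.eq_fexp fun D => ?_
  have h := hφ D _ (isExp_fexp hx D)
  simpa [expPartial] using h

theorem fexp_conj {x y u : R} (hx : x ∈ (F 1 : Submodule ℂ R)) (hy : y ∈ (F 1 : Submodule ℂ R))
    (h : x * u = u * y) : fexp x * u = u * fexp y := by
  refine Filt.ext_of fun D => ?_
  have h1 : expPartial x D * u = u * expPartial y D := by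
    rw [expPartial, expPartial, Finset.sum_mul, Finset.mul_sum]
    refine Finset.sum_congr rfl fun m _ => ?_
    rw [smul_mul_assoc, mul_smul_comm]
    congr 1
    have : SemiconjBy u y x := h.symm
    exact (this.pow_right m).symm
  have h2 := Submodule.sub_mem _ (Filt.mul_right (isExp_fexp hx D) u)
    (Filt.mul_left u (isExp_fexp hy D))
  rw [sub_mul, mul_sub, h1] at h2
  simpa using h2

theorem fexp_commute {x u : R} (hx : x ∈ (F 1 : Submodule ℂ R)) (h : Commute x u) :
    Commute (fexp x) u := fexp_conj hx hx h

theorem fexp_add {x y : R} (hx : x ∈ (F 1 : Submodule ℂ R)) (hy : y ∈ (F 1 : Submodule ℂ R))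
    (h : Commute x y) : fexp (x + y) = fexp x * fexp y := by
  refine (IsExp.eq_fexp fun D => ?_).symm
  have h1 : expPartial (x + y) D = ∑ i ∈ Finset.range D,
      ((1 / (i.factorial : ℂ)) • x ^ i) * expPartial y (D - i) := by
    simp only [expPartial, Finset.mul_sum]
    rw [← Finset.sum_range_diag_flip]
    refine Finset.sum_congr rfl fun m _ => ?_
    rw [h.add_pow, Finset.smul_sum]
    refine Finset.sum_congr rfl fun k hk => ?_
    have hk' : k ≤ m := by have := Finset.mem_range.mp hk; omega
    rw [smul_mul_smul_comm, ← nsmul_eq_mul', ← Nat.cast_smul_eq_nsmul ℂ, smul_smul]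
    congr 1
    rw [Nat.cast_choose ℂ hk']
    have := Nat.factorial_ne_zero m
    field_simp
  have h2 : fexp x * fexp y - expPartial x D * fexp y ∈ (F D : Submodule ℂ R) := by
    rw [← sub_mul]; exact Filt.mul_right (isExp_fexp hx D) _
  have h3 : expPartial x D * fexp y - expPartial (x + y) D ∈ (F D : Submodule ℂ R) := by
    rw [h1, expPartial, Finset.sum_mul, ← Finset.sum_sub_distrib]
    refine Submodule.sum_mem _ fun i hi => ?_
    rw [← mul_sub]
    have hi' := Finset.mem_range.mp hi
    have := Filt.mul_mem (Submodule.smul_mem _ (1 / (i.factorial : ℂ)) (Filt.pow_mem hx i))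
      (isExp_fexp hy (D - i))
    rwa [show i + (D - i) = D by omega] at this
  simpa using Submodule.add_mem _ h2 h3

/-- Moving `y` through an exponential, when the commutator commutes with the exponent. -/
theorem mul_fexp {x y h : R} (hx : x ∈ (F 1 : Submodule ℂ R)) (hc : comm y x = h)
    (hxh : Commute h x) : y * fexp x = fexp x * (y + h) := by
  refine Filt.ext_of fun D => ?_
  have hp : ∀ m, y * x ^ (m + 1) = x ^ (m + 1) * y + ((m + 1 : ℕ) : ℂ) • (x ^ m * h) := by
    have hyx : y * x = x * y + h := by rw [← hc, comm]; abel
    intro m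
    induction m with
    | zero => simp [hyx]
    | succ m ih =>
      rw [pow_succ, ← mul_assoc, ih, add_mul, mul_assoc, hyx, mul_add, ← mul_assoc, add_assoc,
        smul_mul_assoc, mul_assoc (x ^ m), hxh.eq, ← mul_assoc (x ^ m), ← pow_succ]
      congr 1
      rw [← pow_succ, Nat.cast_succ (m + 1), add_smul, one_smul, add_comm]
  have h1 : y * expPartial x (D + 1) = expPartial x (D + 1) * y + expPartial x D * h := by
    rw [expPartial, Finset.sum_range_succ', mul_add, add_mul,
      expPartial, Finset.mul_sum, Finset.sum_mul, Finset.sum_mul, add_right_comm,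
      ← Finset.sum_add_distrib]
    congr 1
    · refine Finset.sum_congr rfl fun m _ => ?_
      rw [mul_smul_comm, hp, smul_add, smul_mul_assoc, smul_smul, smul_mul_assoc]
      congr 2
      rw [Nat.factorial_succ]
      push_cast
      have : ((m : ℂ) + 1) ≠ 0 := by exact_mod_cast Nat.succ_ne_zero m
      field_simp
    · simp
  have e1 := Filt.mul_left y (Filt.mono (Nat.le_succ D) (isExp_fexp hx (D + 1)))
  have e2 := Filt.mul_right (Filt.mono (Nat.le_succ D) (isExp_fexp hx (D + 1))) y
  have e3 := Filt.mul_right (isExp_fexp hx D) h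
  have e4 := Submodule.sub_mem _ (Submodule.sub_mem _ e1 e2) e3
  rw [mul_sub, h1, sub_mul, sub_mul] at e4
  rw [mul_add]
  convert e4 using 1
  abel

/-- The Baker–Campbell–Hausdorff formula for a commutator that commutes with both exponents. -/
theorem fexp_mul_fexp {x y h : R} (hx : x ∈ (F 1 : Submodule ℂ R))
    (hy : y ∈ (F 1 : Submodule ℂ R)) (hc : comm x y = h) (hxh : Commute x h) (hyh : Commute y h) :
    fexp x * fexp y = fexp y * (fexp x * fexp h) := by
  have hh : h ∈ (F 1 : Submodule ℂ R) := by
    rw [← hc]; exact Filt.mono (by omega) (Filt.comm_mem hx hy)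
  rw [← fexp_add hx hh hxh]
  exact fexp_conj hx (Submodule.add_mem _ hx hh) (mul_fexp hy hc hyh.symm)

/-- A subspace that contains the limits of its elements. -/
def FiltClosed (J : Submodule ℂ R) : Prop := ∀ x, (∀ D, ∃ y ∈ J, x - y ∈ F D) → x ∈ J

theorem fexp_sub_one_mem {J : Submodule ℂ R} (hJ : FiltClosed J) {x : R}
    (hx : x ∈ (F 1 : Submodule ℂ R)) (hp : ∀ m, x ^ (m + 1) ∈ J) : fexp x - 1 ∈ J := by
  refine hJ _ fun D => ⟨∑ m ∈ Finset.range D, (1 / ((m + 1).factorial : ℂ)) • x ^ (m + 1),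
    Submodule.sum_mem _ fun m _ => Submodule.smul_mem _ _ (hp m), ?_⟩
  have h := Filt.mono (Nat.le_succ D) (isExp_fexp hx (D + 1))
  rw [expPartial, Finset.sum_range_succ'] at h
  convert h using 1
  simp only [Nat.factorial_zero, Nat.cast_one, pow_zero, one_smul, div_one]
  abel

theorem fexp_mem_of_pow_mem {J : Submodule ℂ R} (hJ : FiltClosed J) {x : R}
    (hx : x ∈ (F 1 : Submodule ℂ R)) (hp : ∀ m, x ^ m ∈ J) : fexp x ∈ J :=
  hJ _ fun D => ⟨expPartial x D,
    Submodule.sum_mem _ fun m _ => Submodule.smul_mem _ _ (hp m), isExp_fexp hx D⟩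

end Filt

/-! ### Filtrations of formal power series -/

/-- The trivial filtration, with all elements in degree zero. -/
@[reducible] def Filt.discrete (R : Type*) [Ring R] [Algebra ℂ R] : Filt R where
  F n := if n = 0 then ⊤ else ⊥
  mem_zero x := by simp
  anti m n h := by
    by_cases hn : n = 0
    · simp [hn, show m = 0 by omega]
    · simp [hn]
  mul_mem {m n x y} hx hy := by
    by_cases hm : m = 0 <;> by_cases hn : n = 0 <;> simp_all
  sep x h := by simpa using h 1
  complete f hf := ⟨f 0, fun D => by
    rcases Nat.eq_zero_or_pos D with rfl | hD
    · simp
    · rw [Finset.sum_eq_single 0 (fun m _ hm => by simpa [hm] using hf m)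
        (fun h => absurd (Finset.mem_range.mpr hD) h)]
      simp⟩

/-- The total degree filtration: the formal variable has degree one. -/
noncomputable instance {R : Type*} [Ring R] [Algebra ℂ R] [Filt R] : Filt (PowerSeries R) where
  F D :=
    { carrier := {f | ∀ n, PowerSeries.coeff n f ∈ (Filt.F (D - n) : Submodule ℂ R)}
      add_mem' := fun hf hg n => by
        rw [map_add]; exact Submodule.add_mem _ (hf n) (hg n)
      zero_mem' := fun n => by rw [map_zero]; exact Submodule.zero_mem _
      smul_mem' := fun c f hf n => by
        exact Submodule.smul_mem _ c (hf n) }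
  mem_zero f n := by rw [Nat.zero_sub]; exact Filt.mem_zero _
  anti m n h f hf k := Filt.mono (by omega) (hf k)
  mul_mem {m n f g} hf hg k := by
    rw [PowerSeries.coeff_mul]
    refine Submodule.sum_mem _ fun p hp => ?_
    have := Finset.HasAntidiagonal.mem_antidiagonal.mp hp
    exact Filt.mono (by omega) (Filt.mul_mem (hf p.1) (hg p.2))
  sep f h := by
    refine PowerSeries.ext fun n => ?_
    rw [map_zero]
    refine Filt.sep _ fun k => ?_
    have := h (n + k) n
    rwa [Nat.add_sub_cancel_left] at this
  complete f hf := by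
    have h1 : ∀ n, ∃ s : R, ∀ D, s - ∑ m ∈ Finset.range D, PowerSeries.coeff n (f (n + m)) ∈
        (Filt.F D : Submodule ℂ R) := fun n => Filt.complete _ fun m => by
      have := hf (n + m) n
      rwa [Nat.add_sub_cancel_left] at this
    choose s hs using h1
    refine ⟨PowerSeries.mk fun n => (∑ m ∈ Finset.range n, PowerSeries.coeff n (f m)) + s n,
      fun D n => ?_⟩
    rw [map_sub, PowerSeries.coeff_mk, map_sum]
    rcases le_or_gt D n with h | h
    · rw [show D - n = 0 by omega]; exact Filt.mem_zero _
    · obtain ⟨k, rfl⟩ : ∃ k, D = n + k := ⟨D - n, by omega⟩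
      rw [Finset.sum_range_add, add_sub_add_left_eq_sub, Nat.add_sub_cancel_left]
      exact hs n k

section Coefficients

variable {R : Type*} [Ring R]

theorem commute_of_coeff {f g : PowerSeries R}
    (h : ∀ i j, Commute (PowerSeries.coeff i f) (PowerSeries.coeff j g)) : Commute f g := by
  refine PowerSeries.ext fun n => ?_
  rw [PowerSeries.coeff_mul, PowerSeries.coeff_mul, ← Finset.Nat.sum_antidiagonal_swap]
  exact Finset.sum_congr rfl fun p _ => h _ _

theorem coeff_pow_eq_zero {f : PowerSeries R} (hf : PowerSeries.coeff 0 f = 0) (N n : ℕ)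
    (h : n < N) : PowerSeries.coeff n (f ^ N) = 0 := by
  induction N generalizing n with
  | zero => omega
  | succ N ih =>
    rw [pow_succ, PowerSeries.coeff_mul]
    refine Finset.sum_eq_zero fun p hp => ?_
    have := Finset.HasAntidiagonal.mem_antidiagonal.mp hp
    by_cases h2 : p.2 = 0
    · rw [h2, hf, mul_zero]
    · rw [ih _ (by omega), zero_mul]

variable [Algebra ℂ R]

theorem coeff_smul_complex (c : ℂ) (n : ℕ) (f : PowerSeries R) :
    PowerSeries.coeff n (c • f) = c • PowerSeries.coeff n f := rfl

/-- Constants, as an algebra homomorphism. -/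
noncomputable def cHom (R : Type*) [Ring R] [Algebra ℂ R] : R →ₐ[ℂ] PowerSeries R :=
  { (PowerSeries.C : R →+* PowerSeries R) with
    commutes' := fun r => by
      change PowerSeries.C (algebraMap ℂ R r) = _
      rw [PowerSeries.algebraMap_apply] }

theorem cHom_apply (x : R) : cHom R x = PowerSeries.C x := rfl

/-- The series all of whose coefficients lie in a given subspace. -/
def coeffwise (J : Submodule ℂ R) : Submodule ℂ (PowerSeries R) where
  carrier := {f | ∀ n, PowerSeries.coeff n f ∈ J}
  add_mem' hf hg n := by rw [map_add]; exact Submodule.add_mem _ (hf n) (hg n)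
  zero_mem' n := by rw [map_zero]; exact Submodule.zero_mem _
  smul_mem' c _ hf n := Submodule.smul_mem _ c (hf n)

theorem coeffwise_mul_left {J : Submodule ℂ R} (hJ : ∀ r, ∀ j ∈ J, r * j ∈ J) :
    ∀ f, ∀ g ∈ coeffwise J, f * g ∈ coeffwise J := by
  intro f g hg n
  rw [PowerSeries.coeff_mul]
  exact Submodule.sum_mem _ fun p _ => hJ _ _ (hg _)

theorem coeffwise_mul_right {J : Submodule ℂ R} (hJ : ∀ r, ∀ j ∈ J, j * r ∈ J) :
    ∀ f, ∀ g ∈ coeffwise J, g * f ∈ coeffwise J := by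
  intro f g hg n
  rw [PowerSeries.coeff_mul]
  exact Submodule.sum_mem _ fun p _ => hJ _ _ (hg _)

end Coefficients

section PowerSeries

variable {R S : Type*} [Ring R] [Algebra ℂ R] [Filt R] [Ring S] [Algebra ℂ S] [Filt S]

theorem mem_F_one {f : PowerSeries R} (h : PowerSeries.coeff 0 f ∈ (Filt.F 1 : Submodule ℂ R)) :
    f ∈ (Filt.F 1 : Submodule ℂ (PowerSeries R)) := fun n => by
  rcases Nat.eq_zero_or_pos n with rfl | hn
  · exact h
  · rw [show 1 - n = 0 by omega]; exact Filt.mem_zero _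

theorem cHom_mem (n : ℕ) (x : R) (hx : x ∈ (Filt.F n : Submodule ℂ R)) :
    cHom R x ∈ (Filt.F n : Submodule ℂ (PowerSeries R)) := fun k => by
  rw [cHom_apply, PowerSeries.coeff_C]
  split_ifs with h
  · subst h; exact hx
  · exact Submodule.zero_mem _

theorem mapAlgHom_mem (φ : R →ₐ[ℂ] S)
    (hφ : ∀ n x, x ∈ (Filt.F n : Submodule ℂ R) → φ x ∈ (Filt.F n : Submodule ℂ S)) (n : ℕ)
    (f : PowerSeries R) (hf : f ∈ (Filt.F n : Submodule ℂ (PowerSeries R))) :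
    PowerSeries.mapAlgHom φ f ∈ (Filt.F n : Submodule ℂ (PowerSeries S)) := fun k => by
  rw [PowerSeries.mapAlgHom_apply, PowerSeries.coeff_map]
  exact hφ _ _ (hf k)

theorem serExp_eq_fexp {f : PowerSeries R} (hf : PowerSeries.coeff 0 f = 0) :
    serExp f = fexp f := by
  refine IsExp.eq_fexp fun D n => ?_
  rcases le_or_gt D n with h | h
  · rw [show D - n = 0 by omega]; exact Filt.mem_zero _
  · have : PowerSeries.coeff n (serExp f - expPartial f D) = 0 := by
      rw [map_sub, serExp, PowerSeries.coeff_mk, expPartial, sub_eq_zero, map_sum, map_sum]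
      refine Finset.sum_subset (Finset.range_subset_range.mpr h) fun N _ hN => ?_
      rw [coeff_smul_complex, coeff_pow_eq_zero hf N n (by simpa using hN), smul_zero]
    rw [this]; exact Submodule.zero_mem _

theorem coeffwise_closed {J : Submodule ℂ R} (hJ : FiltClosed J) : FiltClosed (coeffwise J) := by
  intro f hf n
  refine hJ _ fun D => ?_
  obtain ⟨g, hg, h⟩ := hf (n + D)
  have := h n
  rw [Nat.add_sub_cancel_left, map_sub] at this
  exact ⟨_, hg n, this⟩

end PowerSeries

theorem discrete_closed {R : Type*} [Ring R] [Algebra ℂ R] (J : Submodule ℂ R) :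
    @FiltClosed R _ _ (Filt.discrete R) J := by
  intro x hx
  obtain ⟨y, hy, h⟩ := hx 1
  have : x - y = 0 := by simpa [Filt.F] using h
  rwa [sub_eq_zero.mp this]


/-! ### Commutators of linear combinations of modes -/

/-- Elements `W_i`, `x^i_n`, `x^*_{i,n}` (`n ≠ 0`) of an algebra in which `W_i` is central, with the
commutation relations of the nonzero modes. -/
structure ModeRel (R : Type*) [Ring R] [Algebra ℂ R] where
  W : Fin 3 → R
  x : Fin 3 → ℤ → R
  xs : Fin 3 → ℤ → R
  W_central : ∀ i r, Commute (W i) r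
  x_x : ∀ i j m n, m ≠ 0 → n ≠ 0 → comm (x i m) (x j n) = 0
  xs_x : ∀ i j n m, n ≠ 0 → m ≠ 0 → comm (xs i n) (x j m) =
    if i = j ∧ m = -n then ((1 : ℂ) / (m : ℂ)) • 1 else 0
  xs_xs : ∀ i j m n, m ≠ 0 → n ≠ 0 → comm (xs i m) (xs j n) =
    if m = -n then ∑ k, (eps i j k / (m : ℂ) ^ 2) • W k
    else ∑ k, (((m : ℂ) + (n : ℂ)) / (2 * (m : ℂ) * (n : ℂ)) * eps i j k) • x k (m + n)

/-- The vector product `(u × v)_k = ε_{ijk} u_i v_j`. -/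
noncomputable def cross (u v : Fin 3 → ℂ) (k : Fin 3) : ℂ := ∑ i, ∑ j, eps i j k * u i * v j

/-- The bilinear pairing `∑ i, u_i v_i`. -/
noncomputable def dot (u v : Fin 3 → ℂ) : ℂ := ∑ i, u i * v i

theorem dot_cross (a u v : Fin 3 → ℂ) : dot a (cross u v) = eVol u v a := by
  simp only [dot, cross, eVol, Fin.sum_univ_three]
  ring

theorem eVol_self_left (u v : Fin 3 → ℂ) : eVol u v u = 0 := by
  simp only [eVol, eps, Fin.sum_univ_three]
  ring

theorem eVol_self_right (u v : Fin 3 → ℂ) : eVol u v v = 0 := by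
  simp only [eVol, eps, Fin.sum_univ_three]
  ring

theorem comm_eq_zero_of_commute {R : Type*} [Ring R] {a b : R} (h : Commute a b) :
    comm a b = 0 := sub_eq_zero.mpr h.eq

theorem commute_of_comm_eq_zero {R : Type*} [Ring R] {a b : R} (h : comm a b = 0) :
    Commute a b := sub_eq_zero.mp h

theorem comm_central_mul {R : Type*} [Ring R] (a b c : R) (hb : ∀ r, Commute b r) :
    comm a (b * c) = b * comm a c := by
  rw [comm_mul, comm_eq_zero_of_commute (hb a).symm, zero_mul, zero_add]

theorem comm_central_mul_left {R : Type*} [Ring R] (a b c : R) (hb : ∀ r, Commute b r) :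
    comm (b * a) c = b * comm a c := by
  rw [comm_mul_left, comm_eq_zero_of_commute (hb c), zero_mul, add_zero]

namespace ModeRel

variable {R : Type*} [Ring R] [Algebra ℂ R] (M : ModeRel R)

/-- The linear combination `∑ i, v_i x^i_n`. -/
noncomputable def xmode (v : Fin 3 → ℂ) (n : ℤ) : R := ∑ i, v i • M.x i n

/-- The linear combination `∑ i, u_i x^*_{i,n} + ∑ i, V_i x^i_n`. -/
noncomputable def fld (u : Fin 3 → ℂ) (V : Fin 3 → R) (n : ℤ) : R :=
  ∑ i, u i • M.xs i n + ∑ i, V i * M.x i n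

theorem comm_xmode_xmode (u v : Fin 3 → ℂ) {m n : ℤ} (hm : m ≠ 0) (hn : n ≠ 0) :
    comm (M.xmode u m) (M.xmode v n) = 0 := by
  simp only [xmode, comm_sum, comm_sum_left, comm_smul, comm_smul_left, M.x_x _ _ _ _ hm hn,
    smul_zero, Finset.sum_const_zero]

variable {u u' : Fin 3 → ℂ} {V V' : Fin 3 → R}

theorem comm_xs_xV (hV' : ∀ i r, Commute (V' i) r) {m n : ℤ} (hm : m ≠ 0) (hn : n ≠ 0) :
    comm (∑ i, u i • M.xs i m) (∑ i, V' i * M.x i n) =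
      if n = -m then ((1 : ℂ) / (n : ℂ)) • ∑ i, u i • V' i else 0 := by
  simp only [comm_sum, comm_sum_left, comm_smul_left, comm_central_mul _ _ _ (hV' _),
    M.xs_x _ _ _ _ hm hn]
  by_cases h : n = -m
  · rw [if_pos h, Finset.smul_sum]
    refine Finset.sum_congr rfl fun i _ => ?_
    rw [Finset.sum_eq_single i (fun j _ hj => by rw [if_neg (fun h => hj h.1), smul_zero])
      (by simp), if_pos ⟨rfl, h⟩, mul_smul_comm, mul_smul_comm, mul_one, smul_comm]
  · simp [h]

theorem comm_xV_xV (hV : ∀ i r, Commute (V i) r) (hV' : ∀ i r, Commute (V' i) r) {m n : ℤ}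
    (hm : m ≠ 0) (hn : n ≠ 0) : comm (∑ i, V i * M.x i m) (∑ i, V' i * M.x i n) = 0 := by
  simp only [comm_sum, comm_sum_left, comm_central_mul _ _ _ (hV' _),
    comm_central_mul_left _ _ _ (hV _), M.x_x _ _ _ _ hm hn, mul_zero, Finset.sum_const_zero]

theorem comm_fld_xmode (hV : ∀ i r, Commute (V i) r) (v : Fin 3 → ℂ) {m n : ℤ} (hm : m ≠ 0)
    (hn : n ≠ 0) : comm (M.fld u V m) (M.xmode v n) =
      if n = -m then algebraMap ℂ R (dot u v / (n : ℂ)) else 0 := by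
  have h1 : M.xmode v n = ∑ i, algebraMap ℂ R (v i) * M.x i n := by
    simp only [xmode, Algebra.smul_def]
  have hc : ∀ i r, Commute (algebraMap ℂ R (v i)) r := fun i r => Algebra.commutes (v i) r
  rw [h1, fld, comm_add_left, M.comm_xs_xV hc hm hn, M.comm_xV_xV hV hc hm hn, add_zero]
  split_ifs
  · simp only [dot, Algebra.smul_def, ← map_mul, ← map_sum, div_eq_mul_inv, one_mul]
    rw [mul_comm]
  · rfl

theorem comm_fld_fld (hV : ∀ i r, Commute (V i) r) (hV' : ∀ i r, Commute (V' i) r) {m n : ℤ}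
    (hm : m ≠ 0) (hn : n ≠ 0) (h : m + n ≠ 0) : comm (M.fld u V m) (M.fld u' V' n) =
      M.xmode ((((m : ℂ) + n) / (2 * m * n)) • cross u u') (m + n) := by
  rw [fld, fld, comm_add_left, comm_add, comm_add, M.comm_xV_xV hV hV' hm hn,
    M.comm_xs_xV hV' hm hn, comm_swap (∑ i, u' i • M.xs i n) (∑ i, V i * M.x i m),
    M.comm_xs_xV hV hn hm,
    if_neg (by omega), if_neg (by omega), smul_zero, add_zero, add_zero, add_zero]
  simp only [comm_sum, comm_sum_left, comm_smul_left, comm_smul, M.xs_xs _ _ _ _ hm hn,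
    if_neg (show ¬ m = -n by omega), xmode, cross, Pi.smul_apply, smul_eq_mul, Finset.mul_sum,
    Finset.smul_sum, Finset.sum_smul, smul_smul]
  rw [Finset.sum_comm]
  conv_rhs => rw [Finset.sum_comm]
  refine Finset.sum_congr rfl fun i _ => ?_
  rw [Finset.sum_comm]
  refine Finset.sum_congr rfl fun j _ => Finset.sum_congr rfl fun k _ => ?_
  congr 1
  ring

theorem comm_fld_fld_neg (hV : ∀ i r, Commute (V i) r) (hV' : ∀ i r, Commute (V' i) r) {m : ℤ}
    (hm : m ≠ 0) : comm (M.fld u V m) (M.fld u' V' (-m)) =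
      ((1 : ℂ) / (m : ℂ) ^ 2) • ∑ k, cross u u' k • M.W k -
        ((1 : ℂ) / (m : ℂ)) • (∑ i, u i • V' i + ∑ i, u' i • V i) := by
  have hn : -m ≠ 0 := neg_ne_zero.mpr hm
  rw [fld, fld, comm_add_left, comm_add, comm_add, M.comm_xV_xV hV hV' hm hn,
    M.comm_xs_xV hV' hm hn, comm_swap (∑ i, u' i • M.xs i (-m)) (∑ i, V i * M.x i m),
    M.comm_xs_xV hV hn hm,
    if_pos rfl, if_pos (neg_neg m).symm, add_zero, add_assoc, sub_eq_add_neg]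
  congr 1
  · simp only [comm_sum, comm_sum_left, comm_smul_left, comm_smul, M.xs_xs _ _ _ _ hm hn,
      if_pos (neg_neg m).symm, cross, Finset.smul_sum, Finset.sum_smul, smul_smul]
    rw [Finset.sum_comm]
    conv_rhs => rw [Finset.sum_comm]
    refine Finset.sum_congr rfl fun i _ => ?_
    rw [Finset.sum_comm]
    refine Finset.sum_congr rfl fun j _ => Finset.sum_congr rfl fun k _ => ?_
    congr 1
    ring
  · rw [smul_add, neg_add, smul_smul, ← neg_smul, ← neg_smul]
    push_cast
    congr 2
    · rw [div_neg]
    · ring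

end ModeRel

/-! ### Reordering of exponentials -/

section Reorder

variable {T : Type*} [Ring T] [Algebra ℂ T] [Filt T]

open Filt

/-- Reordering a product of four exponentials whose iterated commutators are central. The factors
`Hm`, `Nm`, `Dm` are moved to the left of the annihilation part `A`, and `Hp`, `Dp` to the right of
the creation part `C`. -/
theorem fexp_reorder {A B C Nm H0 Hm Hp D0 Dm Dp K L : T}
    (hA : A ∈ (F 1 : Submodule ℂ T)) (hB : B ∈ (F 1 : Submodule ℂ T))
    (hC : C ∈ (F 1 : Submodule ℂ T)) (hNm : Nm ∈ (F 1 : Submodule ℂ T))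
    (hH0 : H0 ∈ (F 1 : Submodule ℂ T)) (hHm : Hm ∈ (F 1 : Submodule ℂ T))
    (hHp : Hp ∈ (F 1 : Submodule ℂ T)) (hD0 : D0 ∈ (F 1 : Submodule ℂ T))
    (hDm : Dm ∈ (F 1 : Submodule ℂ T)) (hDp : Dp ∈ (F 1 : Submodule ℂ T))
    (hK : K ∈ (F 1 : Submodule ℂ T)) (hL : L ∈ (F 1 : Submodule ℂ T))
    (hAB : comm A B = H0 + Hm + Hp) (hAC : comm A C = D0 + Dm + Dp) (hHpC : comm Hp C = K)
    (hANm : comm A Nm = L)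
    (cH0 : ∀ t, Commute H0 t) (cD0 : ∀ t, Commute D0 t) (cK : ∀ t, Commute K t)
    (cL : ∀ t, Commute L t)
    (AHm : Commute A Hm) (AHp : Commute A Hp) (BHm : Commute B Hm) (BHp : Commute B Hp)
    (HmHp : Commute Hm Hp) (CNm : Commute C Nm) (HpNm : Commute Hp Nm)
    (ADm : Commute A Dm) (ADp : Commute A Dp) (CDm : Commute C Dm) (CDp : Commute C Dp)
    (HpDm : Commute Hp Dm) (HpDp : Commute Hp Dp) (NmDm : Commute Nm Dm) (NmDp : Commute Nm Dp)
    (DmDp : Commute Dm Dp) :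
    fexp A * fexp B * fexp C * fexp Nm =
      fexp B * fexp Hm * fexp C * fexp Nm * fexp Dm * fexp (H0 + D0 + K + L) *
        (fexp A * fexp Hp * fexp Dp) := by
  -- move `A` through `B`, then `A + Hp` through `C + Nm`, by Baker–Campbell–Hausdorff
  have e1 : fexp A * fexp B = fexp B * (fexp A * (fexp H0 * fexp Hm * fexp Hp)) := by
    rw [fexp_mul_fexp hA hB hAB (((cH0 A).symm.add_right AHm).add_right AHp)
      (((cH0 B).symm.add_right BHm).add_right BHp),
      fexp_add (Submodule.add_mem _ hH0 hHm) hHp ((cH0 Hp).add_left HmHp),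
      fexp_add hH0 hHm (cH0 Hm)]
  have ex : fexp (A + Hp) = fexp A * fexp Hp := fexp_add hA hHp AHp
  have ey : fexp (C + Nm) = fexp C * fexp Nm := fexp_add hC hNm CNm
  have hKL : K + L ∈ (F 1 : Submodule ℂ T) := Submodule.add_mem _ hK hL
  have cKL : ∀ t, Commute (K + L) t := fun t => (cK t).add_left (cL t)
  have exy : comm (A + Hp) (C + Nm) = (D0 + (K + L)) + Dm + Dp := by
    rw [comm_add_left, comm_add, comm_add, hAC, hHpC, hANm, comm_eq_zero_of_commute HpNm]
    abel
  have hD0' : D0 + (K + L) ∈ (F 1 : Submodule ℂ T) := Submodule.add_mem _ hD0 hKL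
  have cD0' : ∀ t, Commute (D0 + (K + L)) t := fun t => (cD0 t).add_left (cKL t)
  have e2 : fexp (A + Hp) * fexp (C + Nm) = fexp (C + Nm) *
      (fexp (A + Hp) * (fexp (D0 + (K + L)) * fexp Dm * fexp Dp)) := by
    rw [fexp_mul_fexp (Submodule.add_mem _ hA hHp) (Submodule.add_mem _ hC hNm) exy
      (((cD0' _).symm.add_right (ADm.add_left HpDm)).add_right (ADp.add_left HpDp))
      (((cD0' _).symm.add_right (CDm.add_left NmDm)).add_right (CDp.add_left NmDp)),
      fexp_add (Submodule.add_mem _ hD0' hDm) hDp ((cD0' _).add_left DmDp),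
      fexp_add hD0' hDm (cD0' _)]
  have zH0 : ∀ t, fexp H0 * t = t * fexp H0 := fun t => fexp_commute hH0 (cH0 t)
  have zD0 : ∀ t, fexp (D0 + (K + L)) * t = t * fexp (D0 + (K + L)) :=
    fun t => fexp_commute hD0' (cD0' t)
  have zS : fexp (H0 + D0 + K + L) = fexp H0 * fexp (D0 + (K + L)) := by
    rw [show H0 + D0 + K + L = H0 + (D0 + (K + L)) by abel, fexp_add hH0 hD0' (cH0 _)]
  have mHm : fexp A * fexp Hm = fexp Hm * fexp A :=
    fexp_commute hA (fexp_commute hHm AHm.symm).symm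
  have mDm : fexp (A + Hp) * fexp Dm = fexp Dm * fexp (A + Hp) :=
    fexp_commute (Submodule.add_mem _ hA hHp) (fexp_commute hDm (ADm.add_left HpDm).symm).symm
  have e1' : fexp A * fexp B = fexp B * (fexp Hm * (fexp (A + Hp) * fexp H0)) := by
    rw [e1, mul_assoc (fexp H0), zH0, mul_assoc (fexp Hm), ← mul_assoc (fexp A), mHm, ex]
    simp only [mul_assoc]
  have e2' : fexp (A + Hp) * fexp (C + Nm) =
      fexp (C + Nm) * (fexp Dm * (fexp (A + Hp) * (fexp Dp * fexp (D0 + (K + L))))) := by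
    rw [e2, mul_assoc (fexp (D0 + (K + L))), zD0, mul_assoc (fexp Dm),
      ← mul_assoc (fexp (A + Hp)), mDm]
    simp only [mul_assoc]
  calc fexp A * fexp B * fexp C * fexp Nm
      = fexp B * (fexp Hm * (fexp (A + Hp) * (fexp H0 * fexp (C + Nm)))) := by
        rw [e1', ey]
        simp only [mul_assoc]
    _ = fexp B * (fexp Hm * (fexp (C + Nm) * (fexp Dm *
          (fexp (A + Hp) * (fexp Dp * fexp (D0 + (K + L))))))) * fexp H0 := by
        rw [zH0, ← mul_assoc (fexp (A + Hp)), e2']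
        simp only [mul_assoc]
    _ = fexp B * (fexp Hm * (fexp (C + Nm) * (fexp Dm *
          (fexp (H0 + D0 + K + L) * (fexp (A + Hp) * fexp Dp))))) := by
        rw [zS, mul_assoc (fexp H0), zH0, zD0]
        simp only [mul_assoc]
    _ = _ := by
        rw [ex, ey]
        simp only [mul_assoc]

end Reorder


open PowerSeries (coeff mk)

/-! ### Three vertex operators on a vacuum -/

/-- The data of three vertex operators in an algebra `R` with modes: winding vectors, the (central)
coefficients of the modes `x_n` in the exponents, and the subspaces `Jl`, `Jr` of elements that
vanish to the right of the vacuum covector and to the left of the vacuum. -/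
structure VertexData (R : Type*) [Ring R] [Algebra ℂ R] [Filt R] extends ModeRel R where
  α : Fin 3 → ℂ
  β : Fin 3 → ℂ
  γ : Fin 3 → ℂ
  Va : ℤ → Fin 3 → R
  Vb : ℤ → Fin 3 → R
  Vc : ℤ → Fin 3 → R
  Va_central : ∀ n i r, Commute (Va n i) r
  Vb_central : ∀ n i r, Commute (Vb n i) r
  Vc_central : ∀ n i r, Commute (Vc n i) r
  Jl : Submodule ℂ R
  Jr : Submodule ℂ R
  Jl_closed : FiltClosed Jl
  Jr_closed : FiltClosed Jr
  Jl_mul : ∀ r, ∀ j ∈ Jl, j * r ∈ Jl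
  mul_Jr : ∀ r, ∀ j ∈ Jr, r * j ∈ Jr
  x_Jr : ∀ i n, 0 < n → x i n ∈ Jr
  xs_Jr : ∀ i n, 0 < n → xs i n ∈ Jr
  x_Jl : ∀ i n, n < 0 → x i n ∈ Jl
  xs_Jl : ∀ i n, n < 0 → xs i n ∈ Jl

section Tri

variable {R : Type*} [Ring R]

/-- The series `∑ f n c e · ζ^n b^c w^e` in three variables. -/
noncomputable def tri (f : ℕ → ℕ → ℕ → R) : PowerSeries (PowerSeries (PowerSeries R)) :=
  mk fun n => mk fun c => mk fun e => f n c e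

theorem coeff_tri (f : ℕ → ℕ → ℕ → R) (n c e : ℕ) :
    coeff e (coeff c (coeff n (tri f))) = f n c e := by
  simp only [tri, PowerSeries.coeff_mk]

theorem tri_ext {g h : PowerSeries (PowerSeries (PowerSeries R))}
    (H : ∀ n c e, coeff e (coeff c (coeff n g)) = coeff e (coeff c (coeff n h))) : g = h :=
  PowerSeries.ext fun n => PowerSeries.ext fun c => PowerSeries.ext fun e => H n c e

theorem commute_tri {f g : ℕ → ℕ → ℕ → R} (h : ∀ n c e n' c' e', Commute (f n c e) (g n' c' e')) :
    Commute (tri f) (tri g) := by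
  refine commute_of_coeff fun n n' => commute_of_coeff fun c c' => commute_of_coeff fun e e' => ?_
  rw [coeff_tri, coeff_tri]
  exact h n c e n' c' e'

theorem commute_tri_central {f : ℕ → ℕ → ℕ → R} (h : ∀ n c e r, Commute (f n c e) r)
    (t : PowerSeries (PowerSeries (PowerSeries R))) : Commute (tri f) t := by
  refine commute_of_coeff fun n n' => commute_of_coeff fun c c' => commute_of_coeff fun e e' => ?_
  rw [coeff_tri]
  exact h n c e _

theorem tri_add (f g : ℕ → ℕ → ℕ → R) : tri f + tri g = tri (fun n c e => f n c e + g n c e) :=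
  tri_ext fun n c e => by simp only [map_add, coeff_tri]

variable [Algebra ℂ R]

theorem tri_mem_coeffwise {J : Submodule ℂ R} {f : ℕ → ℕ → ℕ → R} (h : ∀ n c e, f n c e ∈ J) :
    tri f ∈ coeffwise (coeffwise (coeffwise J)) := fun n c e => by
  rw [coeff_tri]
  exact h n c e

variable [Filt R]

theorem tri_mem_F_one {f : ℕ → ℕ → ℕ → R} (h : f 0 0 0 = 0) :
    tri f ∈ (Filt.F 1 : Submodule ℂ (PowerSeries (PowerSeries (PowerSeries R)))) := by
  refine mem_F_one (mem_F_one (mem_F_one ?_))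
  rw [coeff_tri, h]
  exact Submodule.zero_mem _

end Tri

section LowerSupport

variable (R : Type*) [Ring R] [Algebra ℂ R]

/-- The series in `ζ`, `b`, `w` in which the exponent of `ζ` never exceeds that of `w`. -/
def lowerSupport : Submodule ℂ (PowerSeries (PowerSeries (PowerSeries R))) where
  carrier := {f | ∀ n c e, e < n → coeff e (coeff c (coeff n f)) = 0}
  add_mem' hf hg n c e h := by
    rw [map_add, map_add, map_add, hf n c e h, hg n c e h, add_zero]
  zero_mem' n c e _ := by rw [map_zero, map_zero, map_zero]
  smul_mem' z f hf n c e h := by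
    rw [coeff_smul_complex, coeff_smul_complex, coeff_smul_complex, hf n c e h, smul_zero]

variable {R}

theorem lowerSupport_one : (1 : PowerSeries (PowerSeries (PowerSeries R))) ∈ lowerSupport R := by
  intro n c e h
  rw [PowerSeries.coeff_one, if_neg (by omega), map_zero, map_zero]

theorem lowerSupport_mul {f g : PowerSeries (PowerSeries (PowerSeries R))}
    (hf : f ∈ lowerSupport R) (hg : g ∈ lowerSupport R) : f * g ∈ lowerSupport R := by
  intro n c e h
  rw [PowerSeries.coeff_mul, map_sum, map_sum]
  refine Finset.sum_eq_zero fun p hp => ?_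
  rw [PowerSeries.coeff_mul, map_sum]
  refine Finset.sum_eq_zero fun p' _ => ?_
  rw [PowerSeries.coeff_mul]
  refine Finset.sum_eq_zero fun p'' hp'' => ?_
  have h1 := Finset.HasAntidiagonal.mem_antidiagonal.mp hp
  have h2 := Finset.HasAntidiagonal.mem_antidiagonal.mp hp''
  by_cases h3 : p''.1 < p.1
  · rw [hf _ _ _ h3, zero_mul]
  · rw [hg _ _ _ (show p''.2 < p.2 by omega), mul_zero]

theorem lowerSupport_pow {f : PowerSeries (PowerSeries (PowerSeries R))}
    (hf : f ∈ lowerSupport R) (m : ℕ) : f ^ m ∈ lowerSupport R := by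
  induction m with
  | zero => rw [pow_zero]; exact lowerSupport_one
  | succ m ih => rw [pow_succ]; exact lowerSupport_mul ih hf

theorem tri_mem_lowerSupport {f : ℕ → ℕ → ℕ → R} (h : ∀ n c e, e < n → f n c e = 0) :
    tri f ∈ lowerSupport R := fun n c e hn => by
  rw [coeff_tri, h n c e hn]

variable [Filt R]

theorem lowerSupport_closed : FiltClosed (lowerSupport R) := by
  intro x hx n c e h
  refine Filt.sep _ fun D => ?_
  obtain ⟨y, hy, hxy⟩ := hx (D + n + c + e)
  have := hxy n c e
  rw [map_sub, map_sub, map_sub, hy n c e h, sub_zero] at this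
  exact Filt.mono (by omega) this

theorem lowerSupport_fexp {f : PowerSeries (PowerSeries (PowerSeries R))}
    (h1 : f ∈ (Filt.F 1 : Submodule ℂ _)) (hf : f ∈ lowerSupport R) : fexp f ∈ lowerSupport R :=
  fexp_mem_of_pow_mem lowerSupport_closed h1 (lowerSupport_pow hf)

end LowerSupport

section Reflect

variable {R : Type*} [Ring R]

/-- The series `f` in `t` (outer variable) and `w⁻¹` corresponds to the series `g` in `b = t / w`
(outer variable) and `w`. -/
def Reflect (f g : PowerSeries (PowerSeries R)) : Prop :=
  ∀ c, (∀ q, c < q → coeff q (coeff c f) = 0) ∧ (∀ e, c < e → coeff e (coeff c g) = 0) ∧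
    ∀ q e, q + e = c → coeff q (coeff c f) = coeff e (coeff c g)

theorem Reflect.zero : Reflect (0 : PowerSeries (PowerSeries R)) 0 := fun c => by simp

theorem Reflect.one : Reflect (1 : PowerSeries (PowerSeries R)) 1 := fun c => by
  by_cases h : c = 0
  · subst h
    refine ⟨fun q hq => ?_, fun q hq => ?_, fun q e h => ?_⟩
    · simp [PowerSeries.coeff_one, hq.ne']
    · simp [PowerSeries.coeff_one, hq.ne']
    · rw [show q = 0 by omega, show e = 0 by omega]
  · simp [PowerSeries.coeff_one, h]

theorem Reflect.add {f g f' g' : PowerSeries (PowerSeries R)} (h : Reflect f g)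
    (h' : Reflect f' g') : Reflect (f + f') (g + g') := fun c => by
  refine ⟨fun q hq => ?_, fun e he => ?_, fun q e hqe => ?_⟩
  · rw [map_add, map_add, (h c).1 q hq, (h' c).1 q hq, add_zero]
  · rw [map_add, map_add, (h c).2.1 e he, (h' c).2.1 e he, add_zero]
  · rw [map_add, map_add, map_add, map_add, (h c).2.2 q e hqe, (h' c).2.2 q e hqe]

theorem Reflect.mul {f g f' g' : PowerSeries (PowerSeries R)} (h : Reflect f g)
    (h' : Reflect f' g') : Reflect (f * f') (g * g') := fun c => by
  refine ⟨fun q hq => ?_, fun e he => ?_, fun q e hqe => ?_⟩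
  · rw [PowerSeries.coeff_mul, map_sum]
    refine Finset.sum_eq_zero fun p hp => ?_
    rw [PowerSeries.coeff_mul]
    refine Finset.sum_eq_zero fun r hr => ?_
    have h1 := Finset.HasAntidiagonal.mem_antidiagonal.mp hp
    have h2 := Finset.HasAntidiagonal.mem_antidiagonal.mp hr
    by_cases h3 : p.1 < r.1
    · rw [(h _).1 _ h3, zero_mul]
    · rw [(h' _).1 _ (show p.2 < r.2 by omega), mul_zero]
  · rw [PowerSeries.coeff_mul, map_sum]
    refine Finset.sum_eq_zero fun p hp => ?_
    rw [PowerSeries.coeff_mul]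
    refine Finset.sum_eq_zero fun r hr => ?_
    have h1 := Finset.HasAntidiagonal.mem_antidiagonal.mp hp
    have h2 := Finset.HasAntidiagonal.mem_antidiagonal.mp hr
    by_cases h3 : p.1 < r.1
    · rw [(h _).2.1 _ h3, zero_mul]
    · rw [(h' _).2.1 _ (show p.2 < r.2 by omega), mul_zero]
  · rw [PowerSeries.coeff_mul, PowerSeries.coeff_mul, map_sum, map_sum]
    refine Finset.sum_congr rfl fun p hp => ?_
    have h1 := Finset.HasAntidiagonal.mem_antidiagonal.mp hp
    rw [PowerSeries.coeff_mul, PowerSeries.coeff_mul]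
    refine Finset.sum_bij_ne_zero (fun r _ _ => (p.1 - r.1, p.2 - r.2)) ?_ ?_ ?_ ?_
    · intro r hr hne
      have h2 := Finset.HasAntidiagonal.mem_antidiagonal.mp hr
      have h3 : r.1 ≤ p.1 := by
        by_contra hh
        exact hne (by rw [(h _).1 _ (not_le.mp hh), zero_mul])
      have h4 : r.2 ≤ p.2 := by
        by_contra hh
        exact hne (by rw [(h' _).1 _ (not_le.mp hh), mul_zero])
      exact Finset.HasAntidiagonal.mem_antidiagonal.mpr (by dsimp only; omega)
    · intro r hr hne r' hr' hne' heq
      have h3 : r.1 ≤ p.1 := by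
        by_contra hh
        exact hne (by rw [(h _).1 _ (not_le.mp hh), zero_mul])
      have h4 : r.2 ≤ p.2 := by
        by_contra hh
        exact hne (by rw [(h' _).1 _ (not_le.mp hh), mul_zero])
      have h3' : r'.1 ≤ p.1 := by
        by_contra hh
        exact hne' (by rw [(h _).1 _ (not_le.mp hh), zero_mul])
      have h4' : r'.2 ≤ p.2 := by
        by_contra hh
        exact hne' (by rw [(h' _).1 _ (not_le.mp hh), mul_zero])
      have e1 := congrArg Prod.fst heq
      have e2 := congrArg Prod.snd heq
      dsimp only at e1 e2
      exact Prod.ext (by omega) (by omega)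
    · intro s hs hne
      have h2 := Finset.HasAntidiagonal.mem_antidiagonal.mp hs
      have h3 : s.1 ≤ p.1 := by
        by_contra hh
        exact hne (by rw [(h _).2.1 _ (not_le.mp hh), zero_mul])
      have h4 : s.2 ≤ p.2 := by
        by_contra hh
        exact hne (by rw [(h' _).2.1 _ (not_le.mp hh), mul_zero])
      refine ⟨(p.1 - s.1, p.2 - s.2),
        Finset.HasAntidiagonal.mem_antidiagonal.mpr (by dsimp only; omega), ?_, ?_⟩
      · rw [(h _).2.2 _ s.1 (by dsimp only; omega), (h' _).2.2 _ s.2 (by dsimp only; omega)]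
        exact hne
      · exact Prod.ext (by dsimp only; omega) (by dsimp only; omega)
    · intro r hr hne
      have h3 : r.1 ≤ p.1 := by
        by_contra hh
        exact hne (by rw [(h _).1 _ (not_le.mp hh), zero_mul])
      have h4 : r.2 ≤ p.2 := by
        by_contra hh
        exact hne (by rw [(h' _).1 _ (not_le.mp hh), mul_zero])
      rw [(h _).2.2 r.1 (p.1 - r.1) (by omega), (h' _).2.2 r.2 (p.2 - r.2) (by omega)]

theorem Reflect.pow {f g : PowerSeries (PowerSeries R)} (h : Reflect f g) (m : ℕ) :
    Reflect (f ^ m) (g ^ m) := by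
  induction m with
  | zero => rw [pow_zero, pow_zero]; exact Reflect.one
  | succ m ih => rw [pow_succ, pow_succ]; exact ih.mul h

variable [Algebra ℂ R]

theorem Reflect.smul {f g : PowerSeries (PowerSeries R)} (h : Reflect f g) (z : ℂ) :
    Reflect (z • f) (z • g) := fun c => by
  refine ⟨fun q hq => ?_, fun e he => ?_, fun q e hqe => ?_⟩
  · rw [coeff_smul_complex, coeff_smul_complex, (h c).1 q hq, smul_zero]
  · rw [coeff_smul_complex, coeff_smul_complex, (h c).2.1 e he, smul_zero]
  · rw [coeff_smul_complex, coeff_smul_complex, coeff_smul_complex, coeff_smul_complex,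
      (h c).2.2 q e hqe]

theorem Reflect.expPartial {f g : PowerSeries (PowerSeries R)} (h : Reflect f g) (D : ℕ) :
    Reflect (expPartial f D) (expPartial g D) := by
  induction D with
  | zero => simpa [HDFT.expPartial] using Reflect.zero
  | succ D ih =>
    rw [HDFT.expPartial, HDFT.expPartial, Finset.sum_range_succ, Finset.sum_range_succ]
    exact ih.add ((h.pow D).smul _)

theorem Reflect.fexp [Filt R] {f g : PowerSeries (PowerSeries R)} (h : Reflect f g)
    (hf : f ∈ (Filt.F 1 : Submodule ℂ _)) (hg : g ∈ (Filt.F 1 : Submodule ℂ _)) :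
    Reflect (fexp f) (fexp g) := fun c => by
  have key : ∀ (f : PowerSeries (PowerSeries R)), f ∈ (Filt.F 1 : Submodule ℂ _) → ∀ q D,
      coeff q (coeff c (HDFT.fexp f)) - coeff q (coeff c (HDFT.expPartial f (D + c + q))) ∈
        (Filt.F D : Submodule ℂ R) := by
    intro f hf q D
    have := isExp_fexp hf (D + c + q) c q
    rw [map_sub, map_sub] at this
    exact Filt.mono (by omega) this
  refine ⟨fun q hq => Filt.sep _ fun D => ?_, fun e he => Filt.sep _ fun D => ?_,
    fun q e hqe => Filt.ext_of fun D => ?_⟩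
  · have := key f hf q D
    rwa [((h.expPartial _) c).1 q hq, sub_zero] at this
  · have := key g hg e D
    rwa [((h.expPartial _) c).2.1 e he, sub_zero] at this
  · have h1 := key f hf q (D + e)
    have h2 := key g hg e (D + q)
    rw [((h.expPartial _) c).2.2 q e hqe, show D + e + c + q = D + q + c + e by omega] at h1
    have := Submodule.sub_mem _ (Filt.mono (show D ≤ D + e by omega) h1)
      (Filt.mono (show D ≤ D + q by omega) h2)
    rwa [sub_sub_sub_cancel_right] at this

end Reflect


/-! ### Commutators of the parts of the three exponents -/

namespace VertexData

variable {R : Type*} [Ring R] [Algebra ℂ R] [Filt R] (D : VertexData R)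

/-- The mode `n` of the exponent of the first vertex operator. -/
noncomputable def a (n : ℤ) : R := D.fld D.α (D.Va n) n

/-- The mode `n` of the exponent of the second vertex operator. -/
noncomputable def b (n : ℤ) : R := D.fld D.β (D.Vb n) n

/-- The mode `n` of the exponent of the third vertex operator. -/
noncomputable def c (n : ℤ) : R := D.fld D.γ (D.Vc n) n

/-- Annihilation part of the exponent of the first vertex operator. -/
noncomputable def annA : PowerSeries R := PowerSeries.mk fun n => if n = 0 then 0 else D.a n

/-- Annihilation part of the exponent of the second vertex operator. -/
noncomputable def annB : PowerSeries R := PowerSeries.mk fun n => if n = 0 then 0 else D.b n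

/-- Creation part of the exponent of the second vertex operator. -/
noncomputable def creB : PowerSeries R := PowerSeries.mk fun n => if n = 0 then 0 else D.b (-n)

/-- Creation part of the exponent of the third vertex operator. -/
noncomputable def creC : PowerSeries R := PowerSeries.mk fun n => if n = 0 then 0 else D.c (-n)

/-- The commutator of the modes `n` of the first and `-m` of the second exponent. -/
noncomputable def ab (n m : ℕ) : R := comm (coeff n D.annA) (coeff m D.creB)

/-- The commutator of the modes `n` of the first and `-m` of the third exponent. -/
noncomputable def ac (n m : ℕ) : R := comm (coeff n D.annA) (coeff m D.creC)

/-- The commutator of the modes `n` of the second and `-m` of the third exponent. -/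
noncomputable def bc (n m : ℕ) : R := comm (coeff n D.annB) (coeff m D.creC)

theorem coeff_annA (n : ℕ) : coeff n D.annA = if n = 0 then 0 else D.a n := by
  rw [annA, PowerSeries.coeff_mk]

theorem coeff_annB (n : ℕ) : coeff n D.annB = if n = 0 then 0 else D.b n := by
  rw [annB, PowerSeries.coeff_mk]

theorem coeff_creB (n : ℕ) : coeff n D.creB = if n = 0 then 0 else D.b (-n) := by
  rw [creB, PowerSeries.coeff_mk]

theorem coeff_creC (n : ℕ) : coeff n D.creC = if n = 0 then 0 else D.c (-n) := by
  rw [creC, PowerSeries.coeff_mk]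

/-- `r` is a nonzero mode of `x` in the direction of `v`, or zero. -/
def IsX (v : Fin 3 → ℂ) (k : ℤ) (r : R) : Prop :=
  r = 0 ∨ ∃ s : ℂ, k ≠ 0 ∧ r = D.xmode (s • v) k

/-- `r` is a mode of an exponent with winding `u`, or zero. -/
def IsFld (u : Fin 3 → ℂ) (k : ℤ) (r : R) : Prop :=
  r = 0 ∨ ∃ V : Fin 3 → R, k ≠ 0 ∧ (∀ i t, Commute (V i) t) ∧ r = D.fld u V k

theorem isFld_annA (n : ℕ) : D.IsFld D.α n (coeff n D.annA) := by
  rw [coeff_annA]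
  split_ifs with h
  · exact Or.inl rfl
  · exact Or.inr ⟨_, by omega, D.Va_central n, rfl⟩

theorem isFld_annB (n : ℕ) : D.IsFld D.β n (coeff n D.annB) := by
  rw [coeff_annB]
  split_ifs with h
  · exact Or.inl rfl
  · exact Or.inr ⟨_, by omega, D.Vb_central n, rfl⟩

theorem isFld_creB (n : ℕ) : D.IsFld D.β (-n) (coeff n D.creB) := by
  rw [coeff_creB]
  split_ifs with h
  · exact Or.inl rfl
  · exact Or.inr ⟨_, by omega, D.Vb_central _, rfl⟩

theorem isFld_creC (n : ℕ) : D.IsFld D.γ (-n) (coeff n D.creC) := by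
  rw [coeff_creC]
  split_ifs with h
  · exact Or.inl rfl
  · exact Or.inr ⟨_, by omega, D.Vc_central _, rfl⟩

variable {D}

theorem IsX.commute {v v' : Fin 3 → ℂ} {k k' : ℤ} {r r' : R} (h : D.IsX v k r)
    (h' : D.IsX v' k' r') : Commute r r' := by
  rcases h with rfl | ⟨s, hk, rfl⟩
  · exact Commute.zero_left _
  rcases h' with rfl | ⟨s', hk', rfl⟩
  · exact Commute.zero_right _
  exact commute_of_comm_eq_zero (D.comm_xmode_xmode _ _ hk hk')

theorem IsFld.comm_isX {u v : Fin 3 → ℂ} {k k' : ℤ} {r r' : R} (h : D.IsFld u k r)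
    (h' : D.IsX v k' r') : ∃ z : ℂ, comm r r' = algebraMap ℂ R z ∧ (dot u v = 0 → z = 0) ∧
      (k' ≠ -k → z = 0) := by
  rcases h with rfl | ⟨V, hk, hV, rfl⟩
  · exact ⟨0, by simp [comm], fun _ => rfl, fun _ => rfl⟩
  rcases h' with rfl | ⟨s, hk', rfl⟩
  · exact ⟨0, by simp [comm], fun _ => rfl, fun _ => rfl⟩
  rw [D.comm_fld_xmode hV _ hk hk']
  have hs : dot u (s • v) = s * dot u v := by
    simp only [dot, Pi.smul_apply, smul_eq_mul, Finset.mul_sum]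
    exact Finset.sum_congr rfl fun i _ => by ring
  refine ⟨if k' = -k then dot u (s • v) / k' else 0, ?_, fun h => ?_, fun h => ?_⟩
  · split_ifs <;> simp
  · simp [hs, h]
  · simp [h]

theorem IsFld.commute_isX {u v : Fin 3 → ℂ} {k k' : ℤ} {r r' : R} (h : D.IsFld u k r)
    (h' : D.IsX v k' r') (huv : dot u v = 0) : Commute r r' := by
  obtain ⟨z, hz, h0, -⟩ := h.comm_isX h'
  exact commute_of_comm_eq_zero (by rw [hz, h0 huv, map_zero])

theorem IsFld.comm_isFld {u u' : Fin 3 → ℂ} {k k' : ℤ} {r r' : R} (h : D.IsFld u k r)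
    (h' : D.IsFld u' k' r') (hkk : k + k' ≠ 0) : D.IsX (cross u u') (k + k') (comm r r') := by
  rcases h with rfl | ⟨V, hk, hV, rfl⟩
  · exact Or.inl (by simp [comm])
  rcases h' with rfl | ⟨V', hk', hV', rfl⟩
  · exact Or.inl (by simp [comm])
  exact Or.inr ⟨_, hkk, D.comm_fld_fld hV hV' hk hk' hkk⟩

theorem IsX.mem_Jr {v : Fin 3 → ℂ} {k : ℤ} {r : R} (h : D.IsX v k r) (hk : 0 < k) : r ∈ D.Jr := by
  rcases h with rfl | ⟨s, -, rfl⟩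
  · exact Submodule.zero_mem _
  · exact Submodule.sum_mem _ fun i _ => Submodule.smul_mem _ _ (D.x_Jr i k hk)

theorem IsX.mem_Jl {v : Fin 3 → ℂ} {k : ℤ} {r : R} (h : D.IsX v k r) (hk : k < 0) : r ∈ D.Jl := by
  rcases h with rfl | ⟨s, -, rfl⟩
  · exact Submodule.zero_mem _
  · exact Submodule.sum_mem _ fun i _ => Submodule.smul_mem _ _ (D.x_Jl i k hk)

theorem IsFld.mem_Jr {u : Fin 3 → ℂ} {k : ℤ} {r : R} (h : D.IsFld u k r) (hk : 0 ≤ k) :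
    r ∈ D.Jr := by
  rcases h with rfl | ⟨V, hk', -, rfl⟩
  · exact Submodule.zero_mem _
  · have hk0 : 0 < k := lt_of_le_of_ne hk hk'.symm
    refine Submodule.add_mem _ ?_ ?_
    · exact Submodule.sum_mem _ fun i _ => Submodule.smul_mem _ _ (D.xs_Jr i k hk0)
    · exact Submodule.sum_mem _ fun i _ => D.mul_Jr _ _ (D.x_Jr i k hk0)

theorem IsFld.mem_Jl {u : Fin 3 → ℂ} {k : ℤ} {r : R} (h : D.IsFld u k r) (hk : k ≤ 0) :
    r ∈ D.Jl := by
  rcases h with rfl | ⟨V, hk', hV, rfl⟩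
  · exact Submodule.zero_mem _
  · have hk0 : k < 0 := lt_of_le_of_ne hk hk'
    refine Submodule.add_mem _ ?_ ?_
    · exact Submodule.sum_mem _ fun i _ => Submodule.smul_mem _ _ (D.xs_Jl i k hk0)
    · refine Submodule.sum_mem _ fun i _ => ?_
      rw [(hV i _).eq]
      exact D.Jl_mul _ _ (D.x_Jl i k hk0)

theorem IsFld.central {u u' : Fin 3 → ℂ} {k : ℤ} {r r' : R} (h : D.IsFld u k r)
    (h' : D.IsFld u' (-k) r') (t : R) : Commute (comm r r') t := by
  rcases h with rfl | ⟨V, hk, hV, rfl⟩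
  · rw [show comm 0 r' = 0 by simp [comm]]; exact Commute.zero_left _
  rcases h' with rfl | ⟨V', hk', hV', rfl⟩
  · rw [show comm _ (0 : R) = 0 by simp [comm]]; exact Commute.zero_left _
  rw [D.comm_fld_fld_neg hV hV' hk]
  have hs : ∀ (z : ℂ) (y : R), Commute y t → Commute (z • y) t := fun z y h => h.smul_left z
  refine Commute.sub_left (hs _ _ ?_) (hs _ _ (Commute.add_left ?_ ?_))
  · exact Commute.sum_left _ _ _ fun i _ => hs _ _ (D.W_central i t)
  · exact Commute.sum_left _ _ _ fun i _ => hs _ _ (hV' i t)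
  · exact Commute.sum_left _ _ _ fun i _ => hs _ _ (hV i t)

variable (D)

theorem isX_ab {n m : ℕ} (h : n ≠ m) : D.IsX (cross D.α D.β) (n - m) (D.ab n m) :=
  (D.isFld_annA n).comm_isFld (D.isFld_creB m) (by omega)

theorem isX_ac {n m : ℕ} (h : n ≠ m) : D.IsX (cross D.α D.γ) (n - m) (D.ac n m) :=
  (D.isFld_annA n).comm_isFld (D.isFld_creC m) (by omega)

theorem isX_bc {n m : ℕ} (h : n ≠ m) : D.IsX (cross D.β D.γ) (n - m) (D.bc n m) :=
  (D.isFld_annB n).comm_isFld (D.isFld_creC m) (by omega)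

theorem central_ab (n : ℕ) (t : R) : Commute (D.ab n n) t :=
  (D.isFld_annA n).central (D.isFld_creB n) t

theorem central_ac (n : ℕ) (t : R) : Commute (D.ac n n) t :=
  (D.isFld_annA n).central (D.isFld_creC n) t

theorem central_bc (n : ℕ) (t : R) : Commute (D.bc n n) t :=
  (D.isFld_annB n).central (D.isFld_creC n) t

theorem commute_annB_bc (n q m : ℕ) : Commute (coeff n D.annB) (D.bc q m) := by
  by_cases h : q = m
  · subst h; exact (D.central_bc q _).symm
  · exact (D.isFld_annB n).commute_isX (D.isX_bc h) (by rw [dot_cross, eVol_self_left])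

theorem commute_creC_bc (n q m : ℕ) : Commute (coeff n D.creC) (D.bc q m) := by
  by_cases h : q = m
  · subst h; exact (D.central_bc q _).symm
  · exact (D.isFld_creC n).commute_isX (D.isX_bc h) (by rw [dot_cross, eVol_self_right])

theorem commute_bc_bc (q m q' m' : ℕ) : Commute (D.bc q m) (D.bc q' m') := by
  by_cases h : q = m
  · subst h; exact D.central_bc q _
  by_cases h' : q' = m'
  · subst h'; exact (D.central_bc q' _).symm
  · exact (D.isX_bc h).commute (D.isX_bc h')

/-! ### The second vertex operator on the state created by the third -/

/-- The terms of the commutator of `annB` and `creC` that do not annihilate the vacuum, as a series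
in `t` (outer variable) and `w⁻¹`. -/
noncomputable def bcLow : PowerSeries (PowerSeries R) :=
  PowerSeries.mk fun m => PowerSeries.mk fun q => if q ≤ m then D.bc q m else 0

/-- The terms of the commutator of `annB` and `creC` that annihilate the vacuum. -/
noncomputable def bcHigh : PowerSeries (PowerSeries R) :=
  PowerSeries.mk fun m => PowerSeries.mk fun q => if q ≤ m then 0 else D.bc q m

/-- The series `creC` in terms of `b = t / w` (outer variable) and `w`. -/
noncomputable def creC' : PowerSeries (PowerSeries R) :=
  PowerSeries.mk fun m => PowerSeries.monomial m (coeff m D.creC)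

/-- The series `bcLow` in terms of `b = t / w` (outer variable) and `w`. -/
noncomputable def bcLow' : PowerSeries (PowerSeries R) :=
  PowerSeries.mk fun m => PowerSeries.mk fun e => if e ≤ m then D.bc (m - e) m else 0

theorem coeff_zero_annB : coeff 0 D.annB = 0 := by rw [coeff_annB, if_pos rfl]

theorem coeff_zero_annA : coeff 0 D.annA = 0 := by rw [coeff_annA, if_pos rfl]

theorem coeff_zero_creB : coeff 0 D.creB = 0 := by rw [coeff_creB, if_pos rfl]

theorem coeff_zero_creC : coeff 0 D.creC = 0 := by rw [coeff_creC, if_pos rfl]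

theorem mem_F_one_of_coeff_zero {S : Type*} [Ring S] [Algebra ℂ S] [Filt S] {f : PowerSeries S}
    (h : coeff 0 f = 0) : f ∈ (Filt.F 1 : Submodule ℂ (PowerSeries S)) :=
  mem_F_one (by rw [h]; exact Submodule.zero_mem _)

theorem bc_zero_right (q : ℕ) : D.bc q 0 = 0 := by
  rw [bc, coeff_zero_creC]; simp [comm]

theorem bc_zero_left (m : ℕ) : D.bc 0 m = 0 := by
  rw [bc, coeff_zero_annB]; simp [comm]

theorem coeff_zero_bcLow : coeff 0 D.bcLow = 0 := by
  rw [bcLow, PowerSeries.coeff_mk]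
  refine PowerSeries.ext fun q => ?_
  rw [PowerSeries.coeff_mk, bc_zero_right, ite_self, map_zero]

theorem coeff_zero_bcHigh : coeff 0 D.bcHigh = 0 := by
  rw [bcHigh, PowerSeries.coeff_mk]
  refine PowerSeries.ext fun q => ?_
  rw [PowerSeries.coeff_mk, bc_zero_right, ite_self, map_zero]

theorem coeff_zero_creC' : coeff 0 D.creC' = 0 := by
  rw [creC', PowerSeries.coeff_mk, coeff_zero_creC, map_zero]

theorem coeff_zero_bcLow' : coeff 0 D.bcLow' = 0 := by
  rw [bcLow', PowerSeries.coeff_mk]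
  refine PowerSeries.ext fun q => ?_
  rw [PowerSeries.coeff_mk, bc_zero_right, ite_self, map_zero]

theorem reflect_creC : Reflect (PowerSeries.mapAlgHom (cHom R) D.creC) D.creC' := fun c => by
  simp only [PowerSeries.mapAlgHom_apply, PowerSeries.coeff_map, RingHom.coe_coe, cHom_apply,
    creC', PowerSeries.coeff_mk, PowerSeries.coeff_C, PowerSeries.coeff_monomial]
  refine ⟨fun q hq => if_neg (by omega), fun e he => if_neg (by omega), fun q e h => ?_⟩
  by_cases hq : q = 0
  · rw [if_pos hq, if_pos (by omega)]
  · rw [if_neg hq, if_neg (by omega)]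

theorem reflect_bcLow : Reflect D.bcLow D.bcLow' := fun c => by
  simp only [bcLow, bcLow', PowerSeries.coeff_mk]
  refine ⟨fun q hq => if_neg (by omega), fun e he => if_neg (by omega), fun q e h => ?_⟩
  rw [if_pos (by omega), if_pos (by omega), show c - e = q by omega]

theorem mapAlgHom_cHom_mem_F_one {S : Type*} [Ring S] [Algebra ℂ S] [Filt S] {f : PowerSeries S}
    (h : coeff 0 f = 0) :
    PowerSeries.mapAlgHom (cHom S) f ∈ (Filt.F 1 : Submodule ℂ (PowerSeries (PowerSeries S))) :=
  mapAlgHom_mem _ cHom_mem _ _ (mem_F_one_of_coeff_zero h)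

/-- The annihilation part of the second vertex operator on the state created by the third. The two
exponentials are interchanged in the series in `t` and `w⁻¹`; to the right of `fexp creC` and
`fexp bcLow` there remain `fexp bcHigh` and `fexp annB`, which fix the vacuum. The surviving series
has no terms `t^m w^{-q}` with `m < q`, so that it can be rewritten in terms of `b = t / w` and
`w`. -/
theorem annB_creC (q m : ℕ) : coeff q (fexp D.annB) * coeff m (fexp D.creC) -
    (if q ≤ m then coeff (m - q) (coeff m (fexp D.creC' * fexp D.bcLow')) else 0) ∈ D.Jr := by
  have hB := mem_F_one_of_coeff_zero D.coeff_zero_annB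
  have hC := mem_F_one_of_coeff_zero D.coeff_zero_creC
  have hB1 : cHom (PowerSeries R) D.annB ∈
      (Filt.F 1 : Submodule ℂ (PowerSeries (PowerSeries R))) := cHom_mem _ _ hB
  have hC1 := mapAlgHom_cHom_mem_F_one D.coeff_zero_creC
  have hL := mem_F_one_of_coeff_zero D.coeff_zero_bcLow
  have hH := mem_F_one_of_coeff_zero D.coeff_zero_bcHigh
  have hcomm : comm (cHom (PowerSeries R) D.annB) (PowerSeries.mapAlgHom (cHom R) D.creC) =
      D.bcLow + D.bcHigh := by
    refine PowerSeries.ext fun m => PowerSeries.ext fun q => ?_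
    rw [comm, cHom_apply, PowerSeries.mapAlgHom_apply, map_sub, PowerSeries.coeff_C_mul,
      PowerSeries.coeff_mul_C, PowerSeries.coeff_map, RingHom.coe_coe, cHom_apply, map_sub,
      PowerSeries.coeff_C_mul, PowerSeries.coeff_mul_C, map_add, map_add, bcLow, bcHigh,
      PowerSeries.coeff_mk, PowerSeries.coeff_mk, PowerSeries.coeff_mk, PowerSeries.coeff_mk]
    change D.bc q m = _
    split_ifs <;> simp
  have cfB : ∀ i j, coeff j (coeff i (cHom (PowerSeries R) D.annB)) =
      if i = 0 then coeff j D.annB else 0 := by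
    intro i j
    rw [cHom_apply, PowerSeries.coeff_C]
    split_ifs <;> simp
  have cfC : ∀ i j, coeff j (coeff i (PowerSeries.mapAlgHom (cHom R) D.creC)) =
      if j = 0 then coeff i D.creC else 0 := by
    intro i j
    rw [PowerSeries.mapAlgHom_apply, PowerSeries.coeff_map, RingHom.coe_coe, cHom_apply,
      PowerSeries.coeff_C]
  have cfL : ∀ i j, coeff j (coeff i D.bcLow) = if j ≤ i then D.bc j i else 0 := by
    intro i j
    rw [bcLow, PowerSeries.coeff_mk, PowerSeries.coeff_mk]
  have cfH : ∀ i j, coeff j (coeff i D.bcHigh) = if j ≤ i then 0 else D.bc j i := by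
    intro i j
    rw [bcHigh, PowerSeries.coeff_mk, PowerSeries.coeff_mk]
  have com : ∀ f g : PowerSeries (PowerSeries R), (∀ i j i' j', Commute (coeff j (coeff i f))
      (coeff j' (coeff i' g))) → Commute f g := fun f g h =>
    commute_of_coeff fun i i' => commute_of_coeff fun j j' => h i j i' j'
  have cBL : Commute (cHom (PowerSeries R) D.annB) D.bcLow := com _ _ fun i j i' j' => by
    rw [cfB, cfL]
    split_ifs
    exacts [D.commute_annB_bc _ _ _, Commute.zero_right _, Commute.zero_left _, Commute.zero_left _]
  have cBH : Commute (cHom (PowerSeries R) D.annB) D.bcHigh := com _ _ fun i j i' j' => by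
    rw [cfB, cfH]
    split_ifs
    exacts [Commute.zero_right _, D.commute_annB_bc _ _ _, Commute.zero_left _, Commute.zero_left _]
  have cCL : Commute (PowerSeries.mapAlgHom (cHom R) D.creC) D.bcLow := com _ _ fun i j i' j' => by
    rw [cfC, cfL]
    split_ifs
    exacts [D.commute_creC_bc _ _ _, Commute.zero_right _, Commute.zero_left _, Commute.zero_left _]
  have cCH : Commute (PowerSeries.mapAlgHom (cHom R) D.creC) D.bcHigh :=
    com _ _ fun i j i' j' => by
      rw [cfC, cfH]
      split_ifs
      exacts [Commute.zero_right _, D.commute_creC_bc _ _ _, Commute.zero_left _,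
        Commute.zero_left _]
  have cLH : Commute D.bcLow D.bcHigh := com _ _ fun i j i' j' => by
    rw [cfL, cfH]
    split_ifs
    exacts [Commute.zero_right _, D.commute_bc_bc _ _ _ _, Commute.zero_left _, Commute.zero_left _]
  have key := fexp_mul_fexp hB1 hC1 hcomm (cBL.add_right cBH) (cCL.add_right cCH)
  have e1 : fexp (cHom (PowerSeries R) D.annB) * fexp (D.bcLow + D.bcHigh) =
      fexp D.bcLow * (fexp D.bcHigh * fexp (cHom (PowerSeries R) D.annB)) := by
    rw [fexp_add hL hH cLH, ← mul_assoc, ← mul_assoc,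
      (fexp_commute hB1 (fexp_commute hL cBL.symm).symm).eq, mul_assoc, mul_assoc,
      (fexp_commute hB1 (fexp_commute hH cBH.symm).symm).eq]
  rw [e1, ← mul_assoc] at key
  have hJc : FiltClosed (coeffwise (coeffwise D.Jr)) :=
    coeffwise_closed (coeffwise_closed D.Jr_closed)
  have hJm : ∀ f : PowerSeries (PowerSeries R), ∀ g ∈ coeffwise (coeffwise D.Jr),
      f * g ∈ coeffwise (coeffwise D.Jr) := coeffwise_mul_left (coeffwise_mul_left D.mul_Jr)
  have hpow : ∀ f ∈ coeffwise (coeffwise D.Jr), ∀ m, f ^ (m + 1) ∈ coeffwise (coeffwise D.Jr) :=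
    fun f hf m => by rw [pow_succ]; exact hJm _ _ hf
  -- the factors `fexp annB` and `fexp bcHigh` fix the vacuum
  have mB : fexp (cHom (PowerSeries R) D.annB) - 1 ∈ coeffwise (coeffwise D.Jr) := by
    refine fexp_sub_one_mem hJc hB1 (hpow _ fun i j => ?_)
    rw [cfB]
    split_ifs
    · exact (D.isFld_annB j).mem_Jr (by omega)
    · exact Submodule.zero_mem _
  have mH : fexp D.bcHigh - 1 ∈ coeffwise (coeffwise D.Jr) := by
    refine fexp_sub_one_mem hJc hH (hpow _ fun i j => ?_)
    rw [cfH]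
    split_ifs
    · exact Submodule.zero_mem _
    · exact (D.isX_bc (by omega)).mem_Jr (by omega)
  have mHB : fexp D.bcHigh * fexp (cHom (PowerSeries R) D.annB) - 1 ∈
      coeffwise (coeffwise D.Jr) := by
    have := Submodule.add_mem _ (hJm (fexp D.bcHigh) _ mB) mH
    rwa [mul_sub, mul_one, sub_add_sub_cancel] at this
  have fin := hJm (fexp (PowerSeries.mapAlgHom (cHom R) D.creC) * fexp D.bcLow) _ mHB
  rw [mul_sub, mul_one, ← key] at fin
  have e2 : fexp (cHom (PowerSeries R) D.annB) = PowerSeries.C (fexp D.annB) :=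
    (fexp_hom (cHom (PowerSeries R)) cHom_mem hB).symm
  have e3 : fexp (PowerSeries.mapAlgHom (cHom R) D.creC) =
      PowerSeries.mapAlgHom (cHom R) (fexp D.creC) :=
    (fexp_hom (PowerSeries.mapAlgHom (cHom R)) (mapAlgHom_mem _ cHom_mem) hC).symm
  have fin2 := fin m q
  have hl : coeff q (coeff m (fexp (cHom (PowerSeries R) D.annB) *
      fexp (PowerSeries.mapAlgHom (cHom R) D.creC))) =
      coeff q (fexp D.annB) * coeff m (fexp D.creC) := by
    rw [e2, e3, PowerSeries.coeff_C_mul, PowerSeries.mapAlgHom_apply, PowerSeries.coeff_map,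
      RingHom.coe_coe, cHom_apply, PowerSeries.coeff_mul_C]
  rw [map_sub, map_sub, hl] at fin2
  have hr := (D.reflect_creC.fexp hC1 (mem_F_one_of_coeff_zero D.coeff_zero_creC')).mul
    (D.reflect_bcLow.fexp hL (mem_F_one_of_coeff_zero D.coeff_zero_bcLow'))
  split_ifs with h
  · rwa [(hr m).2.2 q (m - q) (by omega)] at fin2
  · rwa [(hr m).1 q (by omega)] at fin2

end VertexData


/-! ### The first vertex operator on the state created by the other two -/

namespace VertexData

variable {R : Type*} [Ring R] [Algebra ℂ R] [Filt R] (D : VertexData R)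

/-- The state created by the second and the third vertex operator, as a series in `b` (outer
variable) and `w`. -/
noncomputable def state : PowerSeries (PowerSeries R) :=
  fexp (cHom (PowerSeries R) D.creB) * (fexp D.creC' * fexp D.bcLow')

/-- The coefficient of `ζ^n b^c w^n` in the logarithm of the correlator, where `ζ = 1 / z` and
`b = t / w`. On this diagonal `ζ^n w^n = (w / z)^n`. The summands are the central commutators that
the interchange of annihilation and creation parts leaves behind. -/
noncomputable def expo (n c : ℕ) : R :=
  (if c = 0 then D.ab n n else 0) + (if c = n then D.ac n n else 0) +
    (if c ≤ n then comm (D.ab n (n - c)) (coeff c D.creC) else 0) +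
    (if n ≤ c then comm (coeff n D.annA) (D.bc (c - n) c) else 0) +
    (if n = 0 then D.bc c c else 0)

theorem ab_zero_left (m : ℕ) : D.ab 0 m = 0 := by
  rw [ab, coeff_zero_annA]; simp [comm]

theorem ab_zero_right (m : ℕ) : D.ab m 0 = 0 := by
  rw [ab, coeff_zero_creB]; simp [comm]

theorem ac_zero_left (m : ℕ) : D.ac 0 m = 0 := by
  rw [ac, coeff_zero_annA]; simp [comm]

theorem comm_ab_creC {n m c : ℕ} (h : m < n) (hc : n ≠ m + c) :
    comm (D.ab n m) (coeff c D.creC) = 0 := by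
  obtain ⟨z, hz, -, h0⟩ := (D.isFld_creC c).comm_isX (D.isX_ab (show n ≠ m by omega))
  rw [comm_swap, hz, h0 (by omega), map_zero, smul_zero]

theorem central_ab_creC (n m c : ℕ) (t : R) : Commute (comm (D.ab n m) (coeff c D.creC)) t := by
  by_cases h : n = m
  · subst h
    rw [comm_eq_zero_of_commute (D.central_ab n _)]
    exact Commute.zero_left _
  · obtain ⟨z, hz, -, -⟩ := (D.isFld_creC c).comm_isX (D.isX_ab h)
    rw [comm_swap, hz]
    exact Commute.smul_left (Algebra.commutes z t) _

theorem comm_annA_bc {n q m : ℕ} (h : q < m) (hc : m ≠ q + n) :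
    comm (coeff n D.annA) (D.bc q m) = 0 := by
  obtain ⟨z, hz, -, h0⟩ := (D.isFld_annA n).comm_isX (D.isX_bc (show q ≠ m by omega))
  rw [hz, h0 (by omega), map_zero]

theorem central_annA_bc (n q m : ℕ) (t : R) : Commute (comm (coeff n D.annA) (D.bc q m)) t := by
  by_cases h : q = m
  · subst h
    rw [comm_eq_zero_of_commute (D.central_bc q _).symm]
    exact Commute.zero_left _
  · obtain ⟨z, hz, -, -⟩ := (D.isFld_annA n).comm_isX (D.isX_bc h)
    rw [hz]
    exact Algebra.commutes z t

theorem expo_zero : D.expo 0 0 = 0 := by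
  simp [expo, ab_zero_left, ac_zero_left, bc_zero_right, coeff_zero_annA, coeff_zero_creC, comm]

/-- The matrix element factors: up to terms that vanish between the vacuum covector and the vacuum,
the product of the annihilation part of the first vertex operator with `state` is the exponential
of a central series; up to terms that annihilate the vacuum, it is a series in which the exponent of
`ζ` does not exceed that of `w`. -/
theorem annA_state : ∃ U : PowerSeries (PowerSeries (PowerSeries R)),
    U ∈ lowerSupport R ∧
    U - fexp (tri fun n c e => if e = n then D.expo n c else 0) ∈
      coeffwise (coeffwise (coeffwise D.Jl)) ∧
    ∀ n c e, coeff n (fexp D.annA) * coeff e (coeff c D.state) -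
      coeff e (coeff c (coeff n U)) ∈ D.Jr := by
  -- the exponents as series in three variables
  -- (`A` annihilation part of the first operator, `B` and `C` creation parts of the others); the
  -- suffixes `0`, `m`, `p` mark the central, creation and annihilation parts of a commutator
  set A : PowerSeries (PowerSeries (PowerSeries R)) :=
    tri fun n c e => if c = 0 ∧ e = 0 then coeff n D.annA else 0 with hAdef
  set B : PowerSeries (PowerSeries (PowerSeries R)) :=
    tri fun n c e => if n = 0 ∧ c = 0 then coeff e D.creB else 0 with hBdef
  set C : PowerSeries (PowerSeries (PowerSeries R)) :=
    tri fun n c e => if n = 0 ∧ e = c then coeff c D.creC else 0 with hCdef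
  set N0 : PowerSeries (PowerSeries (PowerSeries R)) :=
    tri fun n c e => if n = 0 ∧ e = 0 then D.bc c c else 0 with hN0def
  set Nm : PowerSeries (PowerSeries (PowerSeries R)) :=
    tri fun n c e => if n = 0 ∧ e ≠ 0 ∧ e ≤ c then D.bc (c - e) c else 0 with hNmdef
  set H0 : PowerSeries (PowerSeries (PowerSeries R)) :=
    tri fun n c e => if c = 0 ∧ e = n then D.ab n e else 0 with hH0def
  set Hm : PowerSeries (PowerSeries (PowerSeries R)) :=
    tri fun n c e => if c = 0 ∧ n < e then D.ab n e else 0 with hHmdef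
  set Hp : PowerSeries (PowerSeries (PowerSeries R)) :=
    tri fun n c e => if c = 0 ∧ e < n then D.ab n e else 0 with hHpdef
  set D0 : PowerSeries (PowerSeries (PowerSeries R)) :=
    tri fun n c e => if e = c ∧ c = n then D.ac n c else 0 with hD0def
  set Dm : PowerSeries (PowerSeries (PowerSeries R)) :=
    tri fun n c e => if e = c ∧ n < c then D.ac n c else 0 with hDmdef
  set Dp : PowerSeries (PowerSeries (PowerSeries R)) :=
    tri fun n c e => if e = c ∧ c < n then D.ac n c else 0 with hDpdef
  set K : PowerSeries (PowerSeries (PowerSeries R)) :=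
    tri fun n c e => if e = n ∧ c ≤ n then comm (D.ab n (n - c)) (coeff c D.creC) else 0 with hKdef
  set L : PowerSeries (PowerSeries (PowerSeries R)) :=
    tri fun n c e => if e = n ∧ n ≤ c then comm (coeff n D.annA) (D.bc (c - n) c) else 0 with hLdef
  have eA : A = PowerSeries.mapAlgHom ((cHom (PowerSeries R)).comp (cHom R)) D.annA :=
    tri_ext fun n c e => by
      rw [coeff_tri, PowerSeries.mapAlgHom_apply, PowerSeries.coeff_map, RingHom.coe_coe,
        AlgHom.comp_apply, cHom_apply, cHom_apply, PowerSeries.coeff_C]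
      by_cases hc : c = 0
      · simp [hc, PowerSeries.coeff_C]
      · simp [hc]
  have eB : B = cHom _ (cHom _ D.creB) := tri_ext fun n c e => by
    rw [coeff_tri, cHom_apply, cHom_apply, PowerSeries.coeff_C]
    by_cases hn : n = 0
    · by_cases hc : c = 0 <;> simp [hn, hc, PowerSeries.coeff_C]
    · simp [hn]
  have eC : C = cHom _ D.creC' := tri_ext fun n c e => by
    rw [coeff_tri, cHom_apply, PowerSeries.coeff_C]
    by_cases hn : n = 0
    · simp [hn, creC', PowerSeries.coeff_monomial]
    · simp [hn]
  have eN : Nm + N0 = cHom _ D.bcLow' := tri_ext fun n c e => by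
    rw [hNmdef, hN0def, tri_add, coeff_tri, cHom_apply, PowerSeries.coeff_C]
    by_cases hn : n = 0
    · by_cases he : e = 0 <;> simp [hn, he, bcLow']
    · simp [hn]
  have triA : ∀ f n c e, coeff e (coeff c (coeff n (comm A (tri f)))) =
      ∑ p ∈ Finset.HasAntidiagonal.antidiagonal n, comm (coeff p.1 D.annA) (f p.2 c e) := by
    intro f n c e
    rw [eA, comm, map_sub, map_sub, map_sub, PowerSeries.coeff_mul, PowerSeries.coeff_mul,
      ← Finset.Nat.sum_antidiagonal_swap (n := n)
        (f := fun p => coeff p.1 (tri f) * coeff p.2 (PowerSeries.mapAlgHom _ D.annA))]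
    simp only [map_sum, PowerSeries.mapAlgHom_apply, PowerSeries.coeff_map, RingHom.coe_coe,
      AlgHom.comp_apply, cHom_apply, PowerSeries.coeff_C_mul, PowerSeries.coeff_mul_C, coeff_tri,
      Prod.fst_swap, Prod.snd_swap, ← Finset.sum_sub_distrib, comm]
  have triA0 : ∀ (g : ℕ → ℕ → R) n c e,
      coeff e (coeff c (coeff n (comm A (tri fun n c e => if n = 0 then g c e else 0)))) =
        comm (coeff n D.annA) (g c e) := by
    intro g n c e
    rw [triA, Finset.sum_eq_single (n, 0)]
    · simp
    · intro p hp hne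
      have := Finset.HasAntidiagonal.mem_antidiagonal.mp hp
      rw [if_neg]
      · simp [comm]
      · intro h0
        exact hne (Prod.ext (by dsimp only; omega) h0)
    · intro h
      exact absurd (Finset.HasAntidiagonal.mem_antidiagonal.mpr (by simp)) h
  have hAB : comm A B = H0 + Hm + Hp := tri_ext fun n c e => by
    have : B = tri fun n c e => if n = 0 then (if c = 0 then coeff e D.creB else 0) else 0 := by
      rw [hBdef]; simp only [ite_and]
    rw [this, triA0, hH0def, hHmdef, hHpdef, tri_add, tri_add, coeff_tri]
    by_cases hc : c = 0
    · rw [if_pos hc]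
      change D.ab n e = _
      rcases lt_trichotomy n e with h | h | h
      · simp [hc, h, h.ne', h.not_gt]
      · simp [hc, h]
      · simp [hc, h, h.ne, h.not_gt]
    · simp [hc, comm]
  have hAC : comm A C = D0 + Dm + Dp := tri_ext fun n c e => by
    have : C = tri fun n c e => if n = 0 then (if e = c then coeff c D.creC else 0) else 0 := by
      rw [hCdef]; simp only [ite_and]
    rw [this, triA0, hD0def, hDmdef, hDpdef, tri_add, tri_add, coeff_tri]
    by_cases hc : e = c
    · rw [if_pos hc]
      change D.ac n c = _
      rcases lt_trichotomy n c with h | h | h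
      · simp [hc, h, h.ne', h.not_gt]
      · simp [hc, h]
      · simp [hc, h, h.ne, h.not_gt]
    · simp [hc, comm]
  have hANm : comm A Nm = L := tri_ext fun n c e => by
    have : Nm = tri fun n c e =>
        if n = 0 then (if e ≠ 0 ∧ e ≤ c then D.bc (c - e) c else 0) else 0 := by
      rw [hNmdef]; simp only [ite_and]
    rw [this, triA0, hLdef, coeff_tri]
    by_cases he : e ≠ 0 ∧ e ≤ c
    · rw [if_pos he]
      by_cases h : e = n
      · subst h
        rw [if_pos ⟨rfl, he.2⟩]
      · rw [if_neg (fun h' => h h'.1), D.comm_annA_bc (by omega) (by omega)]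
    · rw [if_neg he]
      by_cases h : e = n ∧ n ≤ c
      · have : n = 0 := by omega
        rw [if_pos h, this, coeff_zero_annA]
        simp [comm]
      · rw [if_neg h]; simp [comm]
  have hHpC : comm Hp C = K := tri_ext fun n c e => by
    have h1 : ∀ i, coeff i Hp = PowerSeries.C (PowerSeries.mk fun e =>
        if e < i then D.ab i e else 0) := by
      intro i
      refine PowerSeries.ext fun c => PowerSeries.ext fun e => ?_
      rw [hHpdef, coeff_tri, PowerSeries.coeff_C]
      by_cases hc : c = 0 <;> simp [hc]
    have h2 : ∀ j, coeff j D.creC' = PowerSeries.C (coeff j D.creC) * PowerSeries.X ^ j := by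
      intro j
      rw [creC', PowerSeries.coeff_mk]
      refine PowerSeries.ext fun e => ?_
      rw [PowerSeries.coeff_C_mul_X_pow, PowerSeries.coeff_monomial]
    have h3 : coeff e (coeff c (coeff n (comm Hp C))) =
        if c ≤ e then comm (if e - c < n then D.ab n (e - c) else 0) (coeff c D.creC) else 0 := by
      rw [eC, cHom_apply, comm, map_sub, PowerSeries.coeff_mul_C, PowerSeries.coeff_C_mul, h1,
        map_sub, PowerSeries.coeff_mul_C, PowerSeries.coeff_C_mul, h2, ← mul_assoc,
        mul_assoc (PowerSeries.C _), (PowerSeries.commute_X_pow _ c).eq.symm, ← mul_assoc, map_sub,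
        PowerSeries.coeff_mul_X_pow', PowerSeries.coeff_mul_X_pow', PowerSeries.coeff_mul_C,
        PowerSeries.coeff_C_mul, PowerSeries.coeff_mk, comm]
      split_ifs <;> simp
    rw [h3, hKdef, coeff_tri]
    by_cases h : e = n ∧ c ≤ n
    · obtain ⟨rfl, hc⟩ := h
      rw [if_pos hc, if_pos (show e = e ∧ c ≤ e from ⟨rfl, hc⟩)]
      by_cases h0 : c = 0
      · subst h0
        rw [coeff_zero_creC]
        simp [comm]
      · rw [if_pos (by omega)]
    · rw [if_neg h]
      by_cases hc : c ≤ e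
      · rw [if_pos hc]
        by_cases hn : e - c < n
        · rw [if_pos hn, D.comm_ab_creC hn (by omega)]
        · rw [if_neg hn]; simp [comm]
      · rw [if_neg hc]
  have mA : A ∈ (Filt.F 1 : Submodule ℂ _) := tri_mem_F_one (by simp [coeff_zero_annA])
  have mB : B ∈ (Filt.F 1 : Submodule ℂ _) := tri_mem_F_one (by simp [coeff_zero_creB])
  have mC : C ∈ (Filt.F 1 : Submodule ℂ _) := tri_mem_F_one (by simp [coeff_zero_creC])
  have mN0 : N0 ∈ (Filt.F 1 : Submodule ℂ _) := tri_mem_F_one (by simp [bc_zero_right])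
  have mNm : Nm ∈ (Filt.F 1 : Submodule ℂ _) := tri_mem_F_one (by simp)
  have mH0 : H0 ∈ (Filt.F 1 : Submodule ℂ _) := tri_mem_F_one (by simp [ab_zero_left])
  have mHm : Hm ∈ (Filt.F 1 : Submodule ℂ _) := tri_mem_F_one (by simp)
  have mHp : Hp ∈ (Filt.F 1 : Submodule ℂ _) := tri_mem_F_one (by simp)
  have mD0 : D0 ∈ (Filt.F 1 : Submodule ℂ _) := tri_mem_F_one (by simp [ac_zero_left])
  have mDm : Dm ∈ (Filt.F 1 : Submodule ℂ _) := tri_mem_F_one (by simp)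
  have mDp : Dp ∈ (Filt.F 1 : Submodule ℂ _) := tri_mem_F_one (by simp)
  have mK : K ∈ (Filt.F 1 : Submodule ℂ _) := tri_mem_F_one (by simp [coeff_zero_creC, comm])
  have mL : L ∈ (Filt.F 1 : Submodule ℂ _) := tri_mem_F_one (by simp [coeff_zero_annA, comm])
  -- commutation of series whose coefficients commute
  have cond : ∀ (p p' : Prop) [Decidable p] [Decidable p'] (y y' : R), (p → p' → Commute y y') →
      Commute (if p then y else 0) (if p' then y' else 0) := by
    intro p p' _ _ y y' h
    split_ifs with h1 h2
    exacts [h h1 h2, Commute.zero_right _, Commute.zero_left _, Commute.zero_left _]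
  have cen : ∀ (p : Prop) [Decidable p] (y : R), (p → ∀ t, Commute y t) → ∀ t,
      Commute (if p then y else 0) t := by
    intro p _ y h t
    split_ifs with h1
    exacts [h h1 t, Commute.zero_left _]
  have cH0 : ∀ t, Commute H0 t := commute_tri_central fun n c e => cen _ _ fun h => by
    rw [h.2]; exact D.central_ab n
  have cD0 : ∀ t, Commute D0 t := commute_tri_central fun n c e => cen _ _ fun h => by
    rw [h.2]; exact D.central_ac n
  have cN0 : ∀ t, Commute N0 t := commute_tri_central fun n c e => cen _ _ fun h =>
    D.central_bc c
  have cK : ∀ t, Commute K t := commute_tri_central fun n c e => cen _ _ fun h =>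
    D.central_ab_creC _ _ _
  have cL : ∀ t, Commute L t := commute_tri_central fun n c e => cen _ _ fun h =>
    D.central_annA_bc _ _ _
  have AHm : Commute A Hm := commute_tri fun n c e n' c' e' => cond _ _ _ _ fun _ h =>
    (D.isFld_annA _).commute_isX (D.isX_ab (by omega)) (by rw [dot_cross, eVol_self_left])
  have AHp : Commute A Hp := commute_tri fun n c e n' c' e' => cond _ _ _ _ fun _ h =>
    (D.isFld_annA _).commute_isX (D.isX_ab (by omega)) (by rw [dot_cross, eVol_self_left])
  have BHm : Commute B Hm := commute_tri fun n c e n' c' e' => cond _ _ _ _ fun _ h =>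
    (D.isFld_creB _).commute_isX (D.isX_ab (by omega)) (by rw [dot_cross, eVol_self_right])
  have BHp : Commute B Hp := commute_tri fun n c e n' c' e' => cond _ _ _ _ fun _ h =>
    (D.isFld_creB _).commute_isX (D.isX_ab (by omega)) (by rw [dot_cross, eVol_self_right])
  have HmHp : Commute Hm Hp := commute_tri fun n c e n' c' e' => cond _ _ _ _ fun h h' =>
    (D.isX_ab (by omega)).commute (D.isX_ab (by omega))
  have CNm : Commute C Nm := commute_tri fun n c e n' c' e' => cond _ _ _ _ fun _ _ =>
    D.commute_creC_bc _ _ _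
  have HpNm : Commute Hp Nm := commute_tri fun n c e n' c' e' => cond _ _ _ _ fun h h' =>
    (D.isX_ab (by omega)).commute (D.isX_bc (by omega))
  have ADm : Commute A Dm := commute_tri fun n c e n' c' e' => cond _ _ _ _ fun _ h =>
    (D.isFld_annA _).commute_isX (D.isX_ac (by omega)) (by rw [dot_cross, eVol_self_left])
  have ADp : Commute A Dp := commute_tri fun n c e n' c' e' => cond _ _ _ _ fun _ h =>
    (D.isFld_annA _).commute_isX (D.isX_ac (by omega)) (by rw [dot_cross, eVol_self_left])
  have CDm : Commute C Dm := commute_tri fun n c e n' c' e' => cond _ _ _ _ fun _ h =>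
    (D.isFld_creC _).commute_isX (D.isX_ac (by omega)) (by rw [dot_cross, eVol_self_right])
  have CDp : Commute C Dp := commute_tri fun n c e n' c' e' => cond _ _ _ _ fun _ h =>
    (D.isFld_creC _).commute_isX (D.isX_ac (by omega)) (by rw [dot_cross, eVol_self_right])
  have HpDm : Commute Hp Dm := commute_tri fun n c e n' c' e' => cond _ _ _ _ fun h h' =>
    (D.isX_ab (by omega)).commute (D.isX_ac (by omega))
  have HpDp : Commute Hp Dp := commute_tri fun n c e n' c' e' => cond _ _ _ _ fun h h' =>
    (D.isX_ab (by omega)).commute (D.isX_ac (by omega))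
  have NmDm : Commute Nm Dm := commute_tri fun n c e n' c' e' => cond _ _ _ _ fun h h' =>
    (D.isX_bc (by omega)).commute (D.isX_ac (by omega))
  have NmDp : Commute Nm Dp := commute_tri fun n c e n' c' e' => cond _ _ _ _ fun h h' =>
    (D.isX_bc (by omega)).commute (D.isX_ac (by omega))
  have DmDp : Commute Dm Dp := commute_tri fun n c e n' c' e' => cond _ _ _ _ fun h h' =>
    (D.isX_ac (by omega)).commute (D.isX_ac (by omega))
  have key := fexp_reorder mA mB mC mNm mH0 mHm mHp mD0 mDm mDp mK mL hAB hAC hHpC hANm cH0 cD0 cK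
    cL AHm AHp BHm BHp HmHp CNm HpNm ADm ADp CDm CDp HpDm HpDp NmDm NmDp DmDp
  have mS' : H0 + D0 + K + L ∈ (Filt.F 1 : Submodule ℂ _) :=
    Submodule.add_mem _ (Submodule.add_mem _ (Submodule.add_mem _ mH0 mD0) mK) mL
  have zN0 : ∀ t, fexp N0 * t = t * fexp N0 := fun t => fexp_commute mN0 (cN0 t)
  have eS : H0 + D0 + K + L + N0 = tri fun n c e => if e = n then D.expo n c else 0 := by
    rw [hH0def, hD0def, hKdef, hLdef, hN0def, tri_add, tri_add, tri_add, tri_add]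
    refine congrArg tri (funext fun n => funext fun c => funext fun e => ?_)
    by_cases h : e = n
    · subst h
      simp only [expo, true_and, and_true, if_true]
      congr 1
      · congr 2
        congr 1
        by_cases hc : c = e
        · simp [hc]
        · simp [hc, Ne.symm hc]
      · by_cases h0 : e = 0 <;> simp [h0]
    · rw [if_neg h, if_neg (fun h' => h h'.2), if_neg (fun h' => h (h'.1.trans h'.2)),
        if_neg (fun h' => h h'.1), if_neg (fun h' => h h'.1), if_neg (fun h' => h (by omega))]
      simp
  set S : PowerSeries (PowerSeries (PowerSeries R)) :=
    tri fun n c e => if e = n then D.expo n c else 0 with hSdef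
  have mS : S ∈ (Filt.F 1 : Submodule ℂ _) := by
    rw [← eS]; exact Submodule.add_mem _ mS' mN0
  have eexpS : fexp (H0 + D0 + K + L) * fexp N0 = fexp S := by
    rw [← eS, fexp_add mS' mN0 (cN0 _).symm]
  -- `Q` collects the annihilation factors, `U` the creation factors and the central exponential
  set Q := fexp A * fexp Hp * fexp Dp with hQdef
  set U := fexp B * (fexp Hm * (fexp C * (fexp Nm * (fexp Dm * fexp S)))) with hUdef
  have key2 : fexp A * (fexp B * (fexp C * fexp (Nm + N0))) = U * Q := by
    rw [fexp_add mNm mN0 (cN0 _).symm, hUdef, ← eexpS]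
    have : fexp A * (fexp B * (fexp C * (fexp Nm * fexp N0))) =
        fexp A * fexp B * fexp C * fexp Nm * fexp N0 := by simp only [mul_assoc]
    rw [this, key, mul_assoc _ Q, ← zN0 Q]
    simp only [mul_assoc]
  -- exponents in `U`; the creation factors on the left; the factor `Q` on the vacuum
  refine ⟨U, ?_, ?_, ?_⟩
  · have low : ∀ f ∈ (Filt.F 1 : Submodule ℂ (PowerSeries (PowerSeries (PowerSeries R)))),
        f ∈ lowerSupport R → fexp f ∈ lowerSupport R := fun f h h' => lowerSupport_fexp h h'
    refine lowerSupport_mul (low _ mB ?_) (lowerSupport_mul (low _ mHm ?_) (lowerSupport_mul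
      (low _ mC ?_) (lowerSupport_mul (low _ mNm ?_) (lowerSupport_mul (low _ mDm ?_)
      (low _ mS ?_))))) <;>
    exact tri_mem_lowerSupport fun n c e h => if_neg (by omega)
  · have hJc : FiltClosed (coeffwise (coeffwise (coeffwise D.Jl))) :=
      coeffwise_closed (coeffwise_closed (coeffwise_closed D.Jl_closed))
    have hJm := coeffwise_mul_right (coeffwise_mul_right (coeffwise_mul_right D.Jl_mul))
    have hpow : ∀ f ∈ coeffwise (coeffwise (coeffwise D.Jl)), ∀ m,
        f ^ (m + 1) ∈ coeffwise (coeffwise (coeffwise D.Jl)) :=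
      fun f hf m => by rw [pow_succ']; exact hJm _ _ hf
    have one : ∀ f ∈ (Filt.F 1 : Submodule ℂ (PowerSeries (PowerSeries (PowerSeries R)))),
        f ∈ coeffwise (coeffwise (coeffwise D.Jl)) →
        fexp f - 1 ∈ coeffwise (coeffwise (coeffwise D.Jl)) :=
      fun f h h' => fexp_sub_one_mem hJc h (hpow f h')
    have step : ∀ f g h : PowerSeries (PowerSeries (PowerSeries R)),
        f - 1 ∈ coeffwise (coeffwise (coeffwise D.Jl)) →
        g - h ∈ coeffwise (coeffwise (coeffwise D.Jl)) →
        f * g - h ∈ coeffwise (coeffwise (coeffwise D.Jl)) := by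
      intro f g h h1 h2
      have := Submodule.add_mem _ (hJm g _ h1) h2
      rwa [sub_mul, one_mul, sub_add_sub_cancel] at this
    have itemem : ∀ (p : Prop) [Decidable p] (y : R), (p → y ∈ D.Jl) →
        (if p then y else 0) ∈ D.Jl := by
      intro p _ y h
      split_ifs with h1
      exacts [h h1, Submodule.zero_mem _]
    refine step _ _ _ (one _ mB ?_) (step _ _ _ (one _ mHm ?_) (step _ _ _ (one _ mC ?_)
      (step _ _ _ (one _ mNm ?_) (step _ _ _ (one _ mDm ?_) (by
        rw [sub_self]; exact Submodule.zero_mem _)))))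
    · exact tri_mem_coeffwise fun n c e => itemem _ _ fun _ => (D.isFld_creB e).mem_Jl (by omega)
    · exact tri_mem_coeffwise fun n c e => itemem _ _ fun _ =>
        (D.isX_ab (by omega)).mem_Jl (by omega)
    · exact tri_mem_coeffwise fun n c e => itemem _ _ fun _ => (D.isFld_creC c).mem_Jl (by omega)
    · exact tri_mem_coeffwise fun n c e => itemem _ _ fun _ =>
        (D.isX_bc (by omega)).mem_Jl (by omega)
    · exact tri_mem_coeffwise fun n c e => itemem _ _ fun _ =>
        (D.isX_ac (by omega)).mem_Jl (by omega)
  · have hJc : FiltClosed (coeffwise (coeffwise (coeffwise D.Jr))) :=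
      coeffwise_closed (coeffwise_closed (coeffwise_closed D.Jr_closed))
    have hJm := coeffwise_mul_left (coeffwise_mul_left (coeffwise_mul_left D.mul_Jr))
    have hpow : ∀ f ∈ coeffwise (coeffwise (coeffwise D.Jr)), ∀ m,
        f ^ (m + 1) ∈ coeffwise (coeffwise (coeffwise D.Jr)) :=
      fun f hf m => by rw [pow_succ]; exact hJm _ _ hf
    have one : ∀ f ∈ (Filt.F 1 : Submodule ℂ (PowerSeries (PowerSeries (PowerSeries R)))),
        f ∈ coeffwise (coeffwise (coeffwise D.Jr)) →
        fexp f - 1 ∈ coeffwise (coeffwise (coeffwise D.Jr)) :=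
      fun f h h' => fexp_sub_one_mem hJc h (hpow f h')
    have step : ∀ f g : PowerSeries (PowerSeries (PowerSeries R)),
        f - 1 ∈ coeffwise (coeffwise (coeffwise D.Jr)) →
        g - 1 ∈ coeffwise (coeffwise (coeffwise D.Jr)) →
        f * g - 1 ∈ coeffwise (coeffwise (coeffwise D.Jr)) := by
      intro f g h1 h2
      have := Submodule.add_mem _ (hJm f _ h2) h1
      rwa [mul_sub, mul_one, sub_add_sub_cancel] at this
    have itemem : ∀ (p : Prop) [Decidable p] (y : R), (p → y ∈ D.Jr) →
        (if p then y else 0) ∈ D.Jr := by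
      intro p _ y h
      split_ifs with h1
      exacts [h h1, Submodule.zero_mem _]
    have mQ : Q - 1 ∈ coeffwise (coeffwise (coeffwise D.Jr)) := by
      refine step _ _ (step _ _ (one _ mA ?_) (one _ mHp ?_)) (one _ mDp ?_)
      · exact tri_mem_coeffwise fun n c e => itemem _ _ fun _ => (D.isFld_annA n).mem_Jr (by omega)
      · exact tri_mem_coeffwise fun n c e => itemem _ _ fun _ =>
          (D.isX_ab (by omega)).mem_Jr (by omega)
      · exact tri_mem_coeffwise fun n c e => itemem _ _ fun _ =>
          (D.isX_ac (by omega)).mem_Jr (by omega)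
    have fin := hJm U _ mQ
    rw [mul_sub, mul_one, ← key2] at fin
    have eexpA : fexp A = PowerSeries.mapAlgHom ((cHom (PowerSeries R)).comp (cHom R))
        (fexp D.annA) := by
      rw [eA]
      exact (fexp_hom _ (mapAlgHom_mem _ fun n x hx =>
        cHom_mem n (cHom R x) (cHom_mem n x hx))
        (mem_F_one_of_coeff_zero D.coeff_zero_annA)).symm
    have eexpV : fexp B * (fexp C * fexp (Nm + N0)) = PowerSeries.C D.state := by
      have h1 := fexp_hom (cHom (PowerSeries (PowerSeries R))) cHom_mem
        (cHom_mem _ _ (mem_F_one_of_coeff_zero D.coeff_zero_creB))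
      have h2 := fexp_hom (cHom (PowerSeries (PowerSeries R))) cHom_mem
        (mem_F_one_of_coeff_zero D.coeff_zero_creC')
      have h3 := fexp_hom (cHom (PowerSeries (PowerSeries R))) cHom_mem
        (mem_F_one_of_coeff_zero D.coeff_zero_bcLow')
      rw [eB, eC, eN, ← h1, ← h2, ← h3, ← map_mul, ← map_mul]
      rfl
    intro n c e
    have := fin n c e
    rw [map_sub, map_sub, map_sub, eexpA, eexpV, PowerSeries.coeff_mul_C,
      PowerSeries.mapAlgHom_apply, PowerSeries.coeff_map, RingHom.coe_coe, AlgHom.comp_apply,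
      cHom_apply, cHom_apply, PowerSeries.coeff_C_mul, PowerSeries.coeff_C_mul] at this
    exact this

end VertexData


/-! ### Series in the ratios of the insertion points -/

theorem coeff_gradedSum (f : ℕ → Ser) (d : Fin 2 →₀ ℕ) : MvPowerSeries.coeff d (gradedSum f) =
    ∑ m ∈ Finset.range (d.degree + 1), MvPowerSeries.coeff d (f m) := by
  have h : MvPowerSeries.coeff d (gradedSum f) =
    MvPowerSeries.coeff d (∑ m ∈ Finset.range (d.degree + 1), f m) := rfl
  rw [h, map_sum]

/-- The filtration of `Ser` by total degree in the ratios. -/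
noncomputable instance : Filt Ser where
  F D :=
    { carrier := {f | ∀ d : Fin 2 →₀ ℕ, d.degree < D → MvPowerSeries.coeff d f = 0}
      add_mem' := fun hf hg d h => by rw [map_add, hf d h, hg d h, add_zero]
      zero_mem' := fun d _ => map_zero _
      smul_mem' := fun c f hf d h => by
        change c • MvPowerSeries.coeff d f = 0
        rw [hf d h, smul_zero] }
  mem_zero x d h := absurd h (Nat.not_lt_zero _)
  anti m n h f hf d hd := hf d (by omega)
  mul_mem {m n f g} hf hg d hd := by
    classical
    rw [MvPowerSeries.coeff_mul]
    refine Finset.sum_eq_zero fun p hp => ?_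
    have h1 := congrArg Finsupp.degree (Finset.HasAntidiagonal.mem_antidiagonal.mp hp)
    rw [map_add] at h1
    by_cases h2 : p.1.degree < m
    · rw [hf _ h2, zero_mul]
    · rw [hg _ (by omega), mul_zero]
  sep f h := MvPowerSeries.ext fun d => h (d.degree + 1) d (Nat.lt_succ_self _)
  complete f hf := ⟨gradedSum f, fun D d hd => by
    rw [map_sub, sub_eq_zero, coeff_gradedSum, map_sum]
    refine Finset.sum_subset (Finset.range_subset_range.mpr hd) fun m _ hm => ?_
    exact hf m d (by simpa using hm)⟩

theorem mem_F_one_ser {f : Ser} (h : MvPowerSeries.coeff 0 f = 0) :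
    f ∈ (Filt.F 1 : Submodule ℂ Ser) := fun d hd => by
  rw [(Finsupp.degree_eq_zero_iff d).mp (by omega), h]

theorem gradedSum_sub_mem {f : ℕ → Ser} (hf : ∀ m, f m ∈ (Filt.F m : Submodule ℂ Ser)) (D : ℕ) :
    gradedSum f - ∑ m ∈ Finset.range D, f m ∈ (Filt.F D : Submodule ℂ Ser) := fun d hd => by
  rw [map_sub, sub_eq_zero, coeff_gradedSum, map_sum]
  refine Finset.sum_subset (Finset.range_subset_range.mpr hd) fun m _ hm => ?_
  exact hf m d (by simpa using hm)

theorem gradedSum_eq {f : ℕ → Ser} (hf : ∀ m, f m ∈ (Filt.F m : Submodule ℂ Ser)) {s : Ser}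
    (hs : ∀ D, s - ∑ m ∈ Finset.range D, f m ∈ (Filt.F D : Submodule ℂ Ser)) :
    gradedSum f = s := Filt.ext_of fun D => by
  have := Submodule.sub_mem _ (gradedSum_sub_mem hf D) (hs D)
  rwa [sub_sub_sub_cancel_right] at this

theorem formalExp_eq_fexp {x : Ser} (hx : x ∈ (Filt.F 1 : Submodule ℂ Ser)) :
    formalExp x = fexp x :=
  gradedSum_eq (fun m => Submodule.smul_mem _ _ (Filt.pow_mem hx m)) (isExp_fexp hx)

theorem gradedSum_add (f g : ℕ → Ser) :
    gradedSum f + gradedSum g = gradedSum fun m => f m + g m := MvPowerSeries.ext fun d => by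
  simp only [map_add, coeff_gradedSum, Finset.sum_add_distrib]

theorem gradedSum_mul {f g : ℕ → Ser} (hf : ∀ m, f m ∈ (Filt.F m : Submodule ℂ Ser))
    (hg : ∀ m, g m ∈ (Filt.F m : Submodule ℂ Ser)) :
    gradedSum f * gradedSum g =
      gradedSum fun m => ∑ p ∈ Finset.HasAntidiagonal.antidiagonal m, f p.1 * g p.2 := by
  refine (gradedSum_eq (fun m => Submodule.sum_mem _ fun p hp => ?_) fun D => ?_).symm
  · rw [← Finset.HasAntidiagonal.mem_antidiagonal.mp hp]
    exact Filt.mul_mem (hf _) (hg _)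
  · have h1 : ∑ m ∈ Finset.range D, ∑ p ∈ Finset.HasAntidiagonal.antidiagonal m, f p.1 * g p.2 =
        ∑ i ∈ Finset.range D, f i * ∑ j ∈ Finset.range (D - i), g j := by
      simp only [Finset.Nat.sum_antidiagonal_eq_sum_range_succ_mk, Finset.mul_sum]
      exact (Finset.sum_range_diag_flip D fun i j => f i * g j)
    have h2 := Filt.mul_right (gradedSum_sub_mem hf D) (gradedSum g)
    have h3 : (∑ i ∈ Finset.range D, f i) * gradedSum g -
        ∑ i ∈ Finset.range D, f i * ∑ j ∈ Finset.range (D - i), g j ∈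
          (Filt.F D : Submodule ℂ Ser) := by
      rw [Finset.sum_mul, ← Finset.sum_sub_distrib]
      refine Submodule.sum_mem _ fun i hi => ?_
      have := Filt.mul_mem (hf i) (gradedSum_sub_mem hg (D - i))
      rw [← mul_sub]
      rwa [Nat.add_sub_cancel' (Finset.mem_range.mp hi).le] at this
    rw [h1]
    have h4 := Submodule.add_mem _ h2 h3
    rw [sub_mul] at h4
    simpa using h4

theorem smul_pow_mem {x : Ser} (hx : x ∈ (Filt.F 1 : Submodule ℂ Ser)) (z : ℕ → ℂ) (m : ℕ) :
    z m • x ^ m ∈ (Filt.F m : Submodule ℂ Ser) := Submodule.smul_mem _ _ (Filt.pow_mem hx m)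

theorem geom_mul {x : Ser} (hx : x ∈ (Filt.F 1 : Submodule ℂ Ser)) : geom x = 1 + x * geom x := by
  refine gradedSum_eq (fun m => Filt.pow_mem hx m) fun D => ?_
  rcases D with _ | D
  · exact Filt.mem_zero _
  · have h := Filt.mul_mem hx (gradedSum_sub_mem (fun m => Filt.pow_mem hx m) D)
    rw [Finset.sum_range_succ', pow_zero]
    rw [mul_sub, Finset.mul_sum, add_comm 1 D] at h
    simp only [pow_succ']
    convert h using 1
    rw [geom]
    ring

/-! ### The five-term relation for the dilogarithm -/

/-- The Euler derivation `a ∂ / ∂ a` in the variable `a = w / z`. -/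
noncomputable def euler : Derivation (MvPolynomial (Fin 3) ℂ) Ser Ser :=
  wz • MvPowerSeries.pderiv (MvPolynomial (Fin 3) ℂ) 0

theorem coeff_euler (f : Ser) (d : Fin 2 →₀ ℕ) :
    MvPowerSeries.coeff d (euler f) = (d 0 : ℂ) • MvPowerSeries.coeff d f := by
  classical
  change MvPowerSeries.coeff d (wz * MvPowerSeries.pderiv _ 0 f) = _
  rw [wz, MvPowerSeries.X_def, MvPowerSeries.coeff_monomial_mul]
  split_ifs with h
  · rw [MvPowerSeries.coeff_pderiv, one_mul, tsub_add_cancel_of_le h]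
    have h1 : 1 ≤ d 0 := by simpa using h 0
    rw [Finsupp.tsub_apply, Finsupp.single_eq_same, Nat.cast_sub h1, Algebra.smul_def, mul_comm]
    simp
  · have h1 : d 0 = 0 := by
      by_contra h1
      refine h fun i => ?_
      fin_cases i
      · simpa using Nat.one_le_iff_ne_zero.mpr h1
      · simp
    rw [h1, Nat.cast_zero, zero_smul]

theorem euler_smul (z : ℂ) (f : Ser) : euler (z • f) = z • euler f := MvPowerSeries.ext fun d => by
  change _ = z • MvPowerSeries.coeff d (euler f)
  rw [coeff_euler, coeff_euler, smul_comm]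
  rfl

theorem euler_gradedSum (f : ℕ → Ser) : euler (gradedSum f) = gradedSum fun m => euler (f m) :=
  MvPowerSeries.ext fun d => by
    simp only [coeff_euler, coeff_gradedSum, Finset.smul_sum]

theorem gradedSum_mul_const {f : ℕ → Ser} (hf : ∀ m, f m ∈ (Filt.F m : Submodule ℂ Ser)) (u : Ser) :
    gradedSum (fun m => f m * u) = gradedSum f * u := by
  refine gradedSum_eq (fun m => Filt.mul_right (hf m) u) fun D => ?_
  rw [← Finset.sum_mul, ← sub_mul]
  exact Filt.mul_right (gradedSum_sub_mem hf D) u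

theorem euler_pow {x u : Ser} (h : euler x = x * u) (m : ℕ) :
    euler (x ^ m) = (m : ℂ) • (x ^ m * u) := by
  induction m with
  | zero => simp
  | succ m ih =>
    rw [pow_succ, Derivation.leibniz, ih, h, Nat.cast_succ, add_smul, one_smul]
    simp only [smul_eq_mul, mul_smul_comm]
    rw [add_comm]
    congr 1
    · congr 1; ring
    · ring

theorem euler_li2 {x u : Ser} (hx : x ∈ (Filt.F 1 : Submodule ℂ Ser)) (h : euler x = x * u) :
    euler (li2 x) = -(logOneSub x * u) := by
  rw [li2, logOneSub, euler_gradedSum, ← mul_neg,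
    ← gradedSum_mul_const (smul_pow_mem hx _)]
  congr 1
  funext m
  rw [euler_smul, euler_pow h, smul_smul, smul_mul_assoc, mul_neg, smul_neg, ← neg_smul, neg_neg]
  congr 1
  rcases Nat.eq_zero_or_pos m with rfl | hm
  · simp
  · have : (m : ℂ) ≠ 0 := by exact_mod_cast hm.ne'
    field_simp

theorem euler_logOneSub {x u : Ser} (hx : x ∈ (Filt.F 1 : Submodule ℂ Ser)) (h : euler x = x * u) :
    euler (logOneSub x) = -(x * geom x * u) := by
  have h1 : euler (logOneSub x) + geom x * u = gradedSum fun m => if m = 0 then u else 0 := by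
    rw [logOneSub, geom, euler_gradedSum, ← gradedSum_mul_const (fun m => Filt.pow_mem hx m),
      gradedSum_add]
    congr 1
    funext m
    rw [euler_smul, euler_pow h, smul_smul]
    rcases Nat.eq_zero_or_pos m with rfl | hm
    · simp
    · have : (m : ℂ) ≠ 0 := by exact_mod_cast hm.ne'
      rw [if_neg hm.ne', neg_mul, one_div_mul_cancel this, neg_one_smul, neg_add_cancel]
  have h2 : (gradedSum fun m => if m = 0 then u else 0) = u := MvPowerSeries.ext fun d => by
    rw [coeff_gradedSum, Finset.sum_eq_single 0 (fun m _ hm => by rw [if_neg hm, map_zero])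
      (fun h => absurd (Finset.mem_range.mpr (Nat.succ_pos _)) h), if_pos rfl]
  rw [h2] at h1
  linear_combination h1 - u * geom_mul hx

/-- The series that vanish at `a = 0`. -/
noncomputable def vanishing : Submodule ℂ Ser where
  carrier := {f | ∀ d : Fin 2 →₀ ℕ, d 0 = 0 → MvPowerSeries.coeff d f = 0}
  add_mem' := fun hf hg d h => by rw [map_add, hf d h, hg d h, add_zero]
  zero_mem' := fun d _ => map_zero _
  smul_mem' := fun c f hf d h => by
    change c • MvPowerSeries.coeff d f = 0
    rw [hf d h, smul_zero]

theorem vanishing_mul {f : Ser} (hf : f ∈ vanishing) (g : Ser) : f * g ∈ vanishing := by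
  classical
  intro d hd
  rw [MvPowerSeries.coeff_mul]
  refine Finset.sum_eq_zero fun p hp => ?_
  have h := DFunLike.congr_fun (Finset.HasAntidiagonal.mem_antidiagonal.mp hp) 0
  rw [Finsupp.add_apply, hd] at h
  rw [hf p.1 (by omega), zero_mul]

theorem vanishing_gradedSum {f : ℕ → Ser} (h : ∀ m, f m ∈ vanishing) :
    gradedSum f ∈ vanishing := fun d hd => by
  rw [coeff_gradedSum]
  exact Finset.sum_eq_zero fun m _ => h m d hd

theorem vanishing_gradedSum_pow {x : Ser} (hx : x ∈ vanishing) (z : ℕ → ℂ) (hz : z 0 = 0) :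
    (gradedSum fun m => z m • x ^ m) ∈ vanishing := vanishing_gradedSum fun m => by
  rcases m with _ | m
  · rw [hz, zero_smul]; exact Submodule.zero_mem _
  · rw [pow_succ']; exact Submodule.smul_mem _ _ (vanishing_mul hx _)

theorem li2_vanishing {x : Ser} (hx : x ∈ vanishing) : li2 x ∈ vanishing :=
  vanishing_gradedSum_pow hx (fun m => 1 / (m : ℂ) ^ 2) (by simp)

theorem logOneSub_vanishing {x : Ser} (hx : x ∈ vanishing) : logOneSub x ∈ vanishing :=
  vanishing_gradedSum_pow hx (fun m => -(1 / (m : ℂ))) (by simp)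

theorem eq_of_euler_eq {f g : Ser} (hf : f ∈ vanishing) (hg : g ∈ vanishing)
    (h : euler f = euler g) : f = g := MvPowerSeries.ext fun d => by
  by_cases hd : d 0 = 0
  · rw [hf d hd, hg d hd]
  · have h1 := congrArg (MvPowerSeries.coeff d) h
    rw [coeff_euler, coeff_euler] at h1
    exact smul_right_injective _ (by exact_mod_cast hd) h1

theorem wz_mem : wz ∈ (Filt.F 1 : Submodule ℂ Ser) :=
  mem_F_one_ser (MvPowerSeries.coeff_zero_X _)

theorem tw_mem : tw ∈ (Filt.F 1 : Submodule ℂ Ser) :=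
  mem_F_one_ser (MvPowerSeries.coeff_zero_X _)

theorem wz_mul_mem (f : Ser) : wz * f ∈ (Filt.F 1 : Submodule ℂ Ser) := Filt.mul_right wz_mem f

theorem wz_vanishing : wz ∈ vanishing := fun d hd => by
  classical
  rw [wz, MvPowerSeries.coeff_X, if_neg]
  rintro rfl
  simp at hd

theorem euler_wz : euler wz = wz * 1 := by
  change wz * MvPowerSeries.pderiv _ 0 (MvPowerSeries.X 0) = _
  rw [MvPowerSeries.pderiv_X_self]

theorem euler_tw : euler tw = 0 := by
  change wz * MvPowerSeries.pderiv _ 0 (MvPowerSeries.X 1) = _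
  rw [MvPowerSeries.pderiv_X_of_ne (by decide), mul_zero]

theorem euler_wz_tw : euler (wz * tw) = (wz * tw) * 1 := by
  rw [Derivation.leibniz, euler_wz, euler_tw]
  simp only [smul_eq_mul]
  ring

theorem euler_geom {x u : Ser} (hx : x ∈ (Filt.F 1 : Submodule ℂ Ser)) (h : euler x = x * u) :
    euler (geom x) = geom x * (x * u * geom x) := by
  have h1 : euler (geom x) = euler (1 + x * geom x) := by rw [← geom_mul hx]
  rw [map_add, Derivation.map_one_eq_zero, Derivation.leibniz, h] at h1
  simp only [smul_eq_mul] at h1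
  have h2 : (geom x) * (1 - x) = 1 := by linear_combination geom_mul hx
  linear_combination geom x * h1 - (euler (geom x)) * h2

/-- The logarithmic derivative of the ratio `(w - t) / (z - t)` with respect to `w / z`, at fixed
`t / w`, is `1 / (1 - t / z)`. -/
theorem euler_shift : euler (wz * (1 - tw) * geom (wz * tw)) =
    wz * (1 - tw) * geom (wz * tw) * geom (wz * tw) := by
  rw [Derivation.leibniz, Derivation.leibniz, euler_geom (wz_mul_mem _) euler_wz_tw, euler_wz,
    map_sub, Derivation.map_one_eq_zero, euler_tw]
  simp only [smul_eq_mul]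
  linear_combination (-(wz * (1 - tw) * geom (wz * tw))) * geom_mul (wz_mul_mem tw)

theorem shift_mem : wz * (1 - tw) * geom (wz * tw) ∈ (Filt.F 1 : Submodule ℂ Ser) := by
  rw [mul_assoc]; exact wz_mul_mem _

/-- `1 - (w - t) / (z - t) = (1 - w / z) / (1 - t / z)`. -/
theorem logOneSub_shift : logOneSub (wz * (1 - tw) * geom (wz * tw)) =
    logOneSub wz - logOneSub (wz * tw) := by
  refine eq_of_euler_eq (logOneSub_vanishing ?_) (Submodule.sub_mem _ (logOneSub_vanishing
    wz_vanishing) (logOneSub_vanishing (vanishing_mul wz_vanishing _))) ?_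
  · rw [mul_assoc]; exact vanishing_mul wz_vanishing _
  · rw [map_sub, euler_logOneSub shift_mem euler_shift, euler_logOneSub wz_mem euler_wz,
      euler_logOneSub (wz_mul_mem _) euler_wz_tw]
    have h1 := geom_mul (wz_mul_mem tw)
    have h2 := geom_mul wz_mem
    have h3 := geom_mul shift_mem
    set r := wz * (1 - tw) * geom (wz * tw) with hr
    have h5 : 1 - r = (1 - wz) * geom (wz * tw) := by linear_combination (-1) * hr - h1
    have h4 : geom r = geom wz * (1 - wz * tw) := by
      have h6 : (1 - wz) * geom (wz * tw) * geom r = 1 := by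
        linear_combination h3 - geom r * h5
      linear_combination geom wz * (1 - wz * tw) * h6 -
        geom r * (geom (wz * tw) * (1 - wz * tw) * h2 + h1)
    linear_combination geom (wz * tw) * h3 - h2 + h1 - geom (wz * tw) * h4 - geom wz * h1

/-- The series with coefficients `z n c` at `a^n b^c`. -/
noncomputable def coeffSer (z : ℕ → ℕ → MvPolynomial (Fin 3) ℂ) : Ser := fun d => z (d 0) (d 1)

theorem coeff_coeffSer (z : ℕ → ℕ → MvPolynomial (Fin 3) ℂ) (d : Fin 2 →₀ ℕ) :
    MvPowerSeries.coeff d (coeffSer z) = z (d 0) (d 1) := rfl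

theorem coeffSer_add (y z : ℕ → ℕ → MvPolynomial (Fin 3) ℂ) :
    coeffSer y + coeffSer z = coeffSer fun n c => y n c + z n c := rfl

theorem coeffSer_smul (t : ℂ) (z : ℕ → ℕ → MvPolynomial (Fin 3) ℂ) :
    t • coeffSer z = coeffSer fun n c => t • z n c := rfl

theorem C_mul_coeffSer (p : MvPolynomial (Fin 3) ℂ) (z : ℕ → ℕ → MvPolynomial (Fin 3) ℂ) :
    MvPowerSeries.C p * coeffSer z = coeffSer fun n c => p * z n c :=
  MvPowerSeries.ext fun d => by rw [MvPowerSeries.coeff_C_mul]; rfl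

theorem euler_coeffSer (z : ℕ → ℕ → MvPolynomial (Fin 3) ℂ) :
    euler (coeffSer z) = coeffSer fun n c => (n : ℂ) • z n c :=
  MvPowerSeries.ext fun d => by rw [coeff_euler]; rfl

theorem wz_mul_coeffSer (z : ℕ → ℕ → MvPolynomial (Fin 3) ℂ) :
    wz * coeffSer z = coeffSer fun n c => if n = 0 then 0 else z (n - 1) c :=
  MvPowerSeries.ext fun d => by
    classical
    rw [wz, MvPowerSeries.X_def, MvPowerSeries.coeff_monomial_mul, one_mul, coeff_coeffSer,
      coeff_coeffSer]
    by_cases hd : d 0 = 0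
    · rw [if_pos hd, if_neg fun h => ?_]
      have := h 0
      simp [hd] at this
    · rw [if_neg hd, if_pos]
      · simp
      · intro i
        fin_cases i
        · simpa using Nat.one_le_iff_ne_zero.mpr hd
        · simp

theorem tw_mul_coeffSer (z : ℕ → ℕ → MvPolynomial (Fin 3) ℂ) :
    tw * coeffSer z = coeffSer fun n c => if c = 0 then 0 else z n (c - 1) :=
  MvPowerSeries.ext fun d => by
    classical
    rw [tw, MvPowerSeries.X_def, MvPowerSeries.coeff_monomial_mul, one_mul, coeff_coeffSer,
      coeff_coeffSer]
    by_cases hd : d 1 = 0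
    · rw [if_pos hd, if_neg fun h => ?_]
      have := h 1
      simp [hd] at this
    · rw [if_neg hd, if_pos]
      · simp
      · intro i
        fin_cases i
        · simp
        · simpa using Nat.one_le_iff_ne_zero.mpr hd

theorem one_eq_coeffSer : (1 : Ser) = coeffSer fun n c => if n = 0 ∧ c = 0 then 1 else 0 :=
  MvPowerSeries.ext fun d => by
    classical
    rw [MvPowerSeries.coeff_one, coeff_coeffSer]
    congr 1
    refine propext ⟨fun h => by simp [h], fun h => Finsupp.ext fun i => ?_⟩
    fin_cases i
    · exact h.1
    · exact h.2

theorem wz_pow (m : ℕ) : wz ^ m = coeffSer fun n c => if c = 0 ∧ m = n then 1 else 0 := by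
  induction m with
  | zero =>
    rw [pow_zero, one_eq_coeffSer]
    congr! 4 with n c
    tauto
  | succ m ih =>
    rw [pow_succ', ih, wz_mul_coeffSer]
    refine congrArg coeffSer (funext fun n => funext fun c => ?_)
    split_ifs <;> first | rfl | omega

theorem tw_pow (m : ℕ) : tw ^ m = coeffSer fun n c => if n = 0 ∧ m = c then 1 else 0 := by
  induction m with
  | zero =>
    rw [pow_zero, one_eq_coeffSer]
    congr! 4 with n c
    tauto
  | succ m ih =>
    rw [pow_succ', ih, tw_mul_coeffSer]
    refine congrArg coeffSer (funext fun n => funext fun c => ?_)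
    split_ifs <;> first | rfl | omega

theorem wz_tw_pow (m : ℕ) :
    (wz * tw) ^ m = coeffSer fun n c => if n = c ∧ m = n then 1 else 0 := by
  induction m with
  | zero =>
    rw [pow_zero, one_eq_coeffSer]
    congr! 4 with n c
    omega
  | succ m ih =>
    rw [pow_succ', ih, mul_assoc, tw_mul_coeffSer, wz_mul_coeffSer]
    refine congrArg coeffSer (funext fun n => funext fun c => ?_)
    split_ifs <;> first | rfl | omega

theorem gradedSum_coeffSer {x : Ser} {Q : ℕ → ℕ → Prop} [∀ n c, Decidable (Q n c)]
    {μ : ℕ → ℕ → ℕ} (hx : ∀ m, x ^ m = coeffSer fun n c => if Q n c ∧ m = μ n c then 1 else 0)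
    (hμ : ∀ n c, μ n c ≤ n + c) (z : ℕ → ℂ) : (gradedSum fun m => z m • x ^ m) =
      coeffSer fun n c => if Q n c then MvPolynomial.C (z (μ n c)) else 0 :=
  MvPowerSeries.ext fun d => by
    have hd : d.degree = d 0 + d 1 := by rw [Finsupp.degree_eq_sum, Fin.sum_univ_two]
    rw [coeff_gradedSum, coeff_coeffSer, Finset.sum_eq_single (μ (d 0) (d 1))]
    · rw [hx, coeffSer_smul, coeff_coeffSer]
      by_cases h : Q (d 0) (d 1)
      · rw [if_pos h, if_pos ⟨h, rfl⟩, MvPolynomial.C_eq_smul_one]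
      · rw [if_neg h, if_neg fun h' => h h'.1, smul_zero]
    · intro m _ hm
      rw [hx, coeffSer_smul, coeff_coeffSer, if_neg fun h' => hm h'.2, smul_zero]
    · intro h
      have := hμ (d 0) (d 1)
      exact absurd (Finset.mem_range.mpr (by omega)) h

theorem gradedSum_wz (z : ℕ → ℂ) : (gradedSum fun m => z m • wz ^ m) =
    coeffSer fun n c => if c = 0 then MvPolynomial.C (z n) else 0 :=
  gradedSum_coeffSer wz_pow (fun _ _ => Nat.le_add_right _ _) z

theorem gradedSum_tw (z : ℕ → ℂ) : (gradedSum fun m => z m • tw ^ m) =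
    coeffSer fun n c => if n = 0 then MvPolynomial.C (z c) else 0 :=
  gradedSum_coeffSer tw_pow (fun _ _ => Nat.le_add_left _ _) z

theorem gradedSum_wz_tw (z : ℕ → ℂ) : (gradedSum fun m => z m • (wz * tw) ^ m) =
    coeffSer fun n c => if n = c then MvPolynomial.C (z n) else 0 :=
  gradedSum_coeffSer wz_tw_pow (fun _ _ => Nat.le_add_right _ _) z

/-- The coefficient of `a^n b^c` in the part of the dilogarithm of the shifted pair that mixes
`a` and `b` off the diagonal. -/
noncomputable def mixedCoeff (n c : ℕ) : ℂ :=
  if 0 < c ∧ c < n then 1 / ((n : ℂ) * ((n : ℂ) - (c : ℂ)))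
  else if 0 < n ∧ n < c then -(1 / ((c : ℂ) * ((c : ℂ) - (n : ℂ)))) else 0

/-- `2 Li₂(r) + (log(1-b) - log(1-ab)) log(1-r) = 2 Li₂(a) - Li₂(ab) + ∑ mixed`, where `a = w / z`,
`b = t / w` and `r = (w - t) / (z - t)`. Both sides vanish at `a = 0`, so it is enough to compare
their Euler derivatives, which involve only logarithms and geometric series. -/
theorem five_term : 2 * li2 (wz * (1 - tw) * geom (wz * tw)) +
    (logOneSub tw - logOneSub (wz * tw)) * (logOneSub wz - logOneSub (wz * tw)) =
    2 * li2 wz - li2 (wz * tw) + coeffSer fun n c => MvPolynomial.C (mixedCoeff n c) := by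
  have hS : euler (coeffSer fun n c => MvPolynomial.C (mixedCoeff n c)) =
      -(wz * tw * geom (wz * tw) * logOneSub wz) + wz * tw * geom (wz * tw) * logOneSub tw
        - (wz * logOneSub tw - logOneSub (wz * tw)) * geom wz := by
    have sub : ∀ y z, coeffSer y - coeffSer z = coeffSer fun n c => y n c - z n c :=
      fun _ _ => rfl
    have hk := gradedSum_wz fun m => -(1 / (m : ℂ))
    have hb := gradedSum_tw fun m => -(1 / (m : ℂ))
    have hl := gradedSum_wz_tw fun m => -(1 / (m : ℂ))
    change logOneSub _ = _ at hk hb hl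
    have h1 := geom_mul (wz_mul_mem tw)
    have h2 := geom_mul wz_mem
    -- the parts of the derivative below and above the diagonal; each one satisfies a linear
    -- recurrence in `a b` or in `a`
    set T1 : Ser := coeffSer fun n c => if 0 < c ∧ c < n then
      MvPolynomial.C (1 / ((n : ℂ) - (c : ℂ))) else 0 with hT1
    set T2 : Ser := coeffSer fun n c => if 0 < n ∧ n < c then
      MvPolynomial.C (1 / ((c : ℂ) - (n : ℂ))) else 0 with hT2
    set T3 : Ser := coeffSer fun n c => if 0 < n ∧ n < c then
      MvPolynomial.C (1 / (c : ℂ)) else 0 with hT3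
    have e0 : euler (coeffSer fun n c => MvPolynomial.C (mixedCoeff n c)) = T1 - T2 + T3 := by
      rw [euler_coeffSer, hT1, hT2, hT3, sub, coeffSer_add]
      refine congrArg coeffSer (funext fun n => funext fun c => ?_)
      rw [mixedCoeff, MvPolynomial.smul_eq_C_mul, ← map_mul]
      by_cases h : 0 < c ∧ c < n
      · have h' : ¬(0 < n ∧ n < c) := by omega
        have hn : (n : ℂ) ≠ 0 := by exact_mod_cast (show n ≠ 0 by omega)
        have hnc : (n : ℂ) - c ≠ 0 := sub_ne_zero.mpr (by exact_mod_cast (show n ≠ c by omega))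
        simp only [if_pos h, if_neg h', sub_zero, add_zero]
        congr 1
        field_simp
      · by_cases h' : 0 < n ∧ n < c
        · have hn : (c : ℂ) ≠ 0 := by exact_mod_cast (show c ≠ 0 by omega)
          have hnc : (c : ℂ) - n ≠ 0 := sub_ne_zero.mpr (by exact_mod_cast (show c ≠ n by omega))
          simp only [if_neg h, if_pos h', zero_sub, ← map_neg, ← map_add]
          congr 1
          field_simp
          ring
        · simp only [if_neg h, if_neg h', mul_zero, map_zero, sub_zero, add_zero]
    have e1 : T1 - wz * (tw * T1) = wz * (tw * (0 - logOneSub wz)) := by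
      have h0 : (0 : Ser) = coeffSer fun _ _ => 0 := rfl
      rw [hT1, hk, h0, sub, tw_mul_coeffSer, tw_mul_coeffSer, wz_mul_coeffSer, wz_mul_coeffSer, sub]
      refine congrArg coeffSer (funext fun n => funext fun c => ?_)
      rcases n with _ | n <;> rcases c with _ | c <;> simp
      rcases Nat.eq_zero_or_pos c with rfl | hc
      · rcases Nat.eq_zero_or_pos n with rfl | hn
        · simp
        · simp [hn]
      · simp [hc, hc.ne']
    have e2 : T2 - wz * (tw * T2) = wz * (tw * (0 - logOneSub tw)) := by
      have h0 : (0 : Ser) = coeffSer fun _ _ => 0 := rfl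
      rw [hT2, hb, h0, sub, tw_mul_coeffSer, tw_mul_coeffSer, wz_mul_coeffSer, wz_mul_coeffSer, sub]
      refine congrArg coeffSer (funext fun n => funext fun c => ?_)
      rcases n with _ | n <;> rcases c with _ | c <;> simp
      rcases Nat.eq_zero_or_pos n with rfl | hn
      · rcases Nat.eq_zero_or_pos c with rfl | hc
        · simp
        · simp [hc]
      · simp [hn, hn.ne']
    have e3 : T3 - wz * T3 = logOneSub (wz * tw) - wz * logOneSub tw := by
      rw [hT3, hb, hl, wz_mul_coeffSer, wz_mul_coeffSer, sub, sub]
      refine congrArg coeffSer (funext fun n => funext fun c => ?_)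
      rcases n with _ | n <;> rcases c with _ | c <;> simp
      rcases Nat.eq_zero_or_pos n with rfl | hn
      · rcases Nat.eq_zero_or_pos c with rfl | hc
        · simp
        · simp [hc, hc.ne]
      · rcases lt_trichotomy n c with h | h | h
        · simp [hn, h, h.le, h.ne, hn.ne']
        · subst h; simp [hn, hn.ne']
        · simp [h.not_gt, h.not_ge, h.ne', hn.ne']
    rw [e0]
    linear_combination geom (wz * tw) * e1 - geom (wz * tw) * e2 + geom wz * e3 -
      (T1 - T2) * h1 - T3 * h2
  have ht : euler (logOneSub tw) = 0 := by
    rw [euler_logOneSub tw_mem (u := 0) (by rw [euler_tw, mul_zero]), mul_zero, neg_zero]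
  have e2 : ∀ f, euler (2 * f) = 2 * euler f := fun f => by rw [two_mul, map_add, two_mul]
  refine eq_of_euler_eq ?_ ?_ ?_
  · refine Submodule.add_mem _ ?_ ?_
    · rw [mul_comm]
      refine vanishing_mul (li2_vanishing ?_) _
      rw [mul_assoc]; exact vanishing_mul wz_vanishing _
    · rw [mul_comm]
      exact vanishing_mul (Submodule.sub_mem _ (logOneSub_vanishing wz_vanishing)
        (logOneSub_vanishing (vanishing_mul wz_vanishing _))) _
  · refine Submodule.add_mem _ (Submodule.sub_mem _ ?_
      (li2_vanishing (vanishing_mul wz_vanishing _))) ?_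
    · rw [mul_comm]
      exact vanishing_mul (li2_vanishing wz_vanishing) _
    · intro d hd
      rw [coeff_coeffSer, mixedCoeff, hd, if_neg (by omega), if_neg (by omega), map_zero]
  · rw [map_add, map_add, map_sub, hS, e2, e2, Derivation.leibniz, map_sub, map_sub, ht,
      euler_li2 shift_mem euler_shift, euler_li2 wz_mem euler_wz,
      euler_li2 (wz_mul_mem _) euler_wz_tw, euler_logOneSub wz_mem euler_wz,
      euler_logOneSub (wz_mul_mem _) euler_wz_tw, logOneSub_shift]
    simp only [smul_eq_mul]
    linear_combination (-2 * logOneSub wz + 2 * logOneSub (wz * tw)) * geom_mul (wz_mul_mem tw) -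
      logOneSub (wz * tw) * geom_mul wz_mem

/-- The coefficients of Rogers' dilogarithm `L(b/a)`; `A` and `B` are the indices of the
logarithms of `a` and `b`. -/
noncomputable def rogersCoeff (A B : Fin 3) (n : ℕ) : MvPolynomial (Fin 3) ℂ :=
  MvPolynomial.C (1 / (n : ℂ) ^ 2) +
    MvPolynomial.C (1 / (2 * (n : ℂ))) * (MvPolynomial.X A - MvPolynomial.X B)

theorem rogersL_aux (A B : Fin 3) {x : Ser} {Q : ℕ → ℕ → Prop} [∀ n c, Decidable (Q n c)]
    {μ : ℕ → ℕ → ℕ} (hx : ∀ z : ℕ → ℂ, (gradedSum fun m => z m • x ^ m) =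
      coeffSer fun n c => if Q n c then MvPolynomial.C (z (μ n c)) else 0) :
    rogersL ⟨MvPowerSeries.C (MvPolynomial.X A), MvPowerSeries.C (MvPolynomial.X B), x⟩ =
      coeffSer fun n c => if Q n c then rogersCoeff A B (μ n c) else 0 := by
  have h1 : li2 x = _ := hx fun m => 1 / (m : ℂ) ^ 2
  have h2 : logOneSub x = _ := hx fun m => -(1 / (m : ℂ))
  rw [rogersL, h1, h2, ← map_sub, C_mul_coeffSer, coeffSer_smul, coeffSer_add]
  refine congrArg coeffSer (funext fun n => funext fun c => ?_)
  split_ifs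
  · rw [rogersCoeff, MvPolynomial.smul_eq_C_mul, mul_left_comm, ← map_mul, mul_comm]
    have : (1 : ℂ) / 2 * -(1 / (μ n c : ℂ)) = -(1 / (2 * (μ n c : ℂ))) := by
      rw [one_div, one_div, one_div, mul_inv, mul_neg]
    rw [this, map_neg]
    ring
  · rw [mul_zero, smul_zero, add_zero]

theorem rogersL_pairWT : rogersL pairWT =
    coeffSer fun n c => if n = 0 then rogersCoeff 1 2 c else 0 :=
  rogersL_aux 1 2 gradedSum_tw

theorem rogersL_pairZT : rogersL pairZT =
    coeffSer fun n c => if n = c then rogersCoeff 0 2 n else 0 :=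
  rogersL_aux 0 2 gradedSum_wz_tw

theorem rogersL_pairZW : rogersL pairZW =
    coeffSer fun n c => if c = 0 then rogersCoeff 0 1 n else 0 :=
  rogersL_aux 0 1 gradedSum_wz

/-- The coefficients of Rogers' dilogarithm at `(w - t) / (z - t)`, by the five-term relation. -/
noncomputable def shiftCoeff (n c : ℕ) : MvPolynomial (Fin 3) ℂ :=
  (if c = 0 then rogersCoeff 0 1 n else 0) +
    (if n = c then MvPolynomial.C (-(1 / (2 * (n : ℂ) ^ 2))) +
      MvPolynomial.C (1 / (2 * (n : ℂ))) * (MvPolynomial.X 1 - MvPolynomial.X 0) else 0) +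
    MvPolynomial.C (mixedCoeff n c / 2)

theorem rogersL_pairShift : rogersL pairShift = coeffSer shiftCoeff := by
  have h5 := congrArg (fun f : Ser => ((1 : ℂ) / 2) • f) five_term
  have h1 : rogersL pairShift = rogersL pairZW + (-(1 : ℂ) / 2) • li2 (wz * tw) +
      ((1 : ℂ) / 2) • (coeffSer fun n c => MvPolynomial.C (mixedCoeff n c)) +
      (-(1 : ℂ) / 2) • ((logw - logz) * logOneSub (wz * tw)) := by
    simp only [rogersL, pairShift, pairZW, logOneSub_shift]
    have hh : ∀ f : Ser, ((1 : ℂ) / 2) • (2 * f) = f := fun f => by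
      rw [two_mul, smul_add, ← add_smul]; norm_num
    simp only [smul_add, smul_sub, hh] at h5
    have e1 : ((1 : ℂ) / 2) • ((logw + logOneSub tw - (logz + logOneSub (wz * tw))) *
        (logOneSub wz - logOneSub (wz * tw))) =
        ((1 : ℂ) / 2) • ((logOneSub tw - logOneSub (wz * tw)) *
        (logOneSub wz - logOneSub (wz * tw))) + ((1 : ℂ) / 2) • ((logw - logz) * logOneSub wz) -
        ((1 : ℂ) / 2) • ((logw - logz) * logOneSub (wz * tw)) := by
      rw [← smul_add, ← smul_sub]
      congr 1
      ring
    rw [e1, neg_div, neg_smul, neg_smul]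
    linear_combination h5
  have h2 : li2 (wz * tw) = _ := gradedSum_wz_tw fun m => 1 / (m : ℂ) ^ 2
  have h3 : logOneSub (wz * tw) = _ := gradedSum_wz_tw fun m => -(1 / (m : ℂ))
  rw [h1, rogersL_pairZW, h2, h3, logw, logz, ← map_sub, C_mul_coeffSer, coeffSer_smul,
    coeffSer_smul, coeffSer_smul, coeffSer_add, coeffSer_add, coeffSer_add]
  refine congrArg coeffSer (funext fun n => funext fun c => ?_)
  rw [shiftCoeff, add_assoc, add_assoc, add_assoc]
  congr 1
  rw [MvPolynomial.smul_eq_C_mul (MvPolynomial.C _), ← map_mul, one_div_mul_eq_div, add_left_comm,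
    add_comm]
  congr 1
  split_ifs with h
  · simp only [MvPolynomial.smul_eq_C_mul]
    rw [mul_left_comm, ← map_mul, ← map_mul, mul_comm (MvPolynomial.X 1 - MvPolynomial.X 0)]
    congr 2
    · rw [neg_div, one_div, one_div, one_div, mul_inv, neg_mul]
    · congr 1; rw [neg_div, one_div, one_div, one_div, mul_inv, neg_mul_neg]
  · simp only [mul_zero, smul_zero, add_zero]

/-- The coefficients of the exponent of the five-point function. -/
noncomputable def exponentCoeff (w : Fin 4 → Fin 3 → ℂ) (n c : ℕ) : MvPolynomial (Fin 3) ℂ :=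
  eVol (w 1) (w 2) (w 3) • (if n = 0 then rogersCoeff 1 2 c else 0) +
    eVol (w 0) (w 1) (w 3) • (if c = 0 then rogersCoeff 0 1 n else 0) +
    eVol (w 0) (w 2) (w 3) • (if n = c then rogersCoeff 0 2 n else 0) +
    eVol (w 0) (w 1) (w 2) • shiftCoeff n c

theorem exponent5_eq (w : Fin 4 → Fin 3 → ℂ) : exponent5 w = coeffSer (exponentCoeff w) := by
  rw [exponent5, rogersL_pairWT, rogersL_pairZW, rogersL_pairZT, rogersL_pairShift]
  rfl

theorem exponentCoeff_zero (w : Fin 4 → Fin 3 → ℂ) : exponentCoeff w 0 0 = 0 := by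
  simp [exponentCoeff, rogersCoeff, shiftCoeff, mixedCoeff]


/-! ### Formal series in three logarithms -/

/-- Formal series in `log z` (outermost), `log w` and `log t`. -/
abbrev LogRing (E : Type*) := PowerSeries (PowerSeries (PowerSeries E))

section LogRing

variable (E : Type*) [Ring E] [Algebra ℂ E]

/-- Constants in the ring of series in the logarithms. -/
noncomputable def logConst : E →ₐ[ℂ] LogRing E :=
  (cHom (PowerSeries (PowerSeries E))).comp ((cHom (PowerSeries E)).comp (cHom E))

/-- Series in `log z`. -/
noncomputable def inLogz : PowerSeries E →ₐ[ℂ] LogRing E :=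
  PowerSeries.mapAlgHom ((cHom (PowerSeries E)).comp (cHom E))

/-- Series in `log w`. -/
noncomputable def inLogw : PowerSeries E →ₐ[ℂ] LogRing E :=
  (cHom (PowerSeries (PowerSeries E))).comp (PowerSeries.mapAlgHom (cHom E))

/-- Series in `log t`. -/
noncomputable def inLogt : PowerSeries E →ₐ[ℂ] LogRing E :=
  (cHom (PowerSeries (PowerSeries E))).comp (cHom (PowerSeries E))

variable {E}

theorem coeff_inLog_mul (f g h : PowerSeries E) (k l m : ℕ) :
    coeff m (coeff l (coeff k (inLogz E f * inLogw E g * inLogt E h))) =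
      coeff k f * coeff l g * coeff m h := by
  have h1 : inLogw E g * inLogt E h = PowerSeries.C (PowerSeries.map PowerSeries.C g *
      PowerSeries.C h) := by
    rw [map_mul]
    rfl
  have h2 : coeff k (inLogz E f) = PowerSeries.C (PowerSeries.C (coeff k f)) := by
    rw [inLogz, PowerSeries.mapAlgHom_apply, PowerSeries.coeff_map]
    rfl
  rw [mul_assoc, h1, PowerSeries.coeff_mul_C, h2, PowerSeries.coeff_C_mul, PowerSeries.coeff_mul_C,
    PowerSeries.coeff_map, PowerSeries.coeff_C_mul, PowerSeries.coeff_C_mul, mul_assoc]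

/-- Polynomials in the logarithms as series with complex coefficients. -/
noncomputable def logPolyC : MvPolynomial (Fin 3) ℂ →ₐ[ℂ] LogRing ℂ :=
  MvPolynomial.aeval ![PowerSeries.X, PowerSeries.C PowerSeries.X,
    PowerSeries.C (PowerSeries.C PowerSeries.X)]

variable (E) in
/-- Polynomials in the logarithms as elements of the centre of `LogRing E`. -/
noncomputable def logPoly : MvPolynomial (Fin 3) ℂ →ₐ[ℂ] LogRing E :=
  (PowerSeries.mapAlgHom (PowerSeries.mapAlgHom (PowerSeries.mapAlgHom
    (Algebra.ofId ℂ E)))).comp logPolyC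

theorem coeff_logPolyC (p : MvPolynomial (Fin 3) ℂ) (k l m : ℕ) :
    coeff m (coeff l (coeff k (logPolyC p))) =
      MvPolynomial.coeff (Finsupp.equivFunOnFinite.symm ![k, l, m]) p := by
  induction p using MvPolynomial.induction_on' with
  | monomial u a =>
    rw [logPolyC, MvPolynomial.aeval_monomial, Finsupp.prod_fintype _ _ (by simp),
      Fin.prod_univ_three, MvPolynomial.coeff_monomial]
    simp only [Matrix.cons_val_zero, Matrix.cons_val_one, Matrix.cons_val]
    rw [← map_pow, ← map_pow, ← map_pow, mul_assoc, ← map_mul, ← Algebra.smul_def,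
      coeff_smul_complex, coeff_smul_complex, coeff_smul_complex, PowerSeries.coeff_mul_C,
      PowerSeries.coeff_X_pow]
    have hu : u = Finsupp.equivFunOnFinite.symm ![k, l, m] ↔ k = u 0 ∧ l = u 1 ∧ m = u 2 := by
      constructor
      · intro h
        rw [h]
        simp
      · rintro ⟨rfl, rfl, rfl⟩
        ext i
        fin_cases i <;> simp
    by_cases hk : k = u 0
    · rw [if_pos hk, one_mul, PowerSeries.coeff_mul_C, PowerSeries.coeff_X_pow]
      by_cases hl : l = u 1
      · rw [if_pos hl, one_mul, PowerSeries.coeff_X_pow]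
        by_cases hm : m = u 2
        · rw [if_pos hm, if_pos (hu.mpr ⟨hk, hl, hm⟩), smul_eq_mul, mul_one]
        · rw [if_neg hm, if_neg fun h => hm (hu.mp h).2.2, smul_zero]
      · rw [if_neg hl, if_neg fun h => hl (hu.mp h).2.1, zero_mul, map_zero, smul_zero]
    · rw [if_neg hk, if_neg fun h => hk (hu.mp h).1, zero_mul, map_zero, map_zero, smul_zero]
  | add p q hp hq => simp only [map_add, hp, hq, MvPolynomial.coeff_add]

theorem coeff_logPoly (p : MvPolynomial (Fin 3) ℂ) (k l m : ℕ) :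
    coeff m (coeff l (coeff k (logPoly E p))) = algebraMap ℂ E
      (MvPolynomial.coeff (Finsupp.equivFunOnFinite.symm ![k, l, m]) p) := by
  rw [← coeff_logPolyC]
  rfl

theorem logPoly_central (p : MvPolynomial (Fin 3) ℂ) (r : LogRing E) :
    Commute (logPoly E p) r := by
  refine commute_of_coeff fun _ _ => commute_of_coeff fun _ _ => commute_of_coeff fun _ _ => ?_
  rw [coeff_logPoly]
  exact Algebra.commutes _ _

variable (E) in
/-- The function underlying `embedSer`. -/
noncomputable def embedSerFun (f : Ser) : PowerSeries (PowerSeries (PowerSeries (LogRing E))) :=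
  PowerSeries.mk fun n => PowerSeries.mk fun c => PowerSeries.monomial n
    (logPoly E (MvPowerSeries.coeff (Finsupp.equivFunOnFinite.symm ![n, c]) f))

theorem coeff_embedSerFun (f : Ser) (n c : ℕ) : coeff c (coeff n (embedSerFun E f)) =
    PowerSeries.monomial n
      (logPoly E (MvPowerSeries.coeff (Finsupp.equivFunOnFinite.symm ![n, c]) f)) := by
  rw [embedSerFun, PowerSeries.coeff_mk, PowerSeries.coeff_mk]

variable (E) in
/-- A series in the ratios `w / z` and `t / w` over the polynomials in the logarithms, as a series
in `ζ = 1 / z`, `b = t / w` and `w`. -/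
noncomputable def embedSer : Ser →ₐ[ℂ] PowerSeries (PowerSeries (PowerSeries (LogRing E))) :=
  AlgHom.ofLinearMap
    { toFun := embedSerFun E
      map_add' := fun f g => by
        refine PowerSeries.ext fun n => PowerSeries.ext fun c => ?_
        simp only [map_add, coeff_embedSerFun]
      map_smul' := fun z f => by
        refine PowerSeries.ext fun n => PowerSeries.ext fun c => PowerSeries.ext fun e => ?_
        simp only [coeff_smul_complex, coeff_embedSerFun, PowerSeries.coeff_monomial,
          RingHom.id_apply]
        change (if e = n then logPoly E (z • MvPowerSeries.coeff _ f) else 0) = _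
        rw [map_smul, smul_ite, smul_zero] }
    (by
      classical
      refine PowerSeries.ext fun n => PowerSeries.ext fun c => PowerSeries.ext fun e => ?_
      simp only [LinearMap.coe_mk, AddHom.coe_mk, coeff_embedSerFun, PowerSeries.coeff_monomial,
        MvPowerSeries.coeff_one, PowerSeries.coeff_one]
      have hnc : Finsupp.equivFunOnFinite.symm ![n, c] = (0 : Fin 2 →₀ ℕ) ↔ n = 0 ∧ c = 0 := by
        rw [DFunLike.ext_iff, Fin.forall_fin_two]
        simp
      by_cases hn : n = 0
      · subst hn
        by_cases hc : c = 0
        · subst hc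
          rw [hnc.mpr ⟨rfl, rfl⟩]
          simp [PowerSeries.coeff_one]
        · simp [hc, hnc, PowerSeries.coeff_one]
      · simp [hn, hnc])
    (fun f g => by
      classical
      refine PowerSeries.ext fun n => PowerSeries.ext fun c => ?_
      simp only [LinearMap.coe_mk, AddHom.coe_mk, coeff_embedSerFun, PowerSeries.coeff_mul,
        map_sum, MvPowerSeries.coeff_mul]
      rw [← Finset.sum_product']
      refine Finset.sum_bij' (fun p _ => ((p.1 0, p.2 0), (p.1 1, p.2 1)))
        (fun q _ => (Finsupp.equivFunOnFinite.symm ![q.1.1, q.2.1],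
          Finsupp.equivFunOnFinite.symm ![q.1.2, q.2.2])) ?_ ?_ ?_ ?_ ?_
      · intro p hp
        have h := Finset.HasAntidiagonal.mem_antidiagonal.mp hp
        have h0 := DFunLike.congr_fun h 0
        have h1 := DFunLike.congr_fun h 1
        simp at h0 h1
        simp [h0, h1]
      · intro q hq
        simp at hq
        refine Finset.HasAntidiagonal.mem_antidiagonal.mpr (Finsupp.ext fun i => ?_)
        fin_cases i
        · simp [hq.1]
        · simp [hq.2]
      · intro p hp
        refine Prod.ext (Finsupp.ext fun i => ?_) (Finsupp.ext fun i => ?_) <;> fin_cases i <;> simp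
      · intro q hq
        simp
      · intro p hp
        have h := Finset.HasAntidiagonal.mem_antidiagonal.mp hp
        have h0 := DFunLike.congr_fun h 0
        simp at h0
        have e1 : ∀ u : Fin 2 →₀ ℕ, Finsupp.equivFunOnFinite.symm ![u 0, u 1] = u := fun u =>
          Finsupp.ext fun i => by fin_cases i <;> simp
        rw [e1, e1, map_mul, PowerSeries.monomial_mul_monomial, h0])

theorem coeff_embedSer (f : Ser) (n c e : ℕ) : coeff e (coeff c (coeff n (embedSer E f))) =
    if e = n then logPoly E (MvPowerSeries.coeff (Finsupp.equivFunOnFinite.symm ![n, c]) f)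
    else 0 := by
  rw [← PowerSeries.coeff_monomial, ← coeff_embedSerFun]
  rfl

theorem embedSer_coeffSer (z : ℕ → ℕ → MvPolynomial (Fin 3) ℂ) : embedSer E (coeffSer z) =
    tri fun n c e => if e = n then logPoly E (z n c) else 0 := tri_ext fun n c e => by
  rw [coeff_embedSer, coeff_tri]
  rfl

theorem embedSer_mem [Filt E] (D : ℕ) (f : Ser) (hf : f ∈ (Filt.F D : Submodule ℂ Ser)) :
    embedSer E f ∈ (Filt.F D : Submodule ℂ _) := fun n c e => by
  rw [coeff_embedSer]
  split_ifs with h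
  · by_cases hD : n + c < D
    · rw [hf _ (by rw [Finsupp.degree_eq_sum, Fin.sum_univ_two]; simpa using hD), map_zero]
      exact Submodule.zero_mem _
    · rw [show D - n - c - e = 0 by omega]
      exact Filt.mem_zero _
  · exact Submodule.zero_mem _

end LogRing


/-! ### Moving the zero modes to the left -/

theorem dirDeriv_expState (v : Pt) (w : Fin 3 → ℂ) :
    dirDeriv v (expState w) = (∑ i, w i * ((v.2 i : ℝ) : ℂ)) • expState w :=
  Subtype.ext <| funext fun p => by
    change fderiv ℝ (fun q : Pt => Complex.exp (∑ i, w i * ((q.2 i : ℝ) : ℂ))) p v =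
      (∑ i, w i * ((v.2 i : ℝ) : ℂ)) • Complex.exp (∑ i, w i * ((p.2 i : ℝ) : ℂ))
    have h1 : ∀ i, HasFDerivAt (fun q : Pt => w i * ((q.2 i : ℝ) : ℂ))
        (w i • (Complex.ofRealCLM ∘L ((ContinuousLinearMap.proj i : (Fin 3 → ℝ) →L[ℝ] ℝ) ∘L
          ContinuousLinearMap.snd ℝ (Fin 3 → ℝ) (Fin 3 → ℝ)))) p := fun i =>
      (Complex.ofRealCLM ∘L ((ContinuousLinearMap.proj i : (Fin 3 → ℝ) →L[ℝ] ℝ) ∘L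
          ContinuousLinearMap.snd ℝ (Fin 3 → ℝ) (Fin 3 → ℝ))).hasFDerivAt.const_mul (w i)
    have h2 := (HasFDerivAt.fun_sum (u := Finset.univ) fun i _ => h1 i).cexp
    rw [h2.fderiv]
    simp [mul_comm]

theorem expState_zero : expState 0 = 1 := Subtype.ext <| funext fun p => by
  change Complex.exp (∑ i, 0 * ((p.2 i : ℝ) : ℂ)) = 1
  simp

theorem expState_add (u v : Fin 3 → ℂ) : expState (u + v) = expState u * expState v :=
  Subtype.ext <| funext fun p => by
    change Complex.exp (∑ i, (u i + v i) * ((p.2 i : ℝ) : ℂ)) =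
      Complex.exp (∑ i, u i * ((p.2 i : ℝ) : ℂ)) * Complex.exp (∑ i, v i * ((p.2 i : ℝ) : ℂ))
    rw [← Complex.exp_add, ← Finset.sum_add_distrib]
    simp only [add_mul]

theorem mulG_mul (f g : Ground) : mulG (f * g) = mulG f * mulG g :=
  LinearMap.ext fun h => mul_assoc f g h

theorem expZero_add (u v : Fin 3 → ℂ) : expZero (u + v) = expZero u * expZero v := by
  rw [expZero, expState_add, mulG_mul, expZero, expZero, tm_mul, one_mul]

theorem expZero_zero : expZero 0 = 1 := by
  rw [expZero, expState_zero, show mulG 1 = 1 from LinearMap.ext fun h => one_mul h, tm_one]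

theorem expZero_neg_mul (u : Fin 3 → ℂ) : expZero (-u) * expZero u = 1 := by
  rw [← expZero_add, neg_add_cancel, expZero_zero]

theorem expZero_mul_neg (u : Fin 3 → ℂ) : expZero u * expZero (-u) = 1 := by
  rw [← expZero_add, add_neg_cancel, expZero_zero]

theorem expZero_injective (u : Fin 3 → ℂ) : Function.Injective (expZero u) :=
  Function.LeftInverse.injective (g := expZero (-u)) fun v => by
    rw [← Module.End.mul_apply, expZero_neg_mul, Module.End.one_apply]

theorem fVac_expState (u : Fin 3 → ℂ) : fVac (expState u) = expZero u (fVac 1) := by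
  change (1 : Osc) ⊗ₜ[ℂ] expState u = (1 : Osc) ⊗ₜ[ℂ] (expState u * 1)
  rw [mul_one]

theorem fProj_expZero (u : Fin 3 → ℂ) (v : Fock) : fProj (expZero u v) = expState u * fProj v := by
  induction v using TensorProduct.induction_on with
  | zero => simp
  | tmul a f => simp [fProj, expZero, tm, mulG]
  | add a b ha hb => rw [map_add, map_add, ha, hb, map_add, mul_add]

theorem comm_dXs_expState (i : Fin 3) (κ : Fin 3 → ℂ) :
    comm (dXs i) (mulG (expState κ)) = mulG (expState κ) * (κ i • 1) := by
  rw [dXs, comm_dirDeriv_mulG, dirDeriv_expState]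
  have : ∑ j, κ j * ((((0, Pi.single i 1) : Pt).2 j : ℝ) : ℂ) = κ i := by
    rw [Finset.sum_eq_single i (fun j _ hj => by simp [hj]) (by simp)]
    simp
  rw [this, mul_smul_comm, mul_one]
  exact LinearMap.ext fun g => smul_mul_assoc _ _ _

theorem comm_dX_expState (i : Fin 3) (κ : Fin 3 → ℂ) :
    comm (dX i) (mulG (expState κ)) = 0 := by
  rw [dX, comm_dirDeriv_mulG, dirDeriv_expState]
  have : ∑ j, κ j * ((((Pi.single i 1, 0) : Pt).2 j : ℝ) : ℂ) = 0 := by simp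
  rw [this, zero_smul]
  exact LinearMap.ext fun g => zero_mul _

/-- Conjugation by `expZero κ`. -/
noncomputable def shift (κ : Fin 3 → ℂ) : Module.End ℂ Fock →ₐ[ℂ] Module.End ℂ Fock :=
  AlgHom.ofLinearMap
    (LinearMap.mulLeft ℂ (expZero (-κ)) ∘ₗ LinearMap.mulRight ℂ (expZero κ))
    (by
      change expZero (-κ) * (1 * expZero κ) = 1
      rw [one_mul, expZero_neg_mul])
    (fun S T => by
      change expZero (-κ) * ((S * T) * expZero κ) =
        (expZero (-κ) * (S * expZero κ)) * (expZero (-κ) * (T * expZero κ))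
      simp only [mul_assoc]
      rw [← mul_assoc (expZero κ) (expZero (-κ)), expZero_mul_neg, one_mul])

theorem mul_expZero (κ : Fin 3 → ℂ) (T : Module.End ℂ Fock) :
    T * expZero κ = expZero κ * shift κ T := by
  change _ = expZero κ * (expZero (-κ) * (T * expZero κ))
  rw [← mul_assoc, expZero_mul_neg, one_mul]

theorem shift_eq_of {κ : Fin 3 → ℂ} {T S : Module.End ℂ Fock}
    (h : comm T (expZero κ) = expZero κ * S) : shift κ T = T + S := by
  have h1 : T * expZero κ = expZero κ * (T + S) := by
    rw [mul_add, ← h, comm]; abel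
  change expZero (-κ) * (T * expZero κ) = _
  rw [h1, ← mul_assoc, expZero_neg_mul, one_mul]

theorem shift_fW (κ : Fin 3 → ℂ) (i : Fin 3) : shift κ (fW i) = fW i + algebraMap ℂ _ (κ i) := by
  refine shift_eq_of ?_
  rw [fW, expZero, comm_tm_right _ _ _ _ (comm_one_left _), comm_dXs_expState, one_mul,
    mul_smul_comm, mul_one, tm_smul_right, Algebra.algebraMap_eq_smul_one, mul_smul_comm, mul_one]

theorem shift_fX (κ : Fin 3 → ℂ) (i : Fin 3) (n : ℤ) : shift κ (fX i n) = fX i n := by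
  refine (shift_eq_of (S := 0) ?_).trans (add_zero _)
  rw [mul_zero, fX, expZero]
  split_ifs
  · exact comm_tm_zero _ _ _ _ (comm_one_left _) (comm_mulG_mulG _ _)
  · exact comm_tm_zero _ _ _ _ (comm_one_right _) (comm_one_left _)

theorem fQ_eq (i : Fin 3) : fQ i = tm 1 (dX i) := by
  have h : ∀ j k, fX j 0 * fW k = tm 1 (mulG (coordX j) * dXs k) := fun j k => by
    rw [fX, if_pos rfl, fW, tm_mul, one_mul]
  have h2 : ∀ B B' : Module.End ℂ Ground, tm 1 (B + B') = tm 1 B + tm 1 B' := fun B B' => by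
    rw [tm, tm, tm, TensorProduct.map_add_right]
  rw [fQ, fP, gP, h2]
  simp only [h, tm_sum_right, tm_smul_right]
  exact add_sub_cancel_right (G := Module.End ℂ Fock) _ _

theorem shift_fQ (κ : Fin 3 → ℂ) (i : Fin 3) : shift κ (fQ i) = fQ i := by
  refine (shift_eq_of (S := 0) ?_).trans (add_zero _)
  rw [mul_zero, fQ_eq, expZero]
  exact comm_tm_zero _ _ _ _ (comm_one_left _) (comm_dX_expState _ _)

theorem shift_fXs (κ : Fin 3 → ℂ) (i : Fin 3) {n : ℤ} (hn : n ≠ 0) : shift κ (fXs i n) =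
    fXs i n + ∑ k, (1 / (2 * (n : ℂ)) * ∑ j, eps i j k * κ j) • fX k n := by
  refine shift_eq_of ?_
  have hg : ∀ j, comm (gZ j n) (mulG (expState κ)) =
      (1 / (2 * (n : ℂ)) * κ j) • mulG (expState κ) := fun j => by
    rw [gZ, comm_add_left, comm_smul_left, comm_smul_left, comm_mulG_mulG, comm_dXs_expState,
      smul_zero, zero_add, mul_smul_comm, mul_one, smul_smul]
  rw [fXs, if_neg hn, expZero, comm_add_left,
    comm_tm_zero _ _ _ _ (comm_one_right _) (comm_one_left _), zero_add]
  simp only [comm_sum_left, comm_smul_left, comm_tm_right _ _ _ _ (comm_one_right _), hg, mul_one,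
    tm_smul_right, smul_smul, fX, if_neg hn, Finset.mul_sum, mul_smul_comm, tm_mul, one_mul,
    Finset.sum_smul]
  rw [Finset.sum_comm]
  refine Finset.sum_congr rfl fun k _ => Finset.sum_congr rfl fun j _ => ?_
  congr 1
  ring

theorem comm_fQ_fW (i j : Fin 3) : comm (fQ i) (fW j) = 0 := by
  rw [fQ_eq, fW]
  exact comm_tm_zero _ _ _ _ (comm_one_left _) (comm_dirDeriv_dirDeriv _ _)

theorem comm_fQ_fX (i j : Fin 3) {n : ℤ} (hn : n ≠ 0) : comm (fQ i) (fX j n) = 0 := by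
  rw [fQ_eq, fX, if_neg hn]
  exact comm_tm_zero _ _ _ _ (comm_one_left _) (comm_one_right _)

theorem comm_fXs_fQ (i j : Fin 3) {n : ℤ} (hn : n ≠ 0) :
    comm (fXs j n) (fQ i) = ∑ k, (-(eps j i k) / 2) • fX k n := by
  have hg : ∀ l, comm (gZ l n) (dX i) = if i = l then (-(1 : ℂ) / 2) • 1 else 0 := fun l => by
    rw [comm_swap (dX i), gZ, comm_add, comm_smul, comm_smul, comm_dX_coordX,
      show comm (dX i) (dXs l) = 0 from comm_dirDeriv_dirDeriv _ _, smul_zero, add_zero]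
    split_ifs
    · rw [smul_smul]; congr 1; ring
    · rw [smul_zero, smul_zero]
  rw [fQ_eq, fXs, if_neg hn, comm_add_left,
    comm_tm_zero _ _ _ _ (comm_one_right _) (comm_one_left _), zero_add]
  simp only [comm_sum_left, comm_smul_left, comm_tm_right _ _ _ _ (comm_one_right _), hg, mul_one,
    fX, if_neg hn]
  rw [Finset.sum_comm]
  refine Finset.sum_congr rfl fun k _ => ?_
  rw [Finset.sum_eq_single i (fun l _ hl => by
    rw [if_neg (Ne.symm hl), tm_zero_right, smul_zero]) (by simp), if_pos rfl, tm_smul_right,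
    smul_smul]
  congr 1
  ring

/-! ### The operators that commute with the winding operators -/

/-- The subalgebra of operators that commute with the winding operators. -/
noncomputable def windSubalgebra : Subalgebra ℂ (Module.End ℂ Fock) :=
  Subalgebra.centralizer ℂ (Set.range fW)

/-- The algebra of operators on the Fock space that commute with the winding operators. -/
def WindOp : Type := windSubalgebra

noncomputable instance : Ring WindOp := by
  delta WindOp
  exact @Subalgebra.toRing ℂ (Module.End ℂ Fock) _ _ _ windSubalgebra

noncomputable instance : Algebra ℂ WindOp := by
  delta WindOp
  exact windSubalgebra.algebra

noncomputable instance : Filt WindOp := Filt.discrete WindOp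

/-- The inclusion of `WindOp` in the algebra of all operators. -/
noncomputable def toEnd : WindOp →ₐ[ℂ] Module.End ℂ Fock := by
  delta WindOp
  exact windSubalgebra.val

theorem toEnd_injective : Function.Injective toEnd := Subtype.coe_injective

theorem mem_windSubalgebra {T : Module.End ℂ Fock} (h : ∀ i, comm (fW i) T = 0) :
    T ∈ windSubalgebra := by
  rw [windSubalgebra, Subalgebra.mem_centralizer_iff]
  rintro _ ⟨i, rfl⟩
  exact sub_eq_zero.mp (h i)

/-- An operator that commutes with the winding operators, as an element of `WindOp`. -/
noncomputable def WindOp.ofEnd (T : Module.End ℂ Fock) (h : ∀ i, comm (fW i) T = 0) : WindOp := by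
  delta WindOp
  exact ⟨T, mem_windSubalgebra h⟩

theorem toEnd_ofEnd (T : Module.End ℂ Fock) (h : ∀ i, comm (fW i) T = 0) :
    toEnd (WindOp.ofEnd T h) = T := rfl

/-- The winding operators in `WindOp`. -/
noncomputable def opW (i : Fin 3) : WindOp := WindOp.ofEnd (fW i) fun j => fockModule.W_W j i

/-- The modes of `x^i` in `WindOp`. -/
noncomputable def opX (i : Fin 3) (n : ℤ) : WindOp :=
  WindOp.ofEnd (fX i n) fun j => fockModule.W_x j i n

/-- The nonzero modes of `x^*_i`; the mode zero, which does not commute with `W_i`, is replaced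
by zero. -/
noncomputable def opXs (i : Fin 3) (n : ℤ) : WindOp :=
  if h : n = 0 then 0 else WindOp.ofEnd (fXs i n) fun j => by
    rw [fW_fXs, if_neg fun h' => h h'.2]

/-- The operators `Q_i` in `WindOp`. -/
noncomputable def opQ (i : Fin 3) : WindOp :=
  WindOp.ofEnd (fQ i) fun j => comm_swap_zero (comm_fQ_fW i j)

theorem toEnd_opW (i : Fin 3) : toEnd (opW i) = fW i := rfl

theorem toEnd_opX (i : Fin 3) (n : ℤ) : toEnd (opX i n) = fX i n := rfl

theorem toEnd_opQ (i : Fin 3) : toEnd (opQ i) = fQ i := rfl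

theorem toEnd_opXs (i : Fin 3) {n : ℤ} (hn : n ≠ 0) : toEnd (opXs i n) = fXs i n := by
  rw [opXs, dif_neg hn, toEnd_ofEnd]

theorem toEnd_comm (S T : WindOp) : toEnd (comm S T) = comm (toEnd S) (toEnd T) := by
  rw [comm, comm, map_sub, map_mul, map_mul]

/-- The modes as operators that commute with the winding operators. -/
noncomputable def windModes : ModeRel WindOp where
  W := opW
  x := opX
  xs := opXs
  W_central i r := Subtype.ext ((Subalgebra.mem_centralizer_iff ℂ).mp r.2 _ ⟨i, rfl⟩)
  x_x i j m n _ _ := toEnd_injective (by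
    rw [toEnd_comm, map_zero]
    exact fX_fX i j m n)
  xs_x i j n m hn hm := toEnd_injective (by
    rw [toEnd_comm, toEnd_opXs i hn, toEnd_opX, fXs_fX i j n m]
    by_cases h : i = j ∧ m = -n
    · rw [if_pos h, if_pos ⟨h.1, h.2, hm⟩, map_smul, map_one]
    · rw [if_neg h, if_neg fun h' => h ⟨h'.1, h'.2.1⟩, map_zero])
  xs_xs i j m n hm hn := toEnd_injective (by
    rw [toEnd_comm, toEnd_opXs i hm, toEnd_opXs j hn, fXs_fXs i j m n hm hn]
    by_cases h : m = -n
    · have h0 : (m : ℂ) + n = 0 := by rw [h]; push_cast; ring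
      rw [if_pos h, if_pos h]
      simp only [h0, zero_div, zero_mul, zero_smul, Finset.sum_const_zero, zero_add, map_sum,
        map_smul, toEnd_opW]
    · rw [if_neg h, if_neg h, add_zero]
      simp only [map_sum, map_smul, toEnd_opX])


/-! ### Modes over the series in the logarithms -/

section LogModes

variable {E : Type*} [Ring E] [Algebra ℂ E]

theorem mapAlgHom_X {S : Type*} [Ring S] [Algebra ℂ S] (φ : E →ₐ[ℂ] S) :
    PowerSeries.mapAlgHom φ PowerSeries.X = PowerSeries.X := by
  rw [PowerSeries.mapAlgHom_apply, PowerSeries.map_X]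

theorem mapAlgHom_C {S : Type*} [Ring S] [Algebra ℂ S] (φ : E →ₐ[ℂ] S) (a : E) :
    PowerSeries.mapAlgHom φ (PowerSeries.C a) = PowerSeries.C (φ a) := by
  rw [PowerSeries.mapAlgHom_apply, PowerSeries.map_C]
  rfl

theorem logConst_comm (a b : E) : logConst E (comm a b) = comm (logConst E a) (logConst E b) := by
  rw [comm, comm, map_sub, map_mul, map_mul]

theorem coeff_logConst (a : E) (k l m : ℕ) : coeff m (coeff l (coeff k (logConst E a))) =
    if k = 0 ∧ l = 0 ∧ m = 0 then a else 0 := by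
  change coeff m (coeff l (coeff k (PowerSeries.C (PowerSeries.C (PowerSeries.C a))))) = _
  rw [PowerSeries.coeff_C]
  by_cases hk : k = 0
  · rw [if_pos hk, PowerSeries.coeff_C]
    by_cases hl : l = 0
    · rw [if_pos hl, PowerSeries.coeff_C]
      simp [hk, hl]
    · rw [if_neg hl, map_zero, if_neg fun h => hl h.2.1]
  · rw [if_neg hk, map_zero, map_zero, if_neg fun h => hk h.1]

theorem logConst_central {a : E} (ha : ∀ b, Commute a b) (r : LogRing E) :
    Commute (logConst E a) r := by
  refine commute_of_coeff fun _ _ => commute_of_coeff fun _ _ => commute_of_coeff fun _ _ => ?_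
  rw [coeff_logConst]
  split_ifs
  exacts [ha _, Commute.zero_left _]

/-- The modes as constant series in the logarithms. -/
noncomputable def ModeRel.toLog (M : ModeRel E) : ModeRel (LogRing E) where
  W i := logConst E (M.W i)
  x i n := logConst E (M.x i n)
  xs i n := logConst E (M.xs i n)
  W_central i := logConst_central (M.W_central i)
  x_x i j m n hm hn := by rw [← logConst_comm, M.x_x i j m n hm hn, map_zero]
  xs_x i j n m hn hm := by
    rw [← logConst_comm, M.xs_x i j n m hn hm]
    split_ifs
    · rw [map_smul, map_one]
    · rw [map_zero]
  xs_xs i j m n hm hn := by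
    rw [← logConst_comm, M.xs_xs i j m n hm hn]
    split_ifs
    · simp only [map_sum, map_smul]
    · simp only [map_sum, map_smul]

variable (E) in
/-- The inclusion of the series in the logarithm with index `A`. -/
noncomputable def inLog : Fin 3 → PowerSeries E →ₐ[ℂ] LogRing E := ![inLogz E, inLogw E, inLogt E]

theorem logPoly_X (A : Fin 3) : logPoly E (MvPolynomial.X A) = inLog E A PowerSeries.X := by
  rw [logPoly, AlgHom.comp_apply, logPolyC, MvPolynomial.aeval_X]
  match A with
  | 0 =>
    change PowerSeries.mapAlgHom _ PowerSeries.X = inLogz E PowerSeries.X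
    rw [mapAlgHom_X, inLogz, mapAlgHom_X]
  | 1 =>
    change PowerSeries.mapAlgHom _ (PowerSeries.C PowerSeries.X) = inLogw E PowerSeries.X
    rw [mapAlgHom_C, mapAlgHom_X, inLogw, AlgHom.comp_apply, mapAlgHom_X]
    rfl
  | 2 =>
    change PowerSeries.mapAlgHom _ (PowerSeries.C (PowerSeries.C PowerSeries.X)) =
      inLogt E PowerSeries.X
    rw [mapAlgHom_C, mapAlgHom_C, mapAlgHom_X]
    rfl

theorem inLog_C (A : Fin 3) (a : E) : inLog E A (PowerSeries.C a) = logConst E a := by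
  match A with
  | 0 =>
    change inLogz E (PowerSeries.C a) = _
    rw [inLogz, mapAlgHom_C]
    rfl
  | 1 =>
    change inLogw E (PowerSeries.C a) = _
    rw [inLogw, AlgHom.comp_apply, mapAlgHom_C]
    rfl
  | 2 => rfl

variable [Filt E]

theorem logPoly_X_mem (A : Fin 3) :
    logPoly E (MvPolynomial.X A) ∈ (Filt.F 1 : Submodule ℂ (LogRing E)) := by
  refine mem_F_one (mem_F_one (mem_F_one ?_))
  rw [coeff_logPoly, MvPolynomial.coeff_X, if_neg, map_zero]
  · exact Submodule.zero_mem _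
  · intro h
    have := DFunLike.congr_fun h A
    fin_cases A <;> simp at this

theorem inLog_mem (A : Fin 3) (n : ℕ) (f : PowerSeries E)
    (hf : f ∈ (Filt.F n : Submodule ℂ (PowerSeries E))) :
    inLog E A f ∈ (Filt.F n : Submodule ℂ (LogRing E)) := by
  match A with
  | 0 =>
    exact mapAlgHom_mem ((cHom (PowerSeries E)).comp (cHom E))
      (fun n x hx => cHom_mem n (cHom E x) (cHom_mem n x hx)) n f hf
  | 1 => exact cHom_mem n _ (mapAlgHom_mem _ cHom_mem n f hf)
  | 2 => exact cHom_mem n _ (cHom_mem n f hf)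

/-- The exponential `exp (ℓ q)`, where `ℓ` is the logarithm with index `A`. -/
noncomputable def expLog (A : Fin 3) (q : E) : LogRing E :=
  fexp (logPoly E (MvPolynomial.X A) * logConst E q)

theorem logMul_mem (A : Fin 3) (q : E) : logPoly E (MvPolynomial.X A) * logConst E q ∈
    (Filt.F 1 : Submodule ℂ (LogRing E)) := Filt.mul_right (logPoly_X_mem A) _

theorem inLog_expSeries (A : Fin 3) (q : E) :
    inLog E A (PowerSeries.mk fun k => (1 / (k.factorial : ℂ)) • q ^ k) = expLog A q := by
  have h0 : coeff 0 (PowerSeries.X * PowerSeries.C q) = 0 := by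
    rw [PowerSeries.coeff_zero_X_mul]
  have h1 : PowerSeries.mk (fun k => (1 / (k.factorial : ℂ)) • q ^ k) =
      fexp (PowerSeries.X * PowerSeries.C q) := by
    rw [← serExp_eq_fexp h0]
    refine PowerSeries.ext fun n => ?_
    rw [serExp, PowerSeries.coeff_mk, PowerSeries.coeff_mk, map_sum, Finset.sum_eq_single n]
    · rw [coeff_smul_complex, (PowerSeries.commute_X _).symm.mul_pow, ← map_pow,
        PowerSeries.coeff_mul_C, PowerSeries.coeff_X_pow, if_pos rfl, one_mul]
    · intro m _ hm
      rw [coeff_smul_complex, (PowerSeries.commute_X _).symm.mul_pow, ← map_pow,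
        PowerSeries.coeff_mul_C, PowerSeries.coeff_X_pow, if_neg (Ne.symm hm), zero_mul, smul_zero]
    · intro h
      simp at h
  rw [h1, fexp_hom _ (inLog_mem A), map_mul, inLog_C, ← logPoly_X, expLog]
  exact mem_F_one (by rw [h0]; exact Submodule.zero_mem _)

/-- Moving `exp (log ⬝ q)` to the left of a mode of an exponent, for an element `q` whose commutator
with that mode is a combination of the modes `x_n`: their coefficients are shifted. -/
theorem ModeRel.fld_mul_expLog (M : ModeRel E) (B : Fin 3) {u d : Fin 3 → ℂ} {q : E} {n : ℤ}
    (hxs : comm (∑ i, u i • M.xs i n) q = ∑ k, (-(d k / 2)) • M.x k n)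
    (hx : ∀ k, comm (M.x k n) q = 0) {V : Fin 3 → LogRing E} (hV : ∀ i r, Commute (V i) r) :
    M.toLog.fld u V n * expLog B q = expLog B q * M.toLog.fld u (fun i => V i - logPoly E
      (MvPolynomial.C (d i / 2) * MvPolynomial.X B)) n := by
  have hx' : ∀ i, M.toLog.x i n = logConst E (M.x i n) := fun _ => rfl
  have hxs' : ∑ i, u i • M.toLog.xs i n = logConst E (∑ i, u i • M.xs i n) := by
    simp only [map_sum, map_smul]; rfl
  have c1 : comm (∑ i, V i * M.toLog.x i n)
      (logPoly E (MvPolynomial.X B) * logConst E q) = 0 := by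
    rw [comm_sum_left]
    refine Finset.sum_eq_zero fun i _ => ?_
    rw [comm_central_mul_left _ _ _ (hV i), comm_central_mul _ _ _ (logPoly_central _), hx',
      ← logConst_comm, hx, map_zero, mul_zero, mul_zero]
  have c2 : comm (M.toLog.fld u V n) (logPoly E (MvPolynomial.X B) * logConst E q) =
      logPoly E (MvPolynomial.X B) * logConst E (∑ k, (-(d k / 2)) • M.x k n) := by
    rw [ModeRel.fld, comm_add_left, c1, add_zero, hxs', comm_central_mul _ _ _ (logPoly_central _),
      ← logConst_comm, hxs]
  have c3 : Commute (logPoly E (MvPolynomial.X B) * logConst E (∑ k, (-(d k / 2)) • M.x k n))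
      (logPoly E (MvPolynomial.X B) * logConst E q) := by
    refine commute_of_comm_eq_zero ?_
    rw [comm_central_mul _ _ _ (logPoly_central _), comm_central_mul_left _ _ _ (logPoly_central _),
      ← logConst_comm, comm_sum_left]
    simp only [comm_smul_left, hx, smul_zero, Finset.sum_const_zero, map_zero, mul_zero]
  rw [expLog, mul_fexp (logMul_mem B _) c2 c3]
  congr 1
  rw [ModeRel.fld, ModeRel.fld, add_assoc]
  congr 1
  simp only [sub_mul, Finset.sum_sub_distrib]
  rw [sub_eq_add_neg]
  congr 1
  rw [map_sum, Finset.mul_sum, ← Finset.sum_neg_distrib]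
  refine Finset.sum_congr rfl fun k _ => ?_
  rw [map_mul, show logPoly E (MvPolynomial.C (d k / 2)) = algebraMap ℂ _ (d k / 2) from
    (logPoly E).commutes _, mul_assoc, ← Algebra.smul_def, map_smul, neg_smul, mul_neg,
    mul_smul_comm, hx']

end LogModes

/-! ### The exponents of the vertex operators -/

/-- The operator `∑ i, u_i Q_i`. -/
noncomputable def qSum (u : Fin 3 → ℂ) : WindOp := ∑ i, u i • opQ i

/-- The coefficient of `z^{-n}` in `u^i x^*_i(z)`, conjugated by the zero mode with winding `κ`. -/
noncomputable def fieldSer (u κ : Fin 3 → ℂ) (n : ℤ) : PowerSeries WindOp :=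
  PowerSeries.C (∑ i, u i • opXs i n + ∑ k, (cross u κ k / (2 * (n : ℂ))) • opX k n) +
    PowerSeries.X * PowerSeries.C (∑ k, (cross u κ k / 2) • opX k n +
      ∑ i, ∑ j, ∑ k, (eps i j k * u i / 2) • (opW j * opX k n))

theorem shift_fieldCoeff (u κ : Fin 3 → ℂ) {n : ℤ} (hn : n ≠ 0) :
    PowerSeries.mapAlgHom (shift κ) (fieldCoeff u n) =
      PowerSeries.mapAlgHom toEnd (fieldSer u κ n) := by
  refine PowerSeries.ext fun k => ?_
  rw [PowerSeries.mapAlgHom_apply, PowerSeries.coeff_map, PowerSeries.mapAlgHom_apply,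
    PowerSeries.coeff_map, fieldCoeff, PowerSeries.coeff_mk, fieldSer, map_add, RingHom.coe_coe,
    RingHom.coe_coe]
  rcases k with _ | _ | k
  · rw [if_pos rfl, PowerSeries.coeff_zero_X_mul, add_zero, PowerSeries.coeff_zero_C]
    simp only [map_sum, map_smul, map_add, toEnd_opXs _ hn, toEnd_opX, shift_fXs κ _ hn, smul_add,
      Finset.sum_add_distrib, cross, Finset.smul_sum, smul_smul]
    congr 1
    rw [Finset.sum_comm]
    refine Finset.sum_congr rfl fun k _ => ?_
    rw [← Finset.sum_smul]
    congr 1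
    rw [Finset.sum_div]
    refine Finset.sum_congr rfl fun i _ => ?_
    rw [Finset.mul_sum, Finset.mul_sum, Finset.sum_div]
    refine Finset.sum_congr rfl fun j _ => ?_
    ring
  · rw [if_neg (by omega), if_pos rfl, zero_add, PowerSeries.coeff_succ_X_mul,
      PowerSeries.coeff_zero_C, PowerSeries.coeff_C, if_neg (by omega), zero_add]
    simp only [map_sum, map_smul, map_add, map_mul, toEnd_opX, toEnd_opW, shift_fW, shift_fX,
      add_mul, smul_add, Finset.sum_add_distrib]
    rw [add_comm]
    congr 1
    simp only [cross, Finset.sum_div, Finset.sum_smul, ← Algebra.smul_def, smul_smul]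
    rw [Finset.sum_comm_cycle]
    refine Finset.sum_congr rfl fun k _ => Finset.sum_congr rfl fun i _ =>
      Finset.sum_congr rfl fun j _ => ?_
    congr 1
    ring
  · rw [if_neg (by omega), if_neg (by omega), PowerSeries.coeff_succ_X_mul, PowerSeries.coeff_C,
      PowerSeries.coeff_C, if_neg (by omega), if_neg (by omega)]
    simp

/-- The modes as operators in series in the logarithms. -/
noncomputable def logModes : ModeRel (LogRing WindOp) := windModes.toLog

/-- The scalar part of the coefficients of the modes `x_n`; `A` is the index of the logarithm of
the insertion point. -/
noncomputable def scalarPart (A : Fin 3) (u κ : Fin 3 → ℂ) (n : ℤ) (i : Fin 3) :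
    MvPolynomial (Fin 3) ℂ :=
  MvPolynomial.C (cross u κ i / (2 * (n : ℂ))) + MvPolynomial.C (cross u κ i / 2) * MvPolynomial.X A

/-- The part of the coefficients of the modes `x_n` that involves the winding operators. -/
noncomputable def windPart (A : Fin 3) (u : Fin 3 → ℂ) (k : Fin 3) : LogRing WindOp :=
  logPoly WindOp (MvPolynomial.X A) *
    logConst WindOp (∑ i, ∑ j, (eps i j k * u i / 2) • opW j)

theorem windPart_central (A : Fin 3) (u : Fin 3 → ℂ) (k : Fin 3) (r : LogRing WindOp) :
    Commute (windPart A u k) r := by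
  refine (logPoly_central _ r).mul_left (logConst_central (fun b => ?_) r)
  exact Commute.sum_left _ _ _ fun i _ => Commute.sum_left _ _ _ fun j _ =>
    (windModes.W_central j b).smul_left _

theorem inLog_fieldSer (A : Fin 3) (u κ : Fin 3 → ℂ) (n : ℤ) : inLog WindOp A (fieldSer u κ n) =
    logModes.fld u (fun i => logPoly WindOp (scalarPart A u κ n i) + windPart A u i) n := by
  have hx : ∀ i n, logModes.x i n = logConst WindOp (opX i n) := fun _ _ => rfl
  have hxs : ∀ i n, logModes.xs i n = logConst WindOp (opXs i n) := fun _ _ => rfl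
  have hC : ∀ c : ℂ, logPoly WindOp (MvPolynomial.C c) = algebraMap ℂ _ c := fun c =>
    (logPoly WindOp).commutes c
  rw [fieldSer, map_add, map_mul, inLog_C, inLog_C, ← logPoly_X, ModeRel.fld]
  simp only [hx, hxs, scalarPart, windPart, map_add, map_mul, hC, add_mul, Finset.sum_add_distrib,
    map_sum, map_smul, mul_add, add_assoc]
  congr 1
  congr 1
  · exact Finset.sum_congr rfl fun k _ => Algebra.smul_def _ _
  congr 1
  · rw [Finset.mul_sum]
    refine Finset.sum_congr rfl fun k _ => ?_
    rw [Algebra.smul_def, ← mul_assoc, (Algebra.commutes _ _).symm, mul_assoc]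
  · rw [Finset.sum_comm_cycle, Finset.mul_sum]
    refine Finset.sum_congr rfl fun k _ => ?_
    rw [mul_assoc, Finset.sum_mul]
    congr 1
    refine Finset.sum_congr rfl fun i _ => ?_
    rw [Finset.sum_mul]
    refine Finset.sum_congr rfl fun j _ => ?_
    rw [smul_mul_assoc]

theorem comm_fld_qSum (u β : Fin 3 → ℂ) {n : ℤ} (hn : n ≠ 0) :
    comm (∑ i, u i • opXs i n) (qSum β) = ∑ k, (-(cross u β k / 2)) • opX k n := by
  refine toEnd_injective ?_
  rw [toEnd_comm, qSum]
  simp only [map_sum, map_smul, toEnd_opXs _ hn, toEnd_opX, toEnd_opQ, comm_sum, comm_sum_left,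
    comm_smul, comm_smul_left, comm_fXs_fQ _ _ hn, cross, Finset.smul_sum, smul_smul,
    Finset.sum_div, ← Finset.sum_neg_distrib, Finset.sum_smul]
  rw [Finset.sum_comm_cycle]
  refine Finset.sum_congr rfl fun k _ => ?_
  rw [Finset.sum_comm]
  refine Finset.sum_congr rfl fun i _ => Finset.sum_congr rfl fun j _ => ?_
  congr 1
  ring

theorem comm_opX_qSum (β : Fin 3 → ℂ) (k : Fin 3) {n : ℤ} (hn : n ≠ 0) :
    comm (opX k n) (qSum β) = 0 := by
  refine toEnd_injective ?_
  rw [toEnd_comm, qSum, map_zero]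
  simp only [map_sum, map_smul, toEnd_opX, toEnd_opQ, comm_sum, comm_smul,
    comm_swap_zero (comm_fQ_fX _ _ hn), smul_zero, Finset.sum_const_zero]

/-- Moving a power of an insertion point through a mode of an exponent. -/
theorem fld_mul_expLog (B : Fin 3) (u β : Fin 3 → ℂ) {V : Fin 3 → LogRing WindOp}
    (hV : ∀ i r, Commute (V i) r) {n : ℤ} (hn : n ≠ 0) :
    logModes.fld u V n * expLog B (qSum β) = expLog B (qSum β) *
      logModes.fld u (fun i => V i - logPoly WindOp
        (MvPolynomial.C (cross u β i / 2) * MvPolynomial.X B)) n :=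
  windModes.fld_mul_expLog B (comm_fld_qSum u β hn) (fun k => comm_opX_qSum β k hn) hV


/-! ### The five-point function as a vacuum matrix element -/

/-- The operators that annihilate the vacuum. -/
noncomputable def vacuumRight : Submodule ℂ WindOp :=
  LinearMap.ker ((LinearMap.applyₗ (fVac 1) : Module.End ℂ Fock →ₗ[ℂ] Fock) ∘ₗ toEnd.toLinearMap)

theorem mem_vacuumRight {T : WindOp} : T ∈ vacuumRight ↔ toEnd T (fVac 1) = 0 := Iff.rfl

/-- The operators whose image is annihilated by the projection to the ground states. -/
noncomputable def vacuumLeft : Submodule ℂ WindOp where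
  carrier := {T | ∀ v, fProj (toEnd T v) = 0}
  add_mem' hS hT v := by rw [map_add, LinearMap.add_apply, map_add, hS v, hT v, add_zero]
  zero_mem' v := by rw [map_zero, LinearMap.zero_apply, map_zero]
  smul_mem' c T hT v := by rw [map_smul, LinearMap.smul_apply, map_smul, hT v, smul_zero]

theorem logConst_mem_coeffwise {E : Type*} [Ring E] [Algebra ℂ E] {J : Submodule ℂ E} {T : E}
    (h : T ∈ J) : logConst E T ∈ coeffwise (coeffwise (coeffwise J)) := fun k l m => by
  rw [coeff_logConst]
  split_ifs
  exacts [h, Submodule.zero_mem _]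

theorem opX_mem_right (i : Fin 3) {n : ℤ} (hn : 0 < n) : opX i n ∈ vacuumRight := by
  rw [mem_vacuumRight, toEnd_opX]
  exact fockModule.x_pos_vac i n 1 hn

theorem opXs_mem_right (i : Fin 3) {n : ℤ} (hn : 0 < n) : opXs i n ∈ vacuumRight := by
  rw [mem_vacuumRight, toEnd_opXs _ hn.ne']
  exact fockModule.xs_pos_vac i n 1 hn

theorem opX_mem_left (i : Fin 3) {n : ℤ} (hn : n < 0) : opX i n ∈ vacuumLeft := fun v => by
  rw [toEnd_opX]
  exact fockModule.proj_x_neg i n v hn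

theorem opXs_mem_left (i : Fin 3) {n : ℤ} (hn : n < 0) : opXs i n ∈ vacuumLeft := fun v => by
  rw [toEnd_opXs _ hn.ne]
  exact fockModule.proj_xs_neg i n v hn

theorem dirDeriv_one (v : Pt) : dirDeriv v 1 = 0 := by
  rw [← expState_zero, dirDeriv_expState]
  simp

theorem opW_mem_right (i : Fin 3) : opW i ∈ vacuumRight := by
  rw [mem_vacuumRight, toEnd_opW]
  exact (fockModule.W_vac i 1).trans (by rw [dXs, dirDeriv_one, map_zero])

/-- The data of the three vertex operators of the five-point function, after all zero modes and
powers of insertion points have been moved to the left. -/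
noncomputable def vertexData (w : Fin 4 → Fin 3 → ℂ) : VertexData (LogRing WindOp) where
  toModeRel := logModes
  α := w 0
  β := w 1
  γ := w 2
  Va n i := logPoly WindOp (scalarPart 0 (w 0) (w 1 + (w 2 + w 3)) n i) + windPart 0 (w 0) i -
    logPoly WindOp (MvPolynomial.C (cross (w 0) (w 1) i / 2) * MvPolynomial.X 1) -
    logPoly WindOp (MvPolynomial.C (cross (w 0) (w 2) i / 2) * MvPolynomial.X 2)
  Vb n i := logPoly WindOp (scalarPart 1 (w 1) (w 2 + w 3) n i) + windPart 1 (w 1) i -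
    logPoly WindOp (MvPolynomial.C (cross (w 1) (w 2) i / 2) * MvPolynomial.X 2)
  Vc n i := logPoly WindOp (scalarPart 2 (w 2) (w 3) n i) + windPart 2 (w 2) i
  Va_central n i r := (((logPoly_central _ r).add_left (windPart_central _ _ _ r)).sub_left
    (logPoly_central _ r)).sub_left (logPoly_central _ r)
  Vb_central n i r := ((logPoly_central _ r).add_left (windPart_central _ _ _ r)).sub_left
    (logPoly_central _ r)
  Vc_central n i r := (logPoly_central _ r).add_left (windPart_central _ _ _ r)
  Jl := coeffwise (coeffwise (coeffwise vacuumLeft))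
  Jr := coeffwise (coeffwise (coeffwise vacuumRight))
  Jl_closed := coeffwise_closed (coeffwise_closed (coeffwise_closed (discrete_closed _)))
  Jr_closed := coeffwise_closed (coeffwise_closed (coeffwise_closed (discrete_closed _)))
  Jl_mul := by
    have h : ∀ r, ∀ j ∈ vacuumLeft, j * r ∈ vacuumLeft := fun r j hj v => by
      rw [map_mul]
      exact hj _
    exact coeffwise_mul_right (coeffwise_mul_right (coeffwise_mul_right h))
  mul_Jr := by
    have h : ∀ r, ∀ j ∈ vacuumRight, r * j ∈ vacuumRight := fun r j hj => by
      rw [mem_vacuumRight] at hj ⊢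
      rw [map_mul, Module.End.mul_apply, hj, map_zero]
    exact coeffwise_mul_left (coeffwise_mul_left (coeffwise_mul_left h))
  x_Jr i n hn := logConst_mem_coeffwise (opX_mem_right i hn)
  xs_Jr i n hn := logConst_mem_coeffwise (opXs_mem_right i hn)
  x_Jl i n hn := logConst_mem_coeffwise (opX_mem_left i hn)
  xs_Jl i n hn := logConst_mem_coeffwise (opXs_mem_left i hn)

section Exponent

variable (w : Fin 4 → Fin 3 → ℂ)

theorem W_mem_Jr (i : Fin 3) : (vertexData w).W i ∈ (vertexData w).Jr :=
  logConst_mem_coeffwise (opW_mem_right i)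

theorem windPart_mem_Jr (A : Fin 3) (u : Fin 3 → ℂ) (k : Fin 3) :
    windPart A u k ∈ (vertexData w).Jr :=
  (vertexData w).mul_Jr _ _ (logConst_mem_coeffwise (Submodule.sum_mem _ fun _ _ =>
    Submodule.sum_mem _ fun j _ => Submodule.smul_mem _ _ (opW_mem_right j)))

/-- Congruence modulo the operators that annihilate the vacuum. -/
def ScalarOn (r : LogRing WindOp) (p : MvPolynomial (Fin 3) ℂ) : Prop :=
  r - logPoly WindOp p ∈ (vertexData w).Jr

variable {w}

theorem scalarOn_logPoly (p : MvPolynomial (Fin 3) ℂ) : ScalarOn w (logPoly WindOp p) p := by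
  rw [ScalarOn, sub_self]
  exact Submodule.zero_mem _

theorem scalarOn_of_mem {r : LogRing WindOp} (h : r ∈ (vertexData w).Jr) : ScalarOn w r 0 := by
  rwa [ScalarOn, map_zero, sub_zero]

theorem ScalarOn.add {r s : LogRing WindOp} {p q : MvPolynomial (Fin 3) ℂ} (h : ScalarOn w r p)
    (h' : ScalarOn w s q) : ScalarOn w (r + s) (p + q) := by
  rw [ScalarOn, map_add, add_sub_add_comm]
  exact Submodule.add_mem _ h h'

theorem ScalarOn.sub {r s : LogRing WindOp} {p q : MvPolynomial (Fin 3) ℂ} (h : ScalarOn w r p)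
    (h' : ScalarOn w s q) : ScalarOn w (r - s) (p - q) := by
  rw [ScalarOn, map_sub, sub_sub_sub_comm]
  exact Submodule.sub_mem _ h h'

theorem ScalarOn.smul {r : LogRing WindOp} {p : MvPolynomial (Fin 3) ℂ} (h : ScalarOn w r p)
    (c : ℂ) : ScalarOn w (c • r) (c • p) := by
  rw [ScalarOn, map_smul, ← smul_sub]
  exact Submodule.smul_mem _ c h

theorem ScalarOn.sum {r : Fin 3 → LogRing WindOp} {p : Fin 3 → MvPolynomial (Fin 3) ℂ}
    (h : ∀ i, ScalarOn w (r i) (p i)) : ScalarOn w (∑ i, r i) (∑ i, p i) := by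
  rw [ScalarOn, map_sum, ← Finset.sum_sub_distrib]
  exact Submodule.sum_mem _ fun i _ => h i

variable (w)

theorem scalarOn_Vc (n : ℤ) (i : Fin 3) :
    ScalarOn w ((vertexData w).Vc n i) (scalarPart 2 (w 2) (w 3) n i) := by
  have := (scalarOn_logPoly (w := w) (scalarPart 2 (w 2) (w 3) n i)).add
    (scalarOn_of_mem (windPart_mem_Jr w 2 (w 2) i))
  rwa [add_zero] at this

theorem scalarOn_Vb (n : ℤ) (i : Fin 3) :
    ScalarOn w ((vertexData w).Vb n i) (scalarPart 1 (w 1) (w 2 + w 3) n i -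
      MvPolynomial.C (cross (w 1) (w 2) i / 2) * MvPolynomial.X 2) := by
  have := ((scalarOn_logPoly (w := w) (scalarPart 1 (w 1) (w 2 + w 3) n i)).add
    (scalarOn_of_mem (windPart_mem_Jr w 1 (w 1) i))).sub (scalarOn_logPoly
      (MvPolynomial.C (cross (w 1) (w 2) i / 2) * MvPolynomial.X 2))
  rwa [add_zero] at this

theorem scalarOn_Va (n : ℤ) (i : Fin 3) :
    ScalarOn w ((vertexData w).Va n i) (scalarPart 0 (w 0) (w 1 + (w 2 + w 3)) n i -
      MvPolynomial.C (cross (w 0) (w 1) i / 2) * MvPolynomial.X 1 -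
      MvPolynomial.C (cross (w 0) (w 2) i / 2) * MvPolynomial.X 2) := by
  have := (((scalarOn_logPoly (w := w) (scalarPart 0 (w 0) (w 1 + (w 2 + w 3)) n i)).add
    (scalarOn_of_mem (windPart_mem_Jr w 0 (w 0) i))).sub (scalarOn_logPoly
      (MvPolynomial.C (cross (w 0) (w 1) i / 2) * MvPolynomial.X 1))).sub (scalarOn_logPoly
      (MvPolynomial.C (cross (w 0) (w 2) i / 2) * MvPolynomial.X 2))
  rwa [add_zero] at this

/-- The central commutator of two opposite modes of exponents on the vacuum: the winding operators
vanish there, and the commutators of `x^*` with `x` pair each winding vector with the scalar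
coefficients of the other exponent. -/
theorem scalarOn_comm {u u' : Fin 3 → ℂ} {V V' : Fin 3 → LogRing WindOp}
    {p p' : Fin 3 → MvPolynomial (Fin 3) ℂ} (hV : ∀ i r, Commute (V i) r)
    (hV' : ∀ i r, Commute (V' i) r) (hp : ∀ i, ScalarOn w (V i) (p i))
    (hp' : ∀ i, ScalarOn w (V' i) (p' i)) {n : ℤ} (hn : n ≠ 0) :
    ScalarOn w (comm ((vertexData w).fld u V n) ((vertexData w).fld u' V' (-n)))
      (-((1 : ℂ) / n) • (∑ i, u i • p' i + ∑ i, u' i • p i)) := by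
  have h1 : ScalarOn w (((1 : ℂ) / (n : ℂ) ^ 2) • ∑ k, cross u u' k • (vertexData w).W k) 0 :=
    scalarOn_of_mem (Submodule.smul_mem _ _ (Submodule.sum_mem _ fun k _ =>
      Submodule.smul_mem _ _ (W_mem_Jr w k)))
  have h2 := h1.sub (((ScalarOn.sum fun i => (hp' i).smul (u i)).add
    (ScalarOn.sum fun i => (hp i).smul (u' i))).smul ((1 : ℂ) / n))
  rw [(vertexData w).comm_fld_fld_neg hV hV' hn]
  rwa [zero_sub, ← neg_smul] at h2

theorem sum_smul_scalarPart (A : Fin 3) (a u κ : Fin 3 → ℂ) (n : ℤ) :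
    ∑ i, a i • scalarPart A u κ n i = MvPolynomial.C (eVol u κ a / (2 * (n : ℂ))) +
      MvPolynomial.C (eVol u κ a / 2) * MvPolynomial.X A := by
  simp only [scalarPart, smul_add, Finset.sum_add_distrib, ← smul_mul_assoc, ← Finset.sum_mul,
    MvPolynomial.smul_eq_C_mul, ← map_mul, ← map_sum, mul_div_assoc', ← Finset.sum_div]
  rw [← dot_cross, dot]

theorem sum_smul_cross (B : Fin 3) (a u v : Fin 3 → ℂ) :
    ∑ i, a i • (MvPolynomial.C (cross u v i / 2) * MvPolynomial.X B) =
      MvPolynomial.C (eVol u v a / 2) * (MvPolynomial.X B : MvPolynomial (Fin 3) ℂ) := by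
  simp only [← smul_mul_assoc, ← Finset.sum_mul,
    MvPolynomial.smul_eq_C_mul, ← map_mul, ← map_sum, mul_div_assoc', ← Finset.sum_div]
  rw [← dot_cross, dot]

theorem dot_smul (s : ℂ) (u v : Fin 3 → ℂ) : dot u (s • v) = s * dot u v := by
  simp only [dot, Pi.smul_apply, smul_eq_mul, Finset.mul_sum]
  exact Finset.sum_congr rfl fun i _ => by ring

theorem ScalarOn.congr {r r' : LogRing WindOp} {p p' : MvPolynomial (Fin 3) ℂ}
    (h : ScalarOn w r p) (hr : r' = r) (hp : p' = p) : ScalarOn w r' p' := by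
  rwa [hr, hp]

theorem scalarOn_algebraMap (c : ℂ) :
    ScalarOn w (algebraMap ℂ (LogRing WindOp) c) (MvPolynomial.C c) := by
  have := scalarOn_logPoly (w := w) (algebraMap ℂ (MvPolynomial (Fin 3) ℂ) c)
  rwa [AlgHom.commutes] at this

theorem scalarOn_ab {n : ℕ} (hn : n ≠ 0) : ScalarOn w ((vertexData w).ab n n)
    (eVol (w 0) (w 1) (w 3) • rogersCoeff 0 1 n + eVol (w 0) (w 1) (w 2) • rogersCoeff 0 1 n) := by
  have hC : (n : ℂ) ≠ 0 := Nat.cast_ne_zero.mpr hn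
  refine (scalarOn_comm w (u := w 0) (u' := w 1) ((vertexData w).Va_central n)
    ((vertexData w).Vb_central (-n)) (scalarOn_Va w n) (scalarOn_Vb w (-n)) (n := n)
    (by omega)).congr w ?_ ?_
  · rw [VertexData.ab, VertexData.coeff_annA, VertexData.coeff_creB, if_neg hn, if_neg hn]
    rfl
  · simp only [smul_sub, Finset.sum_sub_distrib, sum_smul_scalarPart, sum_smul_cross]
    refine MvPolynomial.funext fun x => ?_
    simp only [rogersCoeff, map_add, map_sub, map_mul, MvPolynomial.smul_eval, MvPolynomial.eval_C,
      MvPolynomial.eval_X, Int.cast_neg, Int.cast_natCast]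
    have e1 : eVol (w 1) (w 2 + w 3) (w 0) = eVol (w 0) (w 1) (w 2) + eVol (w 0) (w 1) (w 3) := by
      simp only [eVol, eps, Fin.sum_univ_three, Pi.add_apply]; ring
    have e2 : eVol (w 0) (w 1 + (w 2 + w 3)) (w 1) =
        - eVol (w 0) (w 1) (w 2) - eVol (w 0) (w 1) (w 3) := by
      simp only [eVol, eps, Fin.sum_univ_three, Pi.add_apply]; ring
    have e3 : eVol (w 1) (w 2) (w 0) = eVol (w 0) (w 1) (w 2) := by
      simp only [eVol, eps, Fin.sum_univ_three]; ring
    have e4 : eVol (w 0) (w 1) (w 1) = 0 := by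
      simp only [eVol, eps, Fin.sum_univ_three]; ring
    have e5 : eVol (w 0) (w 2) (w 1) = - eVol (w 0) (w 1) (w 2) := by
      simp only [eVol, eps, Fin.sum_univ_three]; ring
    rw [e1, e2, e3, e4, e5]
    field_simp
    ring

theorem scalarOn_ac {n : ℕ} (hn : n ≠ 0) : ScalarOn w ((vertexData w).ac n n)
    (eVol (w 0) (w 2) (w 3) • rogersCoeff 0 2 n +
      eVol (w 0) (w 1) (w 2) • (MvPolynomial.C (-(1 / (2 * (n : ℂ) ^ 2))) +
        MvPolynomial.C (1 / (2 * (n : ℂ))) * (MvPolynomial.X 1 - MvPolynomial.X 0))) := by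
  have hC : (n : ℂ) ≠ 0 := Nat.cast_ne_zero.mpr hn
  refine (scalarOn_comm w (u := w 0) (u' := w 2) ((vertexData w).Va_central n)
    ((vertexData w).Vc_central (-n)) (scalarOn_Va w n) (scalarOn_Vc w (-n)) (n := n)
    (by omega)).congr w ?_ ?_
  · rw [VertexData.ac, VertexData.coeff_annA, VertexData.coeff_creC, if_neg hn, if_neg hn]
    rfl
  · simp only [smul_sub, Finset.sum_sub_distrib, sum_smul_scalarPart, sum_smul_cross]
    refine MvPolynomial.funext fun x => ?_
    simp only [rogersCoeff, map_add, map_sub, map_mul, MvPolynomial.smul_eval, MvPolynomial.eval_C,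
      MvPolynomial.eval_X, Int.cast_neg, Int.cast_natCast]
    have e1 : eVol (w 2) (w 3) (w 0) = eVol (w 0) (w 2) (w 3) := by
      simp only [eVol, eps, Fin.sum_univ_three]; ring
    have e2 : eVol (w 0) (w 1 + (w 2 + w 3)) (w 2) =
        eVol (w 0) (w 1) (w 2) - eVol (w 0) (w 2) (w 3) := by
      simp only [eVol, eps, Fin.sum_univ_three, Pi.add_apply]; ring
    have e4 : eVol (w 0) (w 2) (w 2) = 0 := by
      simp only [eVol, eps, Fin.sum_univ_three]; ring
    rw [e1, e2, e4]
    field_simp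
    ring

theorem scalarOn_bc {n : ℕ} (hn : n ≠ 0) : ScalarOn w ((vertexData w).bc n n)
    (eVol (w 1) (w 2) (w 3) • rogersCoeff 1 2 n) := by
  have hC : (n : ℂ) ≠ 0 := Nat.cast_ne_zero.mpr hn
  refine (scalarOn_comm w (u := w 1) (u' := w 2) ((vertexData w).Vb_central n)
    ((vertexData w).Vc_central (-n)) (scalarOn_Vb w n) (scalarOn_Vc w (-n)) (n := n)
    (by omega)).congr w ?_ ?_
  · rw [VertexData.bc, VertexData.coeff_annB, VertexData.coeff_creC, if_neg hn, if_neg hn]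
    rfl
  · simp only [smul_sub, Finset.sum_sub_distrib, sum_smul_scalarPart, sum_smul_cross]
    refine MvPolynomial.funext fun x => ?_
    simp only [rogersCoeff, map_add, map_sub, map_mul, MvPolynomial.smul_eval, MvPolynomial.eval_C,
      MvPolynomial.eval_X, Int.cast_neg, Int.cast_natCast]
    have e1 : eVol (w 2) (w 3) (w 1) = eVol (w 1) (w 2) (w 3) := by
      simp only [eVol, eps, Fin.sum_univ_three]; ring
    have e2 : eVol (w 1) (w 2 + w 3) (w 2) = - eVol (w 1) (w 2) (w 3) := by
      simp only [eVol, eps, Fin.sum_univ_three, Pi.add_apply]; ring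
    have e4 : eVol (w 1) (w 2) (w 2) = 0 := by
      simp only [eVol, eps, Fin.sum_univ_three]; ring
    rw [e1, e2, e4]
    field_simp
    ring

theorem comm_ab_creC_of_lt {n c : ℕ} (hc : 0 < c) (h : c < n) :
    comm ((vertexData w).ab n (n - c)) (coeff c (vertexData w).creC) =
      algebraMap ℂ _ (eVol (w 0) (w 1) (w 2) / (2 * n * (n - c))) := by
  have hn0 : (n : ℂ) ≠ 0 := Nat.cast_ne_zero.mpr (by omega)
  have hc0 : (c : ℂ) ≠ 0 := Nat.cast_ne_zero.mpr (by omega)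
  have hnc : (n : ℂ) - c ≠ 0 := sub_ne_zero.mpr (Nat.cast_injective.ne (by omega))
  rw [VertexData.ab, VertexData.coeff_annA, VertexData.coeff_creB, VertexData.coeff_creC,
    if_neg (by omega), if_neg (by omega), if_neg (by omega), VertexData.a, VertexData.b,
    VertexData.c, (vertexData w).comm_fld_fld ((vertexData w).Va_central _)
      ((vertexData w).Vb_central _) (by omega) (by omega) (by omega), comm_swap,
    (vertexData w).comm_fld_xmode ((vertexData w).Vc_central _) _ (by omega) (by omega),
    if_pos (by omega), Algebra.smul_def, ← map_mul]
  congr 1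
  change -1 * (dot (w 2) (_ • cross (w 0) (w 1)) / _) = _
  rw [dot_smul, dot_cross, Nat.cast_sub h.le]
  push_cast [Nat.cast_sub h.le]
  have e : (n : ℂ) + -(n - c) = c := by ring
  rw [e]
  field_simp

theorem comm_annA_bc_of_lt {n c : ℕ} (hn : 0 < n) (h : n < c) :
    comm (coeff n (vertexData w).annA) ((vertexData w).bc (c - n) c) =
      algebraMap ℂ _ (-(eVol (w 0) (w 1) (w 2) / (2 * c * (c - n)))) := by
  have hn0 : (n : ℂ) ≠ 0 := Nat.cast_ne_zero.mpr (by omega)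
  have hc0 : (c : ℂ) ≠ 0 := Nat.cast_ne_zero.mpr (by omega)
  have hnc : (c : ℂ) - n ≠ 0 := sub_ne_zero.mpr (Nat.cast_injective.ne (by omega))
  rw [VertexData.bc, VertexData.coeff_annA, VertexData.coeff_annB, VertexData.coeff_creC,
    if_neg (by omega), if_neg (by omega), if_neg (by omega), VertexData.a, VertexData.b,
    VertexData.c, (vertexData w).comm_fld_fld ((vertexData w).Vb_central _)
      ((vertexData w).Vc_central _) (by omega) (by omega) (by omega),
    (vertexData w).comm_fld_xmode ((vertexData w).Va_central _) _ (by omega) (by omega),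
    if_pos (by omega)]
  congr 1
  change dot (w 0) (_ • cross (w 1) (w 2)) / _ = _
  have e3 : eVol (w 1) (w 2) (w 0) = eVol (w 0) (w 1) (w 2) := by
    simp only [eVol, eps, Fin.sum_univ_three]; ring
  rw [dot_smul, dot_cross, e3]
  push_cast [Nat.cast_sub h.le]
  have e : (c : ℂ) - n + -c = -n := by ring
  rw [e]
  field_simp

/-- On the vacuum the logarithm of the correlator is the exponent of the five-point function. The
terms with `n = 0`, `c = 0` and `n = c` come from single commutators, the off-diagonal ones from
the iterated commutators of all three exponents; the latter are half of `mixedCoeff`, the mixed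
terms that the five-term relation contributes to `L((w - t) / (z - t))`. -/
theorem scalarOn_expo (n c : ℕ) : ScalarOn w ((vertexData w).expo n c) (exponentCoeff w n c) := by
  have h0 : ∀ r : LogRing WindOp, comm 0 r = 0 := fun r => by simp [comm]
  have h0' : ∀ r : LogRing WindOp, comm r 0 = 0 := fun r => by simp [comm]
  rcases Nat.eq_zero_or_pos n with rfl | hn
  · rcases Nat.eq_zero_or_pos c with rfl | hc
    · rw [VertexData.expo_zero, exponentCoeff_zero]
      exact scalarOn_of_mem (Submodule.zero_mem _)
    · refine (scalarOn_bc w hc.ne').congr w ?_ ?_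
      · rw [VertexData.expo, VertexData.coeff_zero_annA, h0, if_neg hc.ne', if_neg hc.ne',
          if_neg (by omega), ite_self, if_pos rfl]
        simp
      · simp [exponentCoeff, shiftCoeff, mixedCoeff, hc.ne', hc.ne]
  rcases Nat.eq_zero_or_pos c with rfl | hc
  · refine (scalarOn_ab w hn.ne').congr w ?_ ?_
    · rw [VertexData.expo, VertexData.coeff_zero_creC, h0', if_pos rfl, if_neg hn.ne,
        if_neg (by omega : ¬ n ≤ 0), ite_self, if_neg hn.ne']
      simp
    · simp [exponentCoeff, shiftCoeff, mixedCoeff, hn.ne']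
  rcases lt_trichotomy n c with h | rfl | h
  · refine (scalarOn_algebraMap w (-(eVol (w 0) (w 1) (w 2) / (2 * c * (c - n))))).congr w ?_ ?_
    · rw [VertexData.expo, if_neg (by omega), if_neg (by omega), if_neg (by omega), if_pos h.le,
        if_neg (by omega), comm_annA_bc_of_lt w hn h]
      simp
    · rw [exponentCoeff, shiftCoeff, mixedCoeff, if_neg hn.ne', if_neg hc.ne', if_neg h.ne,
        if_neg h.ne, if_neg (by omega), if_pos ⟨hn, h⟩, smul_zero, smul_zero,
        smul_zero, add_zero, add_zero, zero_add, zero_add, MvPolynomial.smul_eq_C_mul,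
        ← map_mul]
      congr 1
      rw [neg_div, mul_neg]
      congr 1
      field_simp
  · refine (scalarOn_ac w hn.ne').congr w ?_ ?_
    · rw [VertexData.expo, if_neg hn.ne', if_pos rfl, if_pos le_rfl, if_pos le_rfl,
        Nat.sub_self, VertexData.ab_zero_right, VertexData.bc_zero_left, h0, h0', if_neg hn.ne']
      simp
    · simp [exponentCoeff, shiftCoeff, mixedCoeff, hn.ne']
  · refine (scalarOn_algebraMap w (eVol (w 0) (w 1) (w 2) / (2 * n * (n - c)))).congr w ?_ ?_
    · rw [VertexData.expo, if_neg (by omega), if_neg (by omega), if_pos h.le,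
        if_neg (by omega : ¬ n ≤ c), if_neg (by omega), comm_ab_creC_of_lt w hc h]
      simp
    · rw [exponentCoeff, shiftCoeff, mixedCoeff, if_neg hn.ne', if_neg hc.ne', if_neg h.ne',
        if_neg h.ne', if_pos ⟨hc, h⟩, smul_zero, smul_zero,
        smul_zero, add_zero, add_zero, zero_add, zero_add, MvPolynomial.smul_eq_C_mul,
        ← map_mul]
      congr 1
      field_simp

theorem exponent5_mem : exponent5 w ∈ (Filt.F 1 : Submodule ℂ Ser) := by
  refine mem_F_one_ser ?_
  rw [exponent5_eq]
  exact exponentCoeff_zero w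

/-- On the vacuum the exponential of the logarithm of the correlator is the expansion of the
exponential of the exponent of the five-point function. -/
theorem fexp_expo_sub_mem :
    fexp (tri fun n c e => if e = n then (vertexData w).expo n c else 0) -
      embedSer WindOp (formalExp (exponent5 w)) ∈
        coeffwise (coeffwise (coeffwise (vertexData w).Jr)) := by
  set T := tri fun n c e => if e = n then (vertexData w).expo n c else 0 with hT
  set S := embedSer WindOp (exponent5 w) with hS
  have hSt : S = tri fun n c e => if e = n then logPoly WindOp (exponentCoeff w n c) else 0 := by
    rw [hS, exponent5_eq, embedSer_coeffSer]
  have hS1 : S ∈ (Filt.F 1 : Submodule ℂ _) := embedSer_mem 1 _ (exponent5_mem w)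
  have hT1 : T ∈ (Filt.F 1 : Submodule ℂ _) :=
    tri_mem_F_one (by rw [if_pos rfl, (vertexData w).expo_zero])
  have hJ : T - S ∈ coeffwise (coeffwise (coeffwise (vertexData w).Jr)) := fun n c e => by
    rw [map_sub, map_sub, map_sub, hT, hSt, coeff_tri, coeff_tri]
    split_ifs
    · exact scalarOn_expo w n c
    · rw [sub_zero]
      exact Submodule.zero_mem _
  have hc : Commute S (T - S) := by
    rw [hSt]
    refine commute_tri_central (fun n c e r => ?_) _
    split_ifs
    · exact logPoly_central _ r
    · exact Commute.zero_left r
  have hmul := coeffwise_mul_left (coeffwise_mul_left (coeffwise_mul_left (vertexData w).mul_Jr))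
  have hd : T - S ∈ (Filt.F 1 : Submodule ℂ _) := Submodule.sub_mem _ hT1 hS1
  have hexp : fexp (T - S) - 1 ∈ coeffwise (coeffwise (coeffwise (vertexData w).Jr)) :=
    fexp_sub_one_mem (coeffwise_closed (coeffwise_closed (coeffwise_closed
      (vertexData w).Jr_closed))) hd fun m => by
        rw [pow_succ]
        exact hmul _ _ hJ
  have h1 : fexp T = fexp S * fexp (T - S) := by
    rw [← fexp_add hS1 hd hc, add_sub_cancel]
  have h2 : embedSer WindOp (formalExp (exponent5 w)) = fexp S := by
    rw [formalExp_eq_fexp (exponent5_mem w)]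
    exact fexp_hom _ embedSer_mem (exponent5_mem w)
  rw [h1, h2, show fexp S * fexp (T - S) - fexp S = fexp S * (fexp (T - S) - 1) by
    rw [mul_sub, mul_one]]
  exact hmul _ _ hexp

end Exponent


/-! ### Vertex operators as series with coefficients in `WindOp` -/

theorem mapAlgHom_serExp {R S : Type*} [Ring R] [Algebra ℂ R] [Ring S] [Algebra ℂ S]
    (φ : R →ₐ[ℂ] S) (f : PowerSeries R) (n : ℕ) :
    φ (coeff n (serExp f)) = coeff n (serExp (PowerSeries.mapAlgHom φ f)) := by
  rw [serExp, serExp, PowerSeries.coeff_mk, PowerSeries.coeff_mk]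
  have h : ∀ g : PowerSeries R, φ (coeff n g) = coeff n (PowerSeries.mapAlgHom φ g) := fun g => by
    rw [PowerSeries.mapAlgHom_apply, PowerSeries.coeff_map]
    rfl
  rw [h, map_sum]
  simp only [map_smul, map_pow]

theorem mapAlgHom_coeff_serExp {R S : Type*} [Ring R] [Algebra ℂ R] [Ring S] [Algebra ℂ S]
    (φ : R →ₐ[ℂ] S) (f : PowerSeries (PowerSeries R)) (n : ℕ) :
    PowerSeries.mapAlgHom φ (coeff n (serExp f)) =
      coeff n (serExp (PowerSeries.mapAlgHom (PowerSeries.mapAlgHom φ) f)) :=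
  mapAlgHom_serExp _ f n

/-- `z^{α_l}` with coefficients in `WindOp`. -/
noncomputable def zExp (u : Fin 3 → ℂ) : PowerSeries WindOp :=
  PowerSeries.mk fun k => (1 / (k.factorial : ℂ)) • qSum u ^ k

/-- The creation part of the exponent with winding `u`, conjugated by the zero mode with
winding `κ`. -/
noncomputable def creE (u κ : Fin 3 → ℂ) : PowerSeries (PowerSeries WindOp) :=
  PowerSeries.mk fun n => if n = 0 then 0 else fieldSer u κ (-(n : ℤ))

/-- The annihilation part of the exponent with winding `u`, conjugated by the zero mode with
winding `κ`. -/
noncomputable def annE (u κ : Fin 3 → ℂ) : PowerSeries (PowerSeries WindOp) :=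
  PowerSeries.mk fun n => if n = 0 then 0 else fieldSer u κ (n : ℤ)

/-- The term of the vertex operator that takes the mode `p` of the creation part and the mode `q`
of the annihilation part, conjugated by the zero mode with winding `κ`, as a series in the
logarithm. -/
noncomputable def vertexTerm (u κ : Fin 3 → ℂ) (p q : ℕ) : PowerSeries WindOp :=
  zExp u * coeff p (serExp (creE u κ)) * coeff q (serExp (annE u κ))

theorem shift_creation (u κ : Fin 3 → ℂ) :
    PowerSeries.mapAlgHom (PowerSeries.mapAlgHom (shift κ)) (creation u) =
      PowerSeries.mapAlgHom (PowerSeries.mapAlgHom toEnd) (creE u κ) := by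
  refine PowerSeries.ext fun n => ?_
  rw [PowerSeries.mapAlgHom_apply, PowerSeries.mapAlgHom_apply, PowerSeries.coeff_map,
    PowerSeries.coeff_map, creation, creE, PowerSeries.coeff_mk, PowerSeries.coeff_mk]
  split_ifs
  · rw [map_zero, map_zero]
  · exact shift_fieldCoeff u κ (by omega)

theorem shift_annihilation (u κ : Fin 3 → ℂ) :
    PowerSeries.mapAlgHom (PowerSeries.mapAlgHom (shift κ)) (annihilation u) =
      PowerSeries.mapAlgHom (PowerSeries.mapAlgHom toEnd) (annE u κ) := by
  refine PowerSeries.ext fun n => ?_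
  rw [PowerSeries.mapAlgHom_apply, PowerSeries.mapAlgHom_apply, PowerSeries.coeff_map,
    PowerSeries.coeff_map, annihilation, annE, PowerSeries.coeff_mk, PowerSeries.coeff_mk]
  split_ifs
  · rw [map_zero, map_zero]
  · exact shift_fieldCoeff u κ (by omega)

theorem shift_zPow (u κ : Fin 3 → ℂ) : PowerSeries.mapAlgHom (shift κ) (zPow u) =
    PowerSeries.mapAlgHom toEnd (zExp u) := by
  refine PowerSeries.ext fun k => ?_
  rw [PowerSeries.mapAlgHom_apply, PowerSeries.mapAlgHom_apply, PowerSeries.coeff_map,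
    PowerSeries.coeff_map, zPow, zExp, PowerSeries.coeff_mk, PowerSeries.coeff_mk]
  change shift κ _ = toEnd _
  simp only [map_smul, map_pow, map_sum, qSum, shift_fQ, toEnd_opQ]

theorem shift_vertexTerm (u κ : Fin 3 → ℂ) (p q k : ℕ) :
    shift κ (coeff k (zPow u * coeff p (serExp (creation u)) *
      coeff q (serExp (annihilation u)))) = toEnd (coeff k (vertexTerm u κ p q)) := by
  have h : PowerSeries.mapAlgHom (shift κ) (zPow u * coeff p (serExp (creation u)) *
      coeff q (serExp (annihilation u))) = PowerSeries.mapAlgHom toEnd (vertexTerm u κ p q) := by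
    rw [vertexTerm, map_mul, map_mul, map_mul, map_mul, shift_zPow,
      mapAlgHom_coeff_serExp (R := Module.End ℂ Fock) (S := Module.End ℂ Fock) (shift κ),
      mapAlgHom_coeff_serExp (R := Module.End ℂ Fock) (S := Module.End ℂ Fock) (shift κ),
      mapAlgHom_coeff_serExp (S := Module.End ℂ Fock) toEnd,
      mapAlgHom_coeff_serExp (S := Module.End ℂ Fock) toEnd, shift_creation,
      shift_annihilation]
  have h1 := congrArg (coeff k) h
  rwa [PowerSeries.mapAlgHom_apply, PowerSeries.mapAlgHom_apply, PowerSeries.coeff_map,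
    PowerSeries.coeff_map] at h1

theorem vertex_expZero (u κ : Fin 3 → ℂ) (a : ℤ) (k : ℕ) (v : Fock) :
    vertex u a k (expZero κ v) = expZero (u + κ) (∑ᶠ q : ℕ,
      if 0 ≤ a + (q : ℤ) then toEnd (coeff k (vertexTerm u κ (a + (q : ℤ)).toNat q)) v else 0) := by
  rw [vertex, expZero_add, Module.End.mul_apply]
  congr 1
  refine Eq.trans ?_ (AddMonoidHom.map_finsum_of_injective (expZero κ).toAddMonoidHom
    (expZero_injective κ) _).symm
  refine finsum_congr fun q => ?_
  rw [LinearMap.toAddMonoidHom_coe]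
  split_ifs
  · rw [← Module.End.mul_apply, mul_expZero, Module.End.mul_apply, shift_vertexTerm]
  · rw [map_zero]

/-! ### Vertex operators as series in all logarithms -/

section Series

variable {R : Type*} [Ring R] [Algebra ℂ R] [Filt R]

theorem coeff_zero_fexp {f : PowerSeries R} (hf : coeff 0 f = 0) : coeff 0 (fexp f) = 1 := by
  rw [← serExp_eq_fexp hf, serExp, PowerSeries.coeff_mk]
  simp

theorem coeff_fexp_conj {f g : PowerSeries R} {u : R} (hf : coeff 0 f = 0) (hg : coeff 0 g = 0)
    (h : ∀ n, coeff n f * u = u * coeff n g) (n : ℕ) :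
    coeff n (fexp f) * u = u * coeff n (fexp g) := by
  have h1 : f * PowerSeries.C u = PowerSeries.C u * g := PowerSeries.ext fun n => by
    rw [PowerSeries.coeff_mul_C, PowerSeries.coeff_C_mul, h]
  have h2 := congrArg (coeff n) (fexp_conj (VertexData.mem_F_one_of_coeff_zero hf)
    (VertexData.mem_F_one_of_coeff_zero hg) h1)
  rwa [PowerSeries.coeff_mul_C, PowerSeries.coeff_C_mul] at h2

theorem coeff_fexp_mem {J : Submodule ℂ R} (hJ : FiltClosed J) {f : PowerSeries R}
    (hf : coeff 0 f = 0) (hp : ∀ m, f ^ (m + 1) ∈ coeffwise J) {n : ℕ} (hn : n ≠ 0) :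
    coeff n (fexp f) ∈ J := by
  have h := fexp_sub_one_mem (coeffwise_closed hJ) (VertexData.mem_F_one_of_coeff_zero hf) hp n
  rwa [map_sub, PowerSeries.coeff_one, if_neg hn, sub_zero] at h

end Series

theorem inLog_vertexTerm (A : Fin 3) (u κ : Fin 3 → ℂ) (p q : ℕ) :
    inLog WindOp A (vertexTerm u κ p q) = expLog A (qSum u) *
      coeff p (fexp (PowerSeries.mapAlgHom (inLog WindOp A) (creE u κ))) *
      coeff q (fexp (PowerSeries.mapAlgHom (inLog WindOp A) (annE u κ))) := by
  have h : ∀ f : PowerSeries (PowerSeries WindOp), coeff 0 f = 0 →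
      coeff 0 (PowerSeries.mapAlgHom (inLog WindOp A) f) = 0 := fun f hf => by
    rw [PowerSeries.mapAlgHom_apply, PowerSeries.coeff_map, hf, map_zero]
  rw [vertexTerm, map_mul, map_mul, mapAlgHom_serExp, mapAlgHom_serExp,
    serExp_eq_fexp (h _ (by rw [creE, PowerSeries.coeff_mk, if_pos rfl])),
    serExp_eq_fexp (h _ (by rw [annE, PowerSeries.coeff_mk, if_pos rfl])), zExp, inLog_expSeries]


/-! ### The five-point function -/

section FivePoint

/-- The creation part of an exponent, with the logarithm of index `A`. -/
noncomputable def creL (A : Fin 3) (u κ : Fin 3 → ℂ) : PowerSeries (LogRing WindOp) :=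
  PowerSeries.mapAlgHom (inLog WindOp A) (creE u κ)

/-- The annihilation part of an exponent, with the logarithm of index `A`. -/
noncomputable def annL (A : Fin 3) (u κ : Fin 3 → ℂ) : PowerSeries (LogRing WindOp) :=
  PowerSeries.mapAlgHom (inLog WindOp A) (annE u κ)

theorem coeff_creL (A : Fin 3) (u κ : Fin 3 → ℂ) (n : ℕ) : coeff n (creL A u κ) =
    if n = 0 then 0 else logModes.fld u
      (fun i => logPoly WindOp (scalarPart A u κ (-n) i) + windPart A u i) (-n) := by
  rw [creL, PowerSeries.mapAlgHom_apply, PowerSeries.coeff_map, creE, PowerSeries.coeff_mk]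
  split_ifs
  · rw [map_zero]
  · exact inLog_fieldSer A u κ _

theorem coeff_annL (A : Fin 3) (u κ : Fin 3 → ℂ) (n : ℕ) : coeff n (annL A u κ) =
    if n = 0 then 0 else logModes.fld u
      (fun i => logPoly WindOp (scalarPart A u κ n i) + windPart A u i) n := by
  rw [annL, PowerSeries.mapAlgHom_apply, PowerSeries.coeff_map, annE, PowerSeries.coeff_mk]
  split_ifs
  · rw [map_zero]
  · exact inLog_fieldSer A u κ _

theorem coeff_zero_creL (A : Fin 3) (u κ : Fin 3 → ℂ) : coeff 0 (creL A u κ) = 0 := by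
  rw [coeff_creL, if_pos rfl]

theorem coeff_zero_annL (A : Fin 3) (u κ : Fin 3 → ℂ) : coeff 0 (annL A u κ) = 0 := by
  rw [coeff_annL, if_pos rfl]

theorem exponent_central (A : Fin 3) (u κ : Fin 3 → ℂ) (n : ℤ) (i : Fin 3) (r : LogRing WindOp) :
    Commute (logPoly WindOp (scalarPart A u κ n i) + windPart A u i) r :=
  (logPoly_central _ r).add_left (windPart_central _ _ _ r)

variable (w : Fin 4 → Fin 3 → ℂ)

theorem creL_mem (A : Fin 3) (u κ : Fin 3 → ℂ) {n : ℕ} (hn : n ≠ 0) :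
    coeff n (fexp (creL A u κ)) ∈ (vertexData w).Jl := by
  refine coeff_fexp_mem (vertexData w).Jl_closed (coeff_zero_creL A u κ) (fun m => ?_) hn
  rw [pow_succ']
  refine coeffwise_mul_right (vertexData w).Jl_mul _ _ fun n => ?_
  have : (vertexData w).IsFld u (-n) (coeff n (creL A u κ)) := by
    rw [coeff_creL]
    split_ifs with h
    · exact Or.inl rfl
    · exact Or.inr ⟨_, by omega, exponent_central A u κ _, rfl⟩
  exact this.mem_Jl (by omega)

theorem annL_mem (A : Fin 3) (u κ : Fin 3 → ℂ) {n : ℕ} (hn : n ≠ 0) :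
    coeff n (fexp (annL A u κ)) ∈ (vertexData w).Jr := by
  refine coeff_fexp_mem (vertexData w).Jr_closed (coeff_zero_annL A u κ) (fun m => ?_) hn
  rw [pow_succ]
  refine coeffwise_mul_left (vertexData w).mul_Jr _ _ fun n => ?_
  have : (vertexData w).IsFld u n (coeff n (annL A u κ)) := by
    rw [coeff_annL]
    split_ifs with h
    · exact Or.inl rfl
    · exact Or.inr ⟨_, by omega, exponent_central A u κ _, rfl⟩
  exact this.mem_Jr (by omega)

theorem creL_eq_creC : creL 2 (w 2) (w 3) = (vertexData w).creC := PowerSeries.ext fun n => by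
  rw [coeff_creL, VertexData.coeff_creC]
  rfl

theorem coeff_creL_mul (n : ℕ) :
    coeff n (fexp (creL 1 (w 1) (w 2 + w 3))) * expLog 2 (qSum (w 2)) =
      expLog 2 (qSum (w 2)) * coeff n (fexp (vertexData w).creB) := by
  refine coeff_fexp_conj (coeff_zero_creL _ _ _) (vertexData w).coeff_zero_creB (fun n => ?_) n
  rw [coeff_creL, VertexData.coeff_creB]
  split_ifs
  · rw [zero_mul, mul_zero]
  · exact fld_mul_expLog 2 (w 1) (w 2) (exponent_central _ _ _ _) (by omega)

theorem coeff_annL_mul (n : ℕ) :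
    coeff n (fexp (annL 1 (w 1) (w 2 + w 3))) * expLog 2 (qSum (w 2)) =
      expLog 2 (qSum (w 2)) * coeff n (fexp (vertexData w).annB) := by
  refine coeff_fexp_conj (coeff_zero_annL _ _ _) (vertexData w).coeff_zero_annB (fun n => ?_) n
  rw [coeff_annL, VertexData.coeff_annB]
  split_ifs
  · rw [zero_mul, mul_zero]
  · exact fld_mul_expLog 2 (w 1) (w 2) (exponent_central _ _ _ _) (by omega)

theorem coeff_annL_mul_mul (n : ℕ) : coeff n (fexp (annL 0 (w 0) (w 1 + (w 2 + w 3)))) *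
    (expLog 1 (qSum (w 1)) * expLog 2 (qSum (w 2))) =
      expLog 1 (qSum (w 1)) * expLog 2 (qSum (w 2)) * coeff n (fexp (vertexData w).annA) := by
  refine coeff_fexp_conj (coeff_zero_annL _ _ _) (vertexData w).coeff_zero_annA (fun n => ?_) n
  rw [coeff_annL, VertexData.coeff_annA]
  split_ifs
  · rw [zero_mul, mul_zero]
  · rw [← mul_assoc, fld_mul_expLog 1 (w 0) (w 1) (exponent_central _ _ _ _) (by omega), mul_assoc,
      fld_mul_expLog 2 (w 0) (w 2) (fun i r =>
        (exponent_central _ _ _ _ i r).sub_left (logPoly_central _ r)) (by omega), mul_assoc]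
    rfl

/-- The product of the terms of the three vertex operators. -/
theorem term_eq (p q p' q' c : ℕ) :
    inLogz WindOp (vertexTerm (w 0) (w 1 + (w 2 + w 3)) p q) *
      inLogw WindOp (vertexTerm (w 1) (w 2 + w 3) p' q') *
      inLogt WindOp (vertexTerm (w 2) (w 3) c 0) =
    expLog 0 (qSum (w 0)) * coeff p (fexp (creL 0 (w 0) (w 1 + (w 2 + w 3)))) *
      (expLog 1 (qSum (w 1)) * expLog 2 (qSum (w 2))) *
      (coeff q (fexp (vertexData w).annA) * (coeff p' (fexp (vertexData w).creB) *
        (coeff q' (fexp (vertexData w).annB) * coeff c (fexp (vertexData w).creC)))) := by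
  have h0 := inLog_vertexTerm 0 (w 0) (w 1 + (w 2 + w 3)) p q
  have h1 := inLog_vertexTerm 1 (w 1) (w 2 + w 3) p' q'
  have h2 := inLog_vertexTerm 2 (w 2) (w 3) c 0
  change inLogz WindOp _ = _ at h0
  change inLogw WindOp _ = _ at h1
  change inLogt WindOp _ = _ at h2
  have e2 : coeff 0 (fexp (annL 2 (w 2) (w 3))) = 1 := coeff_zero_fexp (coeff_zero_annL _ _ _)
  rw [h0, h1, h2, ← creL, ← annL, ← creL, ← annL, ← creL, ← annL, e2, mul_one, creL_eq_creC]
  have m1 := coeff_annL_mul w q'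
  have m2 := coeff_creL_mul w p'
  have m3 := coeff_annL_mul_mul w q
  generalize coeff q' (fexp (annL 1 (w 1) (w 2 + w 3))) = x1 at *
  generalize coeff p' (fexp (creL 1 (w 1) (w 2 + w 3))) = x2 at *
  generalize coeff q (fexp (annL 0 (w 0) (w 1 + (w 2 + w 3)))) = x3 at *
  generalize expLog 1 (qSum (w 1)) = e1 at *
  generalize expLog 2 (qSum (w 2)) = e2 at *
  simp only [mul_assoc] at *
  rw [← mul_assoc x1 e2, m1]
  simp only [mul_assoc]
  rw [← mul_assoc x2 e2, m2]
  simp only [mul_assoc]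
  rw [← mul_assoc e1 e2, ← mul_assoc x3, m3]
  simp only [mul_assoc]

/-- The coefficient of a series in the logarithms, applied to the vacuum. -/
noncomputable def vacVec (k l m : ℕ) : LogRing WindOp →ₗ[ℂ] Fock where
  toFun r := toEnd (coeff m (coeff l (coeff k r))) (fVac 1)
  map_add' r s := by simp only [map_add, LinearMap.add_apply]
  map_smul' z r := by
    simp only [coeff_smul_complex, map_smul, LinearMap.smul_apply, RingHom.id_apply]

theorem vacVec_eq_zero {r : LogRing WindOp} (h : r ∈ (vertexData w).Jr) (k l m : ℕ) :
    vacVec k l m r = 0 := h k l m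

theorem fProj_vacVec_eq_zero {r : LogRing WindOp} (h : r ∈ (vertexData w).Jl) (k l m : ℕ) :
    fProj (vacVec k l m r) = 0 := h k l m _

theorem fProj_vacVec_logPoly (p : MvPolynomial (Fin 3) ℂ) (k l m : ℕ) :
    fProj (vacVec k l m (logPoly WindOp p)) = algebraMap ℂ Ground
      (MvPolynomial.coeff (Finsupp.equivFunOnFinite.symm ![k, l, m]) p) := by
  change fProj (toEnd (coeff m (coeff l (coeff k (logPoly WindOp p)))) (fVac 1)) = _
  rw [coeff_logPoly, AlgHom.commutes, Module.algebraMap_end_apply, map_smul,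
    show fProj (fVac 1) = 1 from fockModule.proj_vac 1, Algebra.algebraMap_eq_smul_one]

theorem vacVec_mul (f g h : PowerSeries WindOp) (k l m : ℕ) :
    vacVec k l m (inLogz WindOp f * inLogw WindOp g * inLogt WindOp h) =
      toEnd (coeff k f) (toEnd (coeff l g) (toEnd (coeff m h) (fVac 1))) := by
  change toEnd (coeff m (coeff l (coeff k _))) (fVac 1) = _
  rw [coeff_inLog_mul, map_mul, map_mul, Module.End.mul_apply, Module.End.mul_apply]

theorem opQ_mem_right (i : Fin 3) : opQ i ∈ vacuumRight := by
  rw [mem_vacuumRight, toEnd_opQ, fQ_eq]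
  change (1 : Osc) ⊗ₜ[ℂ] dX i 1 = 0
  rw [dX, dirDeriv_one, TensorProduct.tmul_zero]

theorem qSum_mem_right (u : Fin 3 → ℂ) : qSum u ∈ vacuumRight :=
  Submodule.sum_mem _ fun i _ => Submodule.smul_mem _ _ (opQ_mem_right i)

theorem expLog_sub_one_mem (A : Fin 3) (u : Fin 3 → ℂ) :
    expLog A (qSum u) - 1 ∈ (vertexData w).Jr :=
  fexp_sub_one_mem (vertexData w).Jr_closed (logMul_mem A _) fun m => by
    rw [pow_succ]
    exact (vertexData w).mul_Jr _ _ ((vertexData w).mul_Jr _ _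
      (logConst_mem_coeffwise (qSum_mem_right u)))

theorem fProj_tm_one (B : Module.End ℂ Ground) (v : Fock) :
    fProj (tm 1 B v) = B (fProj v) := by
  induction v using TensorProduct.induction_on with
  | zero => simp
  | tmul a f => simp [fProj, tm]
  | add a b ha hb => rw [map_add, map_add, ha, hb, map_add, map_add]

theorem qSum_mul_mem_left (u : Fin 3 → ℂ) {T : WindOp} (h : T ∈ vacuumLeft) :
    qSum u * T ∈ vacuumLeft := fun v => by
  rw [map_mul, Module.End.mul_apply, qSum, map_sum, LinearMap.sum_apply, map_sum]
  refine Finset.sum_eq_zero fun i _ => ?_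
  rw [map_smul, toEnd_opQ, fQ_eq, LinearMap.smul_apply, map_smul, fProj_tm_one, h v, map_zero,
    smul_zero]

theorem expLog_mul_mem (A : Fin 3) (u : Fin 3 → ℂ) {r : LogRing WindOp}
    (h : r ∈ (vertexData w).Jl) : expLog A (qSum u) * r ∈ (vertexData w).Jl := by
  have hX : ∀ s ∈ (vertexData w).Jl,
      logPoly WindOp (MvPolynomial.X A) * logConst WindOp (qSum u) * s ∈ (vertexData w).Jl := by
    intro s hs
    rw [mul_assoc, (logPoly_central _ _).eq]
    refine (vertexData w).Jl_mul _ _ fun k l m => ?_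
    change coeff m (coeff l (coeff k (PowerSeries.C (PowerSeries.C (PowerSeries.C (qSum u))) * s)))
      ∈ _
    rw [PowerSeries.coeff_C_mul, PowerSeries.coeff_C_mul, PowerSeries.coeff_C_mul]
    exact qSum_mul_mem_left u (hs k l m)
  have hpow : ∀ m, (logPoly WindOp (MvPolynomial.X A) * logConst WindOp (qSum u)) ^ m * r ∈
      (vertexData w).Jl := fun m => by
    induction m with
    | zero => rwa [pow_zero, one_mul]
    | succ m ih =>
      rw [pow_succ', mul_assoc]
      exact hX _ ih
  refine (vertexData w).Jl_closed _ fun D => ⟨expPartial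
    (logPoly WindOp (MvPolynomial.X A) * logConst WindOp (qSum u)) D * r, ?_, ?_⟩
  · rw [expPartial, Finset.sum_mul]
    refine Submodule.sum_mem _ fun m _ => ?_
    rw [smul_mul_assoc]
    exact Submodule.smul_mem _ _ (hpow m)
  · rw [expLog, ← sub_mul]
    exact Filt.mul_right (isExp_fexp (logMul_mem A _) D) r

theorem coeff_zero_vertexTerm (u κ : Fin 3 → ℂ) : coeff 0 (vertexTerm u κ 0 0) = 1 := by
  have h : ∀ f : PowerSeries (PowerSeries WindOp), coeff 0 (serExp f) = 1 := fun f => by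
    rw [serExp, PowerSeries.coeff_mk]
    simp
  rw [vertexTerm, h, h, mul_one, mul_one, zExp, PowerSeries.coeff_mk]
  simp

theorem VertexData.coeff_state {R : Type*} [Ring R] [Algebra ℂ R] [Filt R] (D : VertexData R)
    (c e : ℕ) : coeff e (coeff c D.state) = ∑ j ∈ (Finset.range (c + 1)).filter (· ≤ e),
      coeff (e - j) (fexp D.creB) * coeff j (coeff c (fexp D.creC' * fexp D.bcLow')) := by
  have hr := (D.reflect_creC.fexp (mapAlgHom_cHom_mem_F_one D.coeff_zero_creC)
    (mem_F_one_of_coeff_zero D.coeff_zero_creC')).mul (D.reflect_bcLow.fexp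
      (mem_F_one_of_coeff_zero D.coeff_zero_bcLow) (mem_F_one_of_coeff_zero D.coeff_zero_bcLow'))
  have h1 : fexp (cHom (PowerSeries R) D.creB) = PowerSeries.C (fexp D.creB) :=
    (fexp_hom _ cHom_mem (mem_F_one_of_coeff_zero D.coeff_zero_creB)).symm
  rw [state, h1, PowerSeries.coeff_C_mul, PowerSeries.coeff_mul,
    ← Finset.Nat.sum_antidiagonal_swap, Finset.Nat.sum_antidiagonal_eq_sum_range_succ_mk]
  have h2 : (Finset.range (c + 1)).filter (· ≤ e) = (Finset.range (e + 1)).filter (· ≤ c) := by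
    ext j
    simp only [Finset.mem_filter, Finset.mem_range]
    omega
  rw [h2, Finset.sum_filter_of_ne]
  · rfl
  · intro j _ hj
    by_contra h
    exact hj (by rw [(hr c).2.1 j (by omega), mul_zero])

/-- The second vertex operator applied to the state created by the third. -/
theorem sum_creB_sub_mem (b : ℤ) (c : ℕ) :
    (∑ q ∈ Finset.range (c + 1), if 0 ≤ b + (q : ℤ) then
      coeff (b + (q : ℤ)).toNat (fexp (vertexData w).creB) *
        (coeff q (fexp (vertexData w).annB) * coeff c (fexp (vertexData w).creC)) else 0) -
      (if 0 ≤ b + (c : ℤ) then coeff (b + (c : ℤ)).toNat (coeff c (vertexData w).state) else 0) ∈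
        (vertexData w).Jr := by
  have h : (if 0 ≤ b + (c : ℤ) then coeff (b + (c : ℤ)).toNat (coeff c (vertexData w).state)
      else 0) = ∑ q ∈ Finset.range (c + 1), if 0 ≤ b + (q : ℤ) then
        coeff (b + (q : ℤ)).toNat (fexp (vertexData w).creB) * coeff (c - q) (coeff c
          (fexp (vertexData w).creC' * fexp (vertexData w).bcLow')) else 0 := by
    rw [← Finset.sum_range_reflect]
    split_ifs with hbc
    · rw [VertexData.coeff_state, Finset.sum_filter]
      refine Finset.sum_congr rfl fun j hj => ?_
      have hj' := Finset.mem_range.mp hj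
      by_cases hje : j ≤ (b + (c : ℤ)).toNat
      · rw [if_pos hje, if_pos (by omega), show (b + (c : ℤ)).toNat - j =
          (b + ((c + 1 - 1 - j : ℕ) : ℤ)).toNat by omega, show c - (c + 1 - 1 - j) = j by omega]
      · rw [if_neg hje, if_neg (by omega)]
    · refine (Finset.sum_eq_zero fun j hj => ?_).symm
      rw [if_neg (by omega)]
  rw [h, ← Finset.sum_sub_distrib]
  refine Submodule.sum_mem _ fun q hq => ?_
  have hq' := Finset.mem_range.mp hq
  split_ifs
  · rw [← mul_sub]
    refine (vertexData w).mul_Jr _ _ ?_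
    have := (vertexData w).annB_creC q c
    rwa [if_pos (by omega)] at this
  · rw [sub_zero]
    exact Submodule.zero_mem _

/-- The product of the zero modes, the powers of the insertion points and the creation part of the
first vertex operator. -/
noncomputable def leftPart (p : ℕ) : LogRing WindOp :=
  expLog 0 (qSum (w 0)) * coeff p (fexp (creL 0 (w 0) (w 1 + (w 2 + w 3)))) *
    (expLog 1 (qSum (w 1)) * expLog 2 (qSum (w 2)))

theorem leftPart_mem {p : ℕ} (hp : p ≠ 0) : leftPart w p ∈ (vertexData w).Jl := by
  rw [leftPart, mul_assoc]
  exact expLog_mul_mem w _ _ ((vertexData w).Jl_mul _ _ (creL_mem w _ _ _ hp))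

theorem leftPart_zero : leftPart w 0 =
    expLog 0 (qSum (w 0)) * (expLog 1 (qSum (w 1)) * expLog 2 (qSum (w 2))) := by
  rw [leftPart, coeff_zero_fexp (coeff_zero_creL _ _ _), mul_one]

theorem leftPart_mul_mem {r : LogRing WindOp} (h : r ∈ (vertexData w).Jl) :
    leftPart w 0 * r ∈ (vertexData w).Jl := by
  rw [leftPart_zero, mul_assoc, mul_assoc]
  exact expLog_mul_mem w _ _ (expLog_mul_mem w _ _ (expLog_mul_mem w _ _ h))

theorem leftPart_sub_one_mem : leftPart w 0 - 1 ∈ (vertexData w).Jr := by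
  have h : leftPart w 0 - 1 = expLog 0 (qSum (w 0)) * (expLog 1 (qSum (w 1)) *
      (expLog 2 (qSum (w 2)) - 1) + (expLog 1 (qSum (w 1)) - 1)) +
        (expLog 0 (qSum (w 0)) - 1) := by
    rw [leftPart_zero, mul_sub, mul_one, sub_add_sub_cancel, mul_sub, mul_one, sub_add_sub_cancel]
  rw [h]
  exact Submodule.add_mem _ ((vertexData w).mul_Jr _ _ (Submodule.add_mem _
    ((vertexData w).mul_Jr _ _ (expLog_sub_one_mem w _ _)) (expLog_sub_one_mem w _ _)))
      (expLog_sub_one_mem w _ _)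

theorem vacVec_term (p q p' q' c k l m : ℕ) :
    toEnd (coeff k (vertexTerm (w 0) (w 1 + (w 2 + w 3)) p q))
      (toEnd (coeff l (vertexTerm (w 1) (w 2 + w 3) p' q'))
        (toEnd (coeff m (vertexTerm (w 2) (w 3) c 0)) (fVac 1))) =
    vacVec k l m (leftPart w p * (coeff q (fexp (vertexData w).annA) *
      (coeff p' (fexp (vertexData w).creB) *
        (coeff q' (fexp (vertexData w).annB) * coeff c (fexp (vertexData w).creC))))) := by
  rw [← vacVec_mul, term_eq, leftPart]

/-- The state created by the third vertex operator. -/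
theorem vertex_expState (c : ℤ) (m : ℕ) :
    vertex (w 2) c m (fVac (expState (w 3))) = expZero (w 2 + w 3)
      (if 0 ≤ c then toEnd (coeff m (vertexTerm (w 2) (w 3) c.toNat 0)) (fVac 1) else 0) := by
  rw [fVac_expState, vertex_expZero, finsum_eq_single _ 0]
  · rw [Nat.cast_zero, add_zero]
  · intro q hq
    split_ifs
    · have h := vacVec_mul 1 1 (vertexTerm (w 2) (w 3) (c + (q : ℤ)).toNat q) 0 0 m
      simp only [PowerSeries.coeff_zero_one, map_one, Module.End.one_apply, one_mul] at h
      rw [← h]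
      have h2 := inLog_vertexTerm 2 (w 2) (w 3) (c + (q : ℤ)).toNat q
      change inLogt WindOp _ = _ at h2
      rw [h2]
      exact vacVec_eq_zero w ((vertexData w).mul_Jr _ _ (annL_mem w 2 (w 2) (w 3) hq)) _ _ _
    · rfl

/-- The state created by the second and the third vertex operator. -/
theorem vertex_vertex_expState (b : ℤ) (c l m : ℕ) :
    vertex (w 1) b l (vertex (w 2) c m (fVac (expState (w 3)))) = expZero (w 1 + (w 2 + w 3))
      (∑ q ∈ Finset.range (c + 1), if 0 ≤ b + (q : ℤ) then
        toEnd (coeff l (vertexTerm (w 1) (w 2 + w 3) (b + (q : ℤ)).toNat q))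
          (toEnd (coeff m (vertexTerm (w 2) (w 3) c 0)) (fVac 1)) else 0) := by
  rw [vertex_expState, if_pos (Int.natCast_nonneg c), Int.toNat_natCast, vertex_expZero]
  congr 1
  refine finsum_eq_sum_of_support_subset _ fun q hq => ?_
  by_contra h
  refine hq ?_
  have hqc : ¬ q ≤ c := fun h' => h (Finset.mem_coe.mpr (Finset.mem_range.mpr (by omega)))
  change (if _ then _ else _) = _
  split_ifs
  · have h1 := vacVec_term w 0 0 (b + (q : ℤ)).toNat q c 0 l m
    rw [coeff_zero_vertexTerm, map_one, Module.End.one_apply] at h1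
    rw [h1]
    refine vacVec_eq_zero w ((vertexData w).mul_Jr _ _ ((vertexData w).mul_Jr _ _
      ((vertexData w).mul_Jr _ _ ?_))) _ _ _
    have := (vertexData w).annB_creC q c
    rwa [if_neg hqc, sub_zero] at this
  · rfl

theorem vertexTerm_sum (p q c k l m : ℕ) (b : ℤ) :
    toEnd (coeff k (vertexTerm (w 0) (w 1 + (w 2 + w 3)) p q))
      (∑ q' ∈ Finset.range (c + 1), if 0 ≤ b + (q' : ℤ) then
        toEnd (coeff l (vertexTerm (w 1) (w 2 + w 3) (b + (q' : ℤ)).toNat q'))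
          (toEnd (coeff m (vertexTerm (w 2) (w 3) c 0)) (fVac 1)) else 0) =
    vacVec k l m (leftPart w p * (coeff q (fexp (vertexData w).annA) * if 0 ≤ b + (c : ℤ) then
      coeff (b + (c : ℤ)).toNat (coeff c (vertexData w).state) else 0)) := by
  have h := vacVec_eq_zero w ((vertexData w).mul_Jr (leftPart w p) _ ((vertexData w).mul_Jr
    (coeff q (fexp (vertexData w).annA)) _ (sum_creB_sub_mem w b c))) k l m
  rw [mul_sub, mul_sub, map_sub, sub_eq_zero] at h
  rw [← h, Finset.mul_sum, Finset.mul_sum, map_sum, map_sum]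
  refine Finset.sum_congr rfl fun q' _ => ?_
  split_ifs
  · exact vacVec_term w _ _ _ _ _ _ _ _
  · rw [map_zero, mul_zero, mul_zero, map_zero]

/-- The projection of the state created by the three vertex operators to the ground states. In the
sum over the coefficients `q` of the annihilation part of the first vertex operator, the coefficient
of `U` vanishes for `q > b + c`, and the projection kills every term with `q ≠ -a`, in which the
creation part of that operator contributes a nonzero power. -/
theorem fProj_vertex (a b c : ℤ) (k l m : ℕ) :
    fProj (vertex (w 0) a k (vertex (w 1) b l (vertex (w 2) c m (fVac (expState (w 3)))))) =
      expand3 (formalExp (exponent5 w)) a b c k l m •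
        expState (w 0 + (w 1 + (w 2 + w 3))) := by
  have hv0 : ∀ κ u a k, vertex u a k (expZero κ 0) = 0 := fun κ u a k => by
    rw [vertex_expZero]
    simp
  rcases lt_or_ge c 0 with hc | hc
  · rw [vertex_expState, if_neg (by omega), hv0, ← map_zero (expZero 0), hv0, map_zero, expand3,
      if_neg (by omega), zero_smul]
  lift c to ℕ using hc
  rw [vertex_vertex_expState, vertex_expZero, fProj_expZero]
  simp only [vertexTerm_sum]
  rcases lt_or_ge (b + (c : ℤ)) 0 with hbc | hbc
  · simp only [if_neg (show ¬ 0 ≤ b + (c : ℤ) by omega), mul_zero, map_zero, ite_self, finsum_zero]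
    rw [expand3, if_neg (by omega), zero_smul]
  obtain ⟨e, he⟩ : ∃ e : ℕ, b + (c : ℤ) = e := ⟨(b + (c : ℤ)).toNat, by omega⟩
  obtain ⟨U, hU, hUl, hUr⟩ := (vertexData w).annA_state
  have hterm : ∀ p q : ℕ, vacVec k l m (leftPart w p * (coeff q (fexp (vertexData w).annA) *
      if 0 ≤ b + (c : ℤ) then coeff (b + (c : ℤ)).toNat (coeff c (vertexData w).state) else 0)) =
      vacVec k l m (leftPart w p * coeff e (coeff c (coeff q U))) := fun p q => by
    rw [if_pos hbc, he, Int.toNat_natCast, ← sub_eq_zero, ← map_sub, ← mul_sub]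
    exact vacVec_eq_zero w ((vertexData w).mul_Jr _ _ (hUr q c e)) _ _ _
  simp only [hterm]
  have hfin : (Function.support fun q : ℕ => if 0 ≤ a + (q : ℤ) then
      vacVec k l m (leftPart w (a + (q : ℤ)).toNat *
        coeff e (coeff c (coeff q U))) else 0).Finite := by
    refine (Set.finite_Iic e).subset fun q hq => ?_
    by_contra h
    refine hq ?_
    change (if _ then _ else _) = _
    rw [hU q c e (not_le.mp h), mul_zero, map_zero, ite_self]
  rw [map_finsum fProj hfin]
  have hpos : ∀ q : ℕ, a + (q : ℤ) ≠ 0 → fProj (if 0 ≤ a + (q : ℤ) then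
      vacVec k l m (leftPart w (a + (q : ℤ)).toNat *
        coeff e (coeff c (coeff q U))) else 0) = 0 := by
    intro q hq
    split_ifs
    · exact fProj_vacVec_eq_zero w ((vertexData w).Jl_mul _ _ (leftPart_mem w (by omega))) _ _ _
    · rw [map_zero]
  rcases lt_or_ge 0 a with ha | ha
  · rw [finsum_eq_zero_of_forall_eq_zero fun q => hpos q (by omega), expand3, if_neg (by omega),
      zero_smul, mul_zero]
  obtain ⟨n, rfl⟩ : ∃ n : ℕ, a = -n := ⟨(-a).toNat, by omega⟩
  rw [finsum_eq_single _ n fun q hq => hpos q (by omega), if_pos (by omega), neg_add_cancel,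
    Int.toNat_zero]
  set φ := if e = n then MvPowerSeries.coeff (Finsupp.equivFunOnFinite.symm ![n, c])
    (formalExp (exponent5 w)) else 0 with hφ
  -- `u1` differs from `u2` by a term that the projection kills, and `u2` from the scalar by a term
  -- that annihilates the vacuum
  have hJl := hUl n c e
  have hJr := fexp_expo_sub_mem w n c e
  rw [map_sub, map_sub, map_sub] at hJl hJr
  have hemb : coeff e (coeff c (coeff n (embedSer WindOp (formalExp (exponent5 w))))) =
      logPoly WindOp φ := by
    rw [coeff_embedSer, hφ]
    split_ifs
    · rfl
    · rw [map_zero]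
  rw [hemb] at hJr
  set u1 := coeff e (coeff c (coeff n U))
  set u2 := coeff e (coeff c (coeff n (fexp (tri fun n c e =>
    if e = n then (vertexData w).expo n c else 0))))
  have hsplit : leftPart w 0 * u1 = leftPart w 0 * (u1 - u2) +
      (leftPart w 0 * (u2 - logPoly WindOp φ) + logPoly WindOp φ * (leftPart w 0 - 1)) +
      logPoly WindOp φ := by
    rw [mul_sub, mul_sub, mul_sub, mul_one, (logPoly_central φ (leftPart w 0)).eq]
    abel
  rw [hsplit, map_add, map_add, map_add, map_add, fProj_vacVec_eq_zero w (leftPart_mul_mem w hJl),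
    vacVec_eq_zero w (Submodule.add_mem _ ((vertexData w).mul_Jr _ _ hJr)
      ((vertexData w).mul_Jr _ _ (leftPart_sub_one_mem w))), map_zero, zero_add, zero_add,
    fProj_vacVec_logPoly, mul_comm, ← Algebra.smul_def, expand3]
  congr 1
  by_cases hen : e = n
  · rw [hφ, if_pos hen, if_pos (by omega)]
    simp
  · rw [hφ, if_neg hen, if_neg (by omega), MvPolynomial.coeff_zero]

theorem groundPair_smul (ψ : Pt → ℂ) (z : ℂ) (f : Ground) :
    groundPair ψ (z • f) = z * groundPair ψ f := by
  rw [groundPair, groundPair, ← MeasureTheory.integral_const_mul]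
  congr 1
  funext p
  change _ * (z * (f : Pt → ℂ) p) = _
  ring

/-- The five-point function. -/
theorem corr5_eq (ψ : Pt → ℂ) (a b c : ℤ) (k l m : ℕ) : corr5 ψ w a b c k l m =
    expand3 (formalExp (exponent5 w)) a b c k l m * groundPair ψ (expState (∑ i, w i)) := by
  rw [corr5, bra, fProj_vertex, groundPair_smul, Fin.sum_univ_four, add_assoc, add_assoc]

end FivePoint


/-! ### Winding characters -/

theorem winding_add (m n : Fin 3 → ℤ) : winding m + winding n = winding (m + n) := by
  funext i
  simp only [winding, Pi.add_apply]
  push_cast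
  ring

theorem winding_zero : winding 0 = 0 := by
  funext i
  simp [winding]

theorem sum_winding {ι : Type*} (s : Finset ι) (n : ι → Fin 3 → ℤ) :
    ∑ i ∈ s, winding (n i) = winding (∑ i ∈ s, n i) := by
  classical
  induction s using Finset.induction_on with
  | empty => rw [Finset.sum_empty, Finset.sum_empty, winding_zero]
  | insert a s ha ih => rw [Finset.sum_insert ha, Finset.sum_insert ha, ih, winding_add]

theorem volume_cube : volume cube = 1 := by
  have h : cube = (Set.univ.pi fun _ : Fin 3 => Set.Ico (0 : ℝ) 1) ×ˢ
      (Set.univ.pi fun _ : Fin 3 => Set.Ico (0 : ℝ) 1) := by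
    ext p
    simp only [cube, Set.mem_ofPred_eq, Set.mem_prod, Set.mem_univ_pi]
    exact forall_and
  rw [h, MeasureTheory.Measure.volume_eq_prod, MeasureTheory.Measure.prod_prod,
    MeasureTheory.volume_pi_pi]
  simp

/-- The winding characters have norm one in `L²`. -/
theorem groundPair_winding (n : Fin 3 → ℤ) :
    groundPair (expState (winding n) : Pt → ℂ) (expState (winding n)) = 1 := by
  have h : ∀ p : Pt, (starRingEnd ℂ) ((expState (winding n) : Pt → ℂ) p) *
      (expState (winding n) : Pt → ℂ) p = 1 := fun p => by
    change (starRingEnd ℂ) (Complex.exp (∑ i, winding n i * ((p.2 i : ℝ) : ℂ))) *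
      Complex.exp (∑ i, winding n i * ((p.2 i : ℝ) : ℂ)) = 1
    rw [← Complex.exp_conj, ← Complex.exp_add, map_sum, ← Finset.sum_add_distrib,
      Finset.sum_eq_zero, Complex.exp_zero]
    intro i _
    simp only [winding, map_mul, map_ofNat, Complex.conj_ofReal, Complex.conj_I, map_intCast]
    ring
  rw [groundPair, MeasureTheory.integral_congr_ae (Filter.Eventually.of_forall h),
    MeasureTheory.integral_const, MeasureTheory.measureReal_restrict_apply_univ,
    MeasureTheory.measureReal_def, volume_cube]
  simp

/-! ### The four-point function -/

theorem serExp_zero {R : Type*} [Ring R] [Algebra ℂ R] : serExp (0 : PowerSeries R) = 1 := by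
  refine PowerSeries.ext fun n => ?_
  rw [serExp, PowerSeries.coeff_mk, Finset.sum_range_succ', Finset.sum_eq_zero]
  · simp
  · intro m _
    rw [zero_pow (Nat.succ_ne_zero m), smul_zero]

theorem fieldCoeff_zero (n : ℤ) : fieldCoeff 0 n = 0 := by
  refine PowerSeries.ext fun k => ?_
  rw [fieldCoeff, PowerSeries.coeff_mk]
  simp

/-- The vertex operator without winding is the identity. -/
theorem vertex_zero (v : Fock) : vertex 0 0 0 v = v := by
  have h1 : creation 0 = 0 := PowerSeries.ext fun n => by
    rw [creation, PowerSeries.coeff_mk, fieldCoeff_zero, ite_self, map_zero]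
  have h2 : annihilation 0 = 0 := PowerSeries.ext fun n => by
    rw [annihilation, PowerSeries.coeff_mk, fieldCoeff_zero, ite_self, map_zero]
  have h3 : coeff 0 (zPow 0) = 1 := by
    rw [zPow, PowerSeries.coeff_mk]
    simp
  rw [vertex, expZero_zero, Module.End.one_apply, finsum_eq_single _ 0, h1, h2, serExp_zero]
  · simp [h3]
  · intro q hq
    rw [h2, serExp_zero, PowerSeries.coeff_one, if_neg hq, mul_zero, map_zero,
      LinearMap.zero_apply, ite_self]

theorem eVol_zero_left (u v : Fin 3 → ℂ) : eVol 0 u v = 0 := by simp [eVol]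

theorem corr4_eq (ψ : Pt → ℂ) (u : Fin 3 → Fin 3 → ℂ) (r s : ℤ) (k l : ℕ) : corr4 ψ u r s k l =
    expand3 (formalExp (eVol (u 0) (u 1) (u 2) • rogersL pairWT)) 0 r s 0 k l *
      groundPair ψ (expState (∑ i, u i)) := by
  have h := corr5_eq ![0, u 0, u 1, u 2] ψ 0 r s 0 k l
  have h1 : exponent5 ![0, u 0, u 1, u 2] = eVol (u 0) (u 1) (u 2) • rogersL pairWT := by
    rw [exponent5]
    change eVol (u 0) (u 1) (u 2) • _ + eVol 0 (u 0) (u 2) • _ + eVol 0 (u 1) (u 2) • _ +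
      eVol 0 (u 0) (u 1) • _ = _
    simp only [eVol_zero_left, zero_smul, add_zero]
  have h2 : ∑ i, (![0, u 0, u 1, u 2] : Fin 4 → Fin 3 → ℂ) i = ∑ i, u i := by
    rw [Fin.sum_univ_four, Fin.sum_univ_three]
    change 0 + u 0 + u 1 + u 2 = _
    rw [zero_add]
  rw [h1, h2] at h
  rw [← h, corr5, corr4]
  change _ = bra ψ (vertex 0 0 0 _)
  rw [vertex_zero]
  rfl

/-! ### Series in one ratio -/

section EvalAt

noncomputable instance : Filt (MvPolynomial (Fin 2) ℂ) := Filt.discrete _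

variable {A : FormalPair}

theorem evalAt_term_mem (hA : A.ratio ∈ (Filt.F 1 : Submodule ℂ Ser))
    (p : PowerSeries (MvPolynomial (Fin 2) ℂ)) (m : ℕ) :
    MvPolynomial.aeval ![A.logA, A.logB] (coeff m p) * A.ratio ^ m ∈
      (Filt.F m : Submodule ℂ Ser) := by
  rw [mul_comm]
  exact Filt.mul_right (Filt.pow_mem hA m) _

/-- Evaluation at a pair, as a homomorphism of algebras. -/
noncomputable def evalHom (hA : A.ratio ∈ (Filt.F 1 : Submodule ℂ Ser)) :
    PowerSeries (MvPolynomial (Fin 2) ℂ) →ₐ[ℂ] Ser :=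
  AlgHom.ofLinearMap
    { toFun := fun p => evalAt p A
      map_add' := fun p q => by
        rw [evalAt, evalAt, evalAt, gradedSum_add]
        simp only [map_add, add_mul]
      map_smul' := fun z p => by
        rw [evalAt, evalAt, RingHom.id_apply]
        refine gradedSum_eq (evalAt_term_mem hA _) fun D => ?_
        have h := Submodule.smul_mem _ z (gradedSum_sub_mem (evalAt_term_mem hA p) D)
        simpa only [smul_sub, Finset.smul_sum, coeff_smul_complex, map_smul, smul_mul_assoc]
          using h }
    (by
      change evalAt 1 A = 1
      refine gradedSum_eq (evalAt_term_mem hA 1) fun D => ?_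
      rcases D with _ | D
      · exact Filt.mem_zero _
      · rw [Finset.sum_range_succ', Finset.sum_eq_zero]
        · simp
        · intro m _
          rw [PowerSeries.coeff_one, if_neg (Nat.succ_ne_zero m), map_zero, zero_mul])
    (fun p q => by
      change evalAt (p * q) A = evalAt p A * evalAt q A
      rw [evalAt, evalAt, evalAt, gradedSum_mul (evalAt_term_mem hA p) (evalAt_term_mem hA q)]
      congr 1
      funext m
      rw [PowerSeries.coeff_mul, map_sum, Finset.sum_mul]
      refine Finset.sum_congr rfl fun i hi => ?_
      rw [← Finset.HasAntidiagonal.mem_antidiagonal.mp hi, map_mul, pow_add]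
      ring)

theorem evalHom_apply (hA : A.ratio ∈ (Filt.F 1 : Submodule ℂ Ser))
    (p : PowerSeries (MvPolynomial (Fin 2) ℂ)) : evalHom hA p = evalAt p A := rfl

theorem evalHom_mem (hA : A.ratio ∈ (Filt.F 1 : Submodule ℂ Ser)) (n : ℕ)
    (p : PowerSeries (MvPolynomial (Fin 2) ℂ)) (hp : p ∈ (Filt.F n : Submodule ℂ _)) :
    evalHom hA p ∈ (Filt.F n : Submodule ℂ Ser) := by
  have h := gradedSum_sub_mem (evalAt_term_mem hA p) n
  have h2 : ∑ m ∈ Finset.range n, MvPolynomial.aeval ![A.logA, A.logB] (coeff m p) *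
      A.ratio ^ m = 0 := Finset.sum_eq_zero fun m hm => by
    have hm' := Finset.mem_range.mp hm
    have h3 : coeff m p = 0 := by
      have := hp m
      obtain ⟨j, hj⟩ : ∃ j, n - m = j + 1 := ⟨n - m - 1, by omega⟩
      rw [hj] at this
      simpa [Filt.F] using this
    rw [h3, map_zero, zero_mul]
  rwa [h2, sub_zero] at h

/-- The series of `ε L` in the ratio and the logarithms. -/
noncomputable def rogersSeries (ε : ℂ) : PowerSeries (MvPolynomial (Fin 2) ℂ) :=
  PowerSeries.mk fun m => ε • (MvPolynomial.C (1 / (m : ℂ) ^ 2) +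
    MvPolynomial.C (1 / (2 * (m : ℂ))) * (MvPolynomial.X 0 - MvPolynomial.X 1))

theorem coeff_zero_rogersSeries (ε : ℂ) : coeff 0 (rogersSeries ε) = 0 := by
  rw [rogersSeries, PowerSeries.coeff_mk]
  simp

theorem evalAt_rogersSeries (hA : A.ratio ∈ (Filt.F 1 : Submodule ℂ Ser)) (ε : ℂ) :
    evalAt (rogersSeries ε) A = ε • rogersL A := by
  refine gradedSum_eq (evalAt_term_mem hA _) fun D => ?_
  have h1 := gradedSum_sub_mem (smul_pow_mem hA fun m => 1 / (m : ℂ) ^ 2) D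
  have h2 := gradedSum_sub_mem (smul_pow_mem hA fun m => -(1 / (m : ℂ))) D
  have h3 := Submodule.smul_mem _ ε (Submodule.add_mem _ h1 (Submodule.smul_mem _ ((1 : ℂ) / 2)
    (Filt.mul_left (A.logB - A.logA) h2)))
  refine (congrArg (· ∈ (Filt.F D : Submodule ℂ Ser)) ?_).mp h3
  change _ = ε • (li2 A.ratio + ((1 : ℂ) / 2) • ((A.logB - A.logA) * logOneSub A.ratio)) - _
  have h4 : ∑ m ∈ Finset.range D, MvPolynomial.aeval ![A.logA, A.logB]
      (coeff m (rogersSeries ε)) * A.ratio ^ m =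
      ε • (∑ m ∈ Finset.range D, (1 / (m : ℂ) ^ 2) • A.ratio ^ m + ((1 : ℂ) / 2) •
        ((A.logB - A.logA) * ∑ m ∈ Finset.range D, (-(1 / (m : ℂ))) • A.ratio ^ m)) := by
    rw [Finset.mul_sum, Finset.smul_sum, ← Finset.sum_add_distrib, Finset.smul_sum]
    refine Finset.sum_congr rfl fun m _ => ?_
    rw [rogersSeries, PowerSeries.coeff_mk]
    simp only [map_smul, map_add, map_mul, map_sub, MvPolynomial.aeval_X, MvPolynomial.aeval_C,
      Matrix.cons_val_zero, Matrix.cons_val_one, ← Algebra.smul_def]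
    rw [smul_mul_assoc, add_mul, smul_mul_assoc, mul_smul_comm, smul_smul]
    congr 2
    · rw [← Algebra.smul_def]
    · rw [show (1 : ℂ) / 2 * -(1 / (m : ℂ)) = -(1 / (2 * (m : ℂ))) by
        rw [mul_neg, div_mul_div_comm, one_mul], neg_smul, ← smul_neg, ← neg_mul, neg_sub]
  rw [h4, li2, logOneSub, ← smul_sub, add_sub_add_comm, ← smul_sub, ← mul_sub]

theorem evalAt_serExp (hA : A.ratio ∈ (Filt.F 1 : Submodule ℂ Ser)) (ε : ℂ) :
    evalAt (serExp (rogersSeries ε)) A = formalExp (ε • rogersL A) := by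
  have h1 : rogersSeries ε ∈ (Filt.F 1 : Submodule ℂ (PowerSeries (MvPolynomial (Fin 2) ℂ))) :=
    VertexData.mem_F_one_of_coeff_zero (coeff_zero_rogersSeries ε)
  have h2 := evalHom_mem hA 1 _ h1
  rw [evalHom_apply, evalAt_rogersSeries hA] at h2
  rw [formalExp_eq_fexp h2, serExp_eq_fexp (coeff_zero_rogersSeries ε), ← evalHom_apply hA,
    fexp_hom _ (evalHom_mem hA) h1, evalHom_apply, evalAt_rogersSeries hA]

theorem evalAt_pairWT (p : PowerSeries (MvPolynomial (Fin 2) ℂ)) : evalAt p pairWT =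
    coeffSer fun n c => if n = 0 then MvPolynomial.rename ![1, 2] (coeff c p) else 0 :=
  MvPowerSeries.ext fun d => by
    have ha : ∀ q : MvPolynomial (Fin 2) ℂ, MvPolynomial.aeval ![pairWT.logA, pairWT.logB] q =
        MvPowerSeries.C (MvPolynomial.rename ![1, 2] q) := fun q => by
      induction q using MvPolynomial.induction_on with
      | C z =>
        rw [MvPolynomial.aeval_C, MvPolynomial.rename_C]
        exact MvPowerSeries.algebraMap_apply
      | add p q hp hq => rw [map_add, map_add, map_add, hp, hq]
      | mul_X p i hp =>
        rw [map_mul, map_mul, map_mul, hp, MvPolynomial.aeval_X, MvPolynomial.rename_X]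
        fin_cases i <;> rfl
    rw [evalAt, coeff_gradedSum, coeff_coeffSer]
    have ht : ∀ m, MvPowerSeries.coeff d (MvPolynomial.aeval ![pairWT.logA, pairWT.logB]
        (coeff m p) * pairWT.ratio ^ m) = if d 0 = 0 ∧ m = d 1 then
          MvPolynomial.rename ![1, 2] (coeff m p) else 0 := fun m => by
      change MvPowerSeries.coeff d (_ * tw ^ m) = _
      rw [ha, MvPowerSeries.coeff_C_mul, tw_pow, coeff_coeffSer, mul_ite, mul_one, mul_zero]
    have hd : d.degree = d 0 + d 1 := by rw [Finsupp.degree_eq_sum, Fin.sum_univ_two]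
    simp only [ht]
    split_ifs with h0
    · simp only [h0, true_and]
      rw [Finset.sum_ite_eq', if_pos (Finset.mem_range.mpr (by omega))]
    · exact Finset.sum_eq_zero fun m _ => if_neg fun h => h0 h.1

theorem expand3_evalAt (p : PowerSeries (MvPolynomial (Fin 2) ℂ)) (r s : ℤ) (k l : ℕ) :
    expand3 (evalAt p pairWT) 0 r s 0 k l = expand2 p r s k l := by
  rw [expand3, expand2, evalAt_pairWT, zero_add]
  by_cases h : r + s = 0 ∧ 0 ≤ s
  · rw [if_pos ⟨h.1, le_rfl, h.2⟩, if_pos h, coeff_coeffSer, if_pos (by simp)]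
    have h1 : (Finsupp.equivFunOnFinite.symm ![0, k, l] : Fin 3 →₀ ℕ) =
        Finsupp.mapDomain ![1, 2] (Finsupp.equivFunOnFinite.symm ![k, l]) := by
      have hi : Function.Injective (![1, 2] : Fin 2 → Fin 3) := by decide
      ext i
      fin_cases i
      · exact (Finsupp.mapDomain_of_notMem_range _ _ (by simp)).symm
      · exact (Finsupp.mapDomain_apply hi (Finsupp.equivFunOnFinite.symm ![k, l]) 0).symm
      · exact (Finsupp.mapDomain_apply hi (Finsupp.equivFunOnFinite.symm ![k, l]) 1).symm
    rw [h1, MvPolynomial.coeff_rename_mapDomain _ (by decide)]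
    rfl
  · rw [if_neg fun h' => h ⟨h'.1, h'.2.2⟩, if_neg h]

end EvalAt

/-! ### The factorization into tetrahedra -/

theorem ratio_tetraPair_mem (i : Fin 4) :
    (tetraPair i).ratio ∈ (Filt.F 1 : Submodule ℂ Ser) := by
  match i with
  | 0 => exact tw_mem
  | 1 => exact wz_mul_mem tw
  | 2 => exact wz_mem
  | 3 => exact shift_mem

theorem exponent5_eq_sum (w : Fin 4 → Fin 3 → ℂ) : exponent5 w = ∑ i : Fin 4,
    eVol (w (i.succAbove 0)) (w (i.succAbove 1)) (w (i.succAbove 2)) • hVol i := by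
  rw [Fin.sum_univ_four, exponent5]
  change _ = eVol (w 1) (w 2) (w 3) • rogersL pairWT + eVol (w 0) (w 2) (w 3) • rogersL pairZT +
    eVol (w 0) (w 1) (w 3) • rogersL pairZW + eVol (w 0) (w 1) (w 2) • rogersL pairShift
  abel

theorem formalExp_sum {ι : Type*} (s : Finset ι) (x : ι → Ser)
    (hx : ∀ i, x i ∈ (Filt.F 1 : Submodule ℂ Ser)) :
    formalExp (∑ i ∈ s, x i) = ∏ i ∈ s, formalExp (x i) := by
  classical
  induction s using Finset.induction_on with
  | empty =>
    rw [Finset.sum_empty, Finset.prod_empty, formalExp_eq_fexp (Submodule.zero_mem _), fexp_zero]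
  | insert a s ha ih =>
    have hs : ∑ i ∈ s, x i ∈ (Filt.F 1 : Submodule ℂ Ser) := Submodule.sum_mem _ fun i _ => hx i
    rw [Finset.sum_insert ha, Finset.prod_insert ha, ← ih, formalExp_eq_fexp (hx a),
      formalExp_eq_fexp hs, formalExp_eq_fexp (Submodule.add_mem _ (hx a) hs),
      fexp_add (hx a) hs (Commute.all _ _)]

theorem smul_hVol_mem (i : Fin 4) (ε : ℂ) : ε • hVol i ∈ (Filt.F 1 : Submodule ℂ Ser) := by
  have h := evalHom_mem (ratio_tetraPair_mem i) 1 _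
    (VertexData.mem_F_one_of_coeff_zero (coeff_zero_rogersSeries ε))
  rwa [evalHom_apply, evalAt_rogersSeries (ratio_tetraPair_mem i)] at h

end HDFT

theorem proposition2 :
    (∀ (w : Fin 4 → Fin 3 → ℂ) (ψ : HDFT.Pt → ℂ), MemLp ψ 2 (volume.restrict HDFT.cube) →
      ∀ (a b c : ℤ) (k l m : ℕ),
        HDFT.corr5 ψ w a b c k l m =
          HDFT.expand3 (HDFT.formalExp (HDFT.exponent5 w)) a b c k l m *
            HDFT.groundPair ψ (HDFT.expState (∑ i, w i))) ∧
    (∀ (n : Fin 4 → Fin 3 → ℤ) (w : Fin 4 → Fin 3 → ℂ), (∀ i, w i = HDFT.winding (n i)) →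
      (∀ (a b c : ℤ) (k l m : ℕ),
        HDFT.corr5 (HDFT.expState (∑ i, w i) : HDFT.Pt → ℂ) w a b c k l m =
          HDFT.expand3 (HDFT.formalExp (HDFT.exponent5 w)) a b c k l m) ∧
      ∃ p : Fin 4 → PowerSeries (MvPolynomial (Fin 2) ℂ),
        (∀ (i : Fin 4) (r s : ℤ) (k l : ℕ),
          HDFT.corr4 (HDFT.expState (∑ j, w (i.succAbove j)) : HDFT.Pt → ℂ)
              (fun j => w (i.succAbove j)) r s k l =
            HDFT.expand2 (p i) r s k l) ∧
        (∀ i : Fin 4,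
          HDFT.evalAt (p i) (HDFT.tetraPair i) =
            HDFT.formalExp
              (HDFT.eVol (w (i.succAbove 0)) (w (i.succAbove 1)) (w (i.succAbove 2)) •
                HDFT.hVol i)) ∧
        ∀ (a b c : ℤ) (k l m : ℕ),
          HDFT.corr5 (HDFT.expState (∑ i, w i) : HDFT.Pt → ℂ) w a b c k l m =
            HDFT.expand3 (∏ i, HDFT.evalAt (p i) (HDFT.tetraPair i)) a b c k l m) := by
  refine ⟨fun w ψ _ a b c k l m => HDFT.corr5_eq w ψ a b c k l m, fun n w hw => ?_⟩
  obtain rfl : w = fun i => HDFT.winding (n i) := funext hw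
  have h1 : ∀ (a b c : ℤ) (k l m : ℕ), HDFT.corr5 (HDFT.expState (∑ i, HDFT.winding (n i)) :
      HDFT.Pt → ℂ) (fun i => HDFT.winding (n i)) a b c k l m = HDFT.expand3 (HDFT.formalExp
        (HDFT.exponent5 fun i => HDFT.winding (n i))) a b c k l m := fun a b c k l m => by
    rw [HDFT.corr5_eq, HDFT.sum_winding, HDFT.groundPair_winding, mul_one]
  have h2 : ∀ i : Fin 4, HDFT.evalAt (HDFT.serExp (HDFT.rogersSeries (HDFT.eVol
      (HDFT.winding (n (i.succAbove 0))) (HDFT.winding (n (i.succAbove 1)))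
        (HDFT.winding (n (i.succAbove 2)))))) (HDFT.tetraPair i) = HDFT.formalExp (HDFT.eVol
      (HDFT.winding (n (i.succAbove 0))) (HDFT.winding (n (i.succAbove 1)))
        (HDFT.winding (n (i.succAbove 2))) • HDFT.hVol i) := fun i =>
    HDFT.evalAt_serExp (HDFT.ratio_tetraPair_mem i) _
  refine ⟨h1, fun i => HDFT.serExp (HDFT.rogersSeries (HDFT.eVol
      (HDFT.winding (n (i.succAbove 0))) (HDFT.winding (n (i.succAbove 1)))
        (HDFT.winding (n (i.succAbove 2))))), fun i r s k l => ?_, h2, fun a b c k l m => ?_⟩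
  · rw [HDFT.corr4_eq, HDFT.sum_winding, HDFT.groundPair_winding, mul_one,
      ← HDFT.evalAt_serExp HDFT.tw_mem]
    exact HDFT.expand3_evalAt _ r s k l
  · rw [h1, HDFT.exponent5_eq_sum, HDFT.formalExp_sum _ _ fun i => HDFT.smul_hVol_mem i _]
    simp only [h2]
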